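/- **Setting.** Let $0\le\alpha<1$, $\mu\le\mu(\alpha):=\frac{(1-\alpha)^2}{4}$, and put $\nu=\frac{2}{2-\alpha}\sqrt{\mu(\alpha)-\mu}$. Let $J_\nu$ be the Bessel function of the first kind of order $\nu$, let $0<j_{\nu,1}<j_{\nu,2}<\cdots$ be its positive zeros, and for $n\ge 1$, $x\in(0,1)$ let $$\Phi_n(x)=\frac{\sqrt{2-\alpha}}{|J_\nu'(j_{\nu,n})|}\,x^{\frac{1-\alpha}{2}}\,J_\nu\big(j_{\nu,n}x^{\frac{2-\alpha}{2}}\big).$$ Let $A=\begin{pmatrix}0&a_1\\1&a_2\end{pmatrix}$ with $a_1,a_2\in\mathbb R$, $a_1\neq0$ and $\Delta:=a_2^2+4a_1\ne0$. Its eigenvalues are $\alpha_1=\frac12(a_2-\sqrt{\Delta})$, $\alpha_2=\frac12(a_2+\sqrt{\Delta})$ if $\Delta>0$, and $\alpha_1=\frac12(a_2+i\sqrt{-\Delta})$, $\alpha_2=\frac12(a_2-i\sqrt{-\Delta})$ if $\Delta<0$. The scalar field is $\mathbb K=\mathbb R$ or $\mathbb C$, with $\mathbb K=\mathbb C$ if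 $\Delta<0$; all function spaces consist of $\mathbb K$-valued functions. Put $$U_1=\frac{a_1}{\alpha_2^2+a_1}\begin{pmatrix}-\alpha_2\\1\end{pmatrix},\quad U_2=\begin{pmatrix}-\alpha_1\\1\end{pmatrix},\quad V_1=\begin{pmatrix}-\alpha_2/a_1\\1\end{pmatrix},\quad V_2=\frac{a_1}{\alpha_1^2+a_1}\begin{pmatrix}-\alpha_1/a_1\\1\end{pmatrix},$$ $\psi_n^{(i)}=U_i\Phi_n$, $\Psi_n^{(i)}=V_i\Phi_n$ (the eigenfunctions of $Ly=-(x^\alpha y_x)_x-\frac{\mu}{x^{2-\alpha}}y-Ay$ and of $L^*$, the same operator with $A$ replaced by its transpose, under homogeneous Dirichlet conditions), and $$\mathcal B=\{\psi_n^{(1)},\psi_n^{(2)}:n\ge1\},\qquad \mathcal B^*=\{\Psi_n^{(1)},\Psi_n^{(2)}:n\ge1\}.$$ Let $H^{1,\mu}_{\alpha,0}(0,1)\subset L^2(0,1)$ be the Hilbert space obtained by completing $C_c^\infty(0,1)$ in the norm $$\|z\|^2=\int_0^1\Big(|z|^2+x^\alpha|z_x|^2-\frac{\mu}{x^{2-\alpha}}|z|^2\Big)dx,$$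 and let $H^{-1,\mu}_\alpha(0,1)$ be its dual, with $L^2(0,1)$ as pivot space, i.e. $f\in L^2(0,1)$ is identified with the functional $h\mapsto\int_0^1 fh\,dx$. Pairings are bilinear: $\langle f,g\rangle=\int_0^1(f_1g_1+f_2g_2)\,dx$ on $L^2(0,1)^2$, and $\langle F,h\rangle=F_1(h_1)+F_2(h_2)$ for $F\in H^{-1,\mu}_\alpha(0,1)^2$, $h\in H^{1,\mu}_{\alpha,0}(0,1)^2$. **Proposition 3.6.** 1. $\mathcal B$ and $\mathcal B^*$ are biorthogonal in $L^2(0,1)^2$: $\langle\psi_n^{(i)},\Psi_k^{(j)}\rangle=\delta_{ij}\delta_{nk}$ for all $n,k\ge1$, $i,j\in\{1,2\}$. 2. $\mathcal B$ and $\mathcal B^*$ are complete in $L^2(0,1)^2$: each has dense linear span. 3. $\mathcal B$ and $\mathcal B^*$ are (biorthogonal) Riesz bases of $L^2(0,1)^2$: each is the image of an orthonormal basis under a bounded linear operator with bounded inverse. 4. $\mathcal B^*\subset H^{1,\mu}_{\alpha,0}(0,1)^2$, and the sequence $\Psi_1^{(1)},\Psi_1^{(2)},\Psi_2^{(1)},\Psi_2^{(2)},\dots$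 is a Schauder basis of $H^{1,\mu}_{\alpha,0}(0,1)^2$; moreover $\mathcal B$, regarded in $H^{-1,\mu}_\alpha(0,1)^2$, is biorthogonal to $\mathcal B^*$ for the duality pairing, and $\psi_1^{(1)},\psi_1^{(2)},\psi_2^{(1)},\psi_2^{(2)},\dots$ is a Schauder basis of $H^{-1,\mu}_\alpha(0,1)^2$. -/

import Mathlib

noncomputable section

namespace DegSing

open MeasureTheory Set Filter Topology
open scoped Distributions ContDiff InnerProductSpace

/-- The parameters of the degenerate/singular operator: `0 ≤ α < 1`, `μ ≤ (1 - α)² / 4`. -/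
structure Params where
  α : ℝ
  μ : ℝ
  α_nonneg : 0 ≤ α
  α_lt_one : α < 1
  μ_le : μ ≤ (1 - α) ^ 2 / 4

/-- Lebesgue measure on `(0,1)`. -/
abbrev vol01 : Measure ℝ := volume.restrict (Ioo 0 1)

/-- The scalar space `L²(0,1)`. -/
abbrev L2 (𝕜 : Type*) [RCLike 𝕜] : Type _ := Lp 𝕜 2 vol01

/-- The space `L²(0,1)²`. -/
abbrev L2sq (𝕜 : Type*) [RCLike 𝕜] : Type _ := PiLp 2 (fun _ : Fin 2 => L2 𝕜)

/-- The scalar pairing `∫₀¹ f g` (bilinear, no complex conjugation). -/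
def pairing {𝕜 : Type*} [RCLike 𝕜] (f g : L2 𝕜) : 𝕜 := ∫ x in Ioo (0 : ℝ) 1, f x * g x

/-- The pairing `∫₀¹ (f₁ g₁ + f₂ g₂)` on `L²(0,1)²`. -/
def pairingSq {𝕜 : Type*} [RCLike 𝕜] (f g : L2sq 𝕜) : 𝕜 := ∑ i, pairing (f i) (g i)

/-! ### Bessel functions, their zeros, and the eigenfunctions -/

/-- The `m`-th term of the series of `J_ν(x)`. -/
def besselTerm (ν : ℝ) (m : ℕ) (x : ℝ) : ℝ :=
  (-1) ^ m / ((m.factorial : ℝ) * Real.Gamma (1 + ν + m)) * (x / 2) ^ (2 * (m : ℝ) + ν)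

/-- The Bessel function of the first kind `J_ν(x)`, for `ν ≥ 0` and `x ≥ 0`. -/
def besselJ (ν x : ℝ) : ℝ := ∑' m : ℕ, besselTerm ν m x

/-- The positive zeros of `J_ν` in increasing order; `besselZero ν n` is `j_{ν,n+1}`. -/
def besselZero (ν : ℝ) : ℕ → ℝ
  | 0 => sInf {x | 0 < x ∧ besselJ ν x = 0}
  | n + 1 => sInf {x | besselZero ν n < x ∧ besselJ ν x = 0}

lemma besselZero_nonneg (ν : ℝ) (n : ℕ) : 0 ≤ besselZero ν n := by
  induction n with
  | zero => exact Real.sInf_nonneg fun x hx => hx.1.le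
  | succ n ih => exact Real.sInf_nonneg fun x hx => ih.trans hx.1.le

lemma gamma_le (ν : ℝ) (hν : 0 ≤ ν) (m : ℕ) :
    Real.Gamma (1 + ν) ≤ Real.Gamma (1 + ν + m) := by
  induction m with
  | zero => simp
  | succ m ih =>
    have h0 : 0 < 1 + ν + m := by positivity
    have h1 : 1 + ν + ((m + 1 : ℕ) : ℝ) = (1 + ν + m) + 1 := by push_cast; ring
    rw [h1, Real.Gamma_add_one h0.ne']
    have := Real.Gamma_pos_of_pos h0
    have h2 : 1 ≤ 1 + ν + m := by have : (0:ℝ) ≤ m := by positivity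
                                  linarith
    nlinarith

lemma continuousOn_besselJ (ν : ℝ) (hν : 0 ≤ ν) (R : ℝ) (hR : 0 < R) :
    ContinuousOn (besselJ ν) (Icc 0 R) := by
  have hG : 0 < Real.Gamma (1 + ν) := Real.Gamma_pos_of_pos (by linarith)
  refine continuousOn_tsum (u := fun m : ℕ => (R / 2) ^ ν / Real.Gamma (1 + ν) *
    (((R / 2) ^ 2) ^ m / (m.factorial : ℝ))) ?_ ?_ ?_
  · intro m
    unfold besselTerm
    refine (continuous_const.mul ?_).continuousOn
    exact (Real.continuous_rpow_const (by positivity)).comp (continuous_id.div_const 2)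
  · exact (Real.summable_pow_div_factorial _).mul_left _
  · intro m x hx
    have hGm := gamma_le ν hν m
    have hGm0 : 0 < Real.Gamma (1 + ν + m) := hG.trans_le hGm
    have hf : (0 : ℝ) < m.factorial := by positivity
    have hpow : (x / 2) ^ (2 * (m : ℝ) + ν) ≤ ((R / 2) ^ 2) ^ m * (R / 2) ^ ν := by
      calc (x / 2) ^ (2 * (m : ℝ) + ν) ≤ (R / 2) ^ (2 * (m : ℝ) + ν) :=
            Real.rpow_le_rpow (by linarith [hx.1]) (by linarith [hx.2]) (by positivity)
        _ = _ := by
            rw [Real.rpow_add (by positivity), Real.rpow_mul (by positivity), Real.rpow_natCast]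
            norm_num
    have hx0 : 0 ≤ (x / 2) ^ (2 * (m : ℝ) + ν) := Real.rpow_nonneg (by linarith [hx.1]) _
    unfold besselTerm
    rw [norm_mul, norm_div, norm_pow, norm_neg, norm_one, one_pow, Real.norm_of_nonneg hx0,
      Real.norm_of_nonneg (by positivity)]
    calc 1 / ((m.factorial : ℝ) * Real.Gamma (1 + ν + m)) * (x / 2) ^ (2 * (m : ℝ) + ν)
        ≤ 1 / ((m.factorial : ℝ) * Real.Gamma (1 + ν)) * (((R / 2) ^ 2) ^ m * (R / 2) ^ ν) := by
          gcongr
      _ = _ := by field_simp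

/-- The order `ν(α,μ) = 2 / (2 - α) * √((1 - α)² / 4 - μ)`. -/
def Params.ν (P : Params) : ℝ := 2 / (2 - P.α) * √((1 - P.α) ^ 2 / 4 - P.μ)

lemma Params.ν_nonneg (P : Params) : 0 ≤ P.ν := by
  have := P.α_lt_one
  have : 0 < 2 - P.α := by linarith
  unfold Params.ν
  positivity

/-- The function `Φ_{α,μ,n+1}(x) =
`√(2-α) / |J_ν'(j)| * x^((1-α)/2) * J_ν(j x^((2-α)/2))` with `ν = ν(α,μ)`, `j = j_{ν,n+1}`. -/
def phiFun (P : Params) (n : ℕ) (x : ℝ) : ℝ :=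
  √(2 - P.α) / |deriv (besselJ P.ν) (besselZero P.ν n)| * x ^ ((1 - P.α) / 2) *
    besselJ P.ν (besselZero P.ν n * x ^ ((2 - P.α) / 2))

lemma memLp_phiFun (𝕜 : Type*) [RCLike 𝕜] (P : Params) (n : ℕ) :
    MemLp (fun x => (phiFun P n x : 𝕜)) 2 vol01 := by
  have h1 := P.α_lt_one
  have hj := besselZero_nonneg P.ν n
  have hc : ContinuousOn (fun x => (phiFun P n x : 𝕜)) (Icc 0 1) := by
    refine RCLike.continuous_ofReal.comp_continuousOn ?_
    unfold phiFun
    refine ContinuousOn.mul (continuousOn_const.mul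
      (Real.continuous_rpow_const (by linarith)).continuousOn) ?_
    refine (continuousOn_besselJ P.ν P.ν_nonneg (besselZero P.ν n + 1) (by linarith)).comp
      (continuous_const.mul (Real.continuous_rpow_const (by linarith))).continuousOn ?_
    intro x hx
    have hx1 : x ^ ((2 - P.α) / 2) ≤ 1 := Real.rpow_le_one hx.1 hx.2 (by linarith)
    have hx0 : 0 ≤ x ^ ((2 - P.α) / 2) := Real.rpow_nonneg hx.1 _
    exact ⟨by positivity, by nlinarith⟩
  obtain ⟨C, hC⟩ := isCompact_Icc.exists_bound_of_continuousOn hc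
  refine MemLp.of_bound ((hc.mono Ioo_subset_Icc_self).aestronglyMeasurable measurableSet_Ioo) C ?_
  exact (ae_restrict_mem measurableSet_Ioo).mono fun x hx => hC x (Ioo_subset_Icc_self hx)

/-- `Φ_{α,μ,n+1}` as an element of `L²(0,1)`. -/
def phi (𝕜 : Type*) [RCLike 𝕜] (P : Params) (n : ℕ) : L2 𝕜 := (memLp_phiFun 𝕜 P n).toLp _

/-! ### The coupling matrix `A = !![0, a₁; 1, a₂]` -/

/-- The eigenvalue `α₁` of `A`: `(a₂ - √(a₂² + 4a₁)) / 2` if `a₂² + 4a₁ > 0`, and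
`(a₂ + i √(-(a₂² + 4a₁))) / 2` otherwise. -/
def eig1 (𝕜 : Type*) [RCLike 𝕜] (a₁ a₂ : ℝ) : 𝕜 :=
  if 0 < a₂ ^ 2 + 4 * a₁ then (((a₂ - √(a₂ ^ 2 + 4 * a₁)) / 2 : ℝ) : 𝕜)
  else ((a₂ : 𝕜) + RCLike.I * (√(-(a₂ ^ 2 + 4 * a₁)) : ℝ)) / 2

/-- The eigenvalue `α₂` of `A`: `(a₂ + √(a₂² + 4a₁)) / 2` if `a₂² + 4a₁ > 0`, and
`(a₂ - i √(-(a₂² + 4a₁))) / 2` otherwise. -/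
def eig2 (𝕜 : Type*) [RCLike 𝕜] (a₁ a₂ : ℝ) : 𝕜 :=
  if 0 < a₂ ^ 2 + 4 * a₁ then (((a₂ + √(a₂ ^ 2 + 4 * a₁)) / 2 : ℝ) : 𝕜)
  else ((a₂ : 𝕜) - RCLike.I * (√(-(a₂ ^ 2 + 4 * a₁)) : ℝ)) / 2

/-- The vectors `U₁ = a₁ / (α₂² + a₁) (-α₂, 1)` and `U₂ = (-α₁, 1)`. -/
def vecU (𝕜 : Type*) [RCLike 𝕜] (a₁ a₂ : ℝ) : Fin 2 → Fin 2 → 𝕜 :=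
  ![((a₁ : 𝕜) / (eig2 𝕜 a₁ a₂ ^ 2 + a₁)) • ![-eig2 𝕜 a₁ a₂, 1], ![-eig1 𝕜 a₁ a₂, 1]]

/-- The vectors `V₁ = (-α₂ / a₁, 1)` and `V₂ = a₁ / (α₁² + a₁) (-α₁ / a₁, 1)`. -/
def vecV (𝕜 : Type*) [RCLike 𝕜] (a₁ a₂ : ℝ) : Fin 2 → Fin 2 → 𝕜 :=
  ![![-eig2 𝕜 a₁ a₂ / a₁, 1],
    ((a₁ : 𝕜) / (eig1 𝕜 a₁ a₂ ^ 2 + a₁)) • ![-eig1 𝕜 a₁ a₂ / a₁, 1]]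

/-- The family `ℬ`: `familyB (n, i)` is `ψ_{n+1}^{(i+1)} = U_{i+1} Φ_{n+1}`. -/
def familyB (𝕜 : Type*) [RCLike 𝕜] (P : Params) (a₁ a₂ : ℝ) (k : ℕ × Fin 2) : L2sq 𝕜 :=
  WithLp.toLp 2 fun c => vecU 𝕜 a₁ a₂ k.2 c • phi 𝕜 P k.1

/-- The family `ℬ*`: `familyBstar (n, i)` is `Ψ_{n+1}^{(i+1)} = V_{i+1} Φ_{n+1}`. -/
def familyBstar (𝕜 : Type*) [RCLike 𝕜] (P : Params) (a₁ a₂ : ℝ) (k : ℕ × Fin 2) : L2sq 𝕜 :=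
  WithLp.toLp 2 fun c => vecV 𝕜 a₁ a₂ k.2 c • phi 𝕜 P k.1

/-- The order `(1,1), (1,2), (2,1), (2,2), …` in which the families are listed as sequences. -/
def idx : ℕ ≃ ℕ × Fin 2 := Nat.divModEquiv 2

/-! ### Riesz bases -/

/-- A Riesz basis of a Hilbert space: the image of an orthonormal basis under a bounded linear
operator with bounded inverse. -/
def IsRieszBasis (𝕜 : Type*) [RCLike 𝕜] {ι E : Type*} [NormedAddCommGroup E]
    [InnerProductSpace 𝕜 E] (f : ι → E) : Prop :=
  ∃ (e : HilbertBasis ι 𝕜 E) (T : E ≃L[𝕜] E), ∀ k, f k = T (e k)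

/-! ### The space `H^{1,μ}_{α,0}(0,1)`

It is the completion of `C_c^∞(0,1)` for the inner product
`∫₀¹ (φ ψ + x^α φ' ψ' - μ / x^(2-α) φ ψ) dx` (with a complex conjugation on the first factor over
`ℂ`). By Hardy's inequality this is positive; `embed` is the (injective) inclusion in `L²(0,1)`. -/

/-- The open interval `(0,1)`. -/
def unitIoo : TopologicalSpace.Opens ℝ := ⟨Ioo 0 1, isOpen_Ioo⟩

/-- The space `C_c^∞(0,1)`, to be endowed with the energy norm (not with its usual topology). -/
def TestSpace (𝕜 : Type*) [RCLike 𝕜] (_P : Params) : Type _ := 𝓓(unitIoo, 𝕜)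

section TestSpace

variable {𝕜 : Type*} [RCLike 𝕜] {P : Params}

instance : AddCommGroup (TestSpace 𝕜 P) := inferInstanceAs (AddCommGroup 𝓓(unitIoo, 𝕜))

instance : Module 𝕜 (TestSpace 𝕜 P) := inferInstanceAs (Module 𝕜 𝓓(unitIoo, 𝕜))

/-- The underlying function. -/
def TestSpace.toFun (f : TestSpace 𝕜 P) : ℝ → 𝕜 := TestFunction.toFun (Ω := unitIoo) (n := ⊤) f

instance : CoeFun (TestSpace 𝕜 P) (fun _ => ℝ → 𝕜) := ⟨TestSpace.toFun⟩

lemma TestSpace.contDiff (f : TestSpace 𝕜 P) : ContDiff ℝ ∞ f :=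
  TestFunction.contDiff' (Ω := unitIoo) (n := ⊤) f

lemma TestSpace.hasCompactSupport (f : TestSpace 𝕜 P) : HasCompactSupport f :=
  TestFunction.hasCompactSupport' (Ω := unitIoo) (n := ⊤) f

lemma TestSpace.tsupport_subset (f : TestSpace 𝕜 P) : tsupport f ⊆ Ioo 0 1 :=
  TestFunction.tsupport_subset' (Ω := unitIoo) (n := ⊤) f

lemma TestSpace.differentiable (f : TestSpace 𝕜 P) : Differentiable ℝ f :=
  f.contDiff.differentiable (by simp)

lemma TestSpace.contDiff_deriv (f : TestSpace 𝕜 P) : ContDiff ℝ ∞ (deriv f) :=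
  ((contDiff_infty_iff_deriv).1 f.contDiff).2

lemma TestSpace.add_apply (f g : TestSpace 𝕜 P) (x : ℝ) : (f + g) x = f x + g x := rfl

lemma TestSpace.smul_apply (c : 𝕜) (f : TestSpace 𝕜 P) (x : ℝ) : (c • f) x = c * f x := rfl

lemma TestSpace.deriv_add (f g : TestSpace 𝕜 P) (x : ℝ) :
    deriv (f + g : TestSpace 𝕜 P) x = deriv f x + deriv g x :=
  ((f.differentiable x).hasDerivAt.add (g.differentiable x).hasDerivAt).deriv

lemma TestSpace.deriv_smul (c : 𝕜) (f : TestSpace 𝕜 P) (x : ℝ) :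
    deriv (c • f : TestSpace 𝕜 P) x = c * deriv f x :=
  ((f.differentiable x).hasDerivAt.const_mul c).deriv

/-- The integrand of the energy inner product. -/
def energyIntegrand (f g : TestSpace 𝕜 P) (x : ℝ) : 𝕜 :=
  inner 𝕜 (f x) (g x) + (x ^ P.α) • inner 𝕜 (deriv f x) (deriv g x)
    - (P.μ / x ^ (2 - P.α)) • inner 𝕜 (f x) (g x)

/-- The energy inner product. -/
def energyInner (f g : TestSpace 𝕜 P) : 𝕜 := ∫ x in Ioo (0 : ℝ) 1, energyIntegrand f g x

lemma integrable_weight {F : Type*} [NormedAddCommGroup F] [NormedSpace ℝ F] {w : ℝ → ℝ}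
    {f : ℝ → F} (hw : ContinuousOn w (Ioo 0 1)) (hf : Continuous f) (hc : HasCompactSupport f)
    (hs : tsupport f ⊆ Ioo 0 1) : Integrable (fun x => w x • f x) := by
  have h : IntegrableOn (fun x => w x • f x) (tsupport f) :=
    ((hw.mono hs).smul hf.continuousOn).integrableOn_compact hc
  refine (integrableOn_iff_integrable_of_support_subset ?_).1 h
  intro x hx
  refine subset_tsupport f ?_
  intro h0
  exact hx (by simp [h0])

lemma integral_parts {F : Type*} [NormedAddCommGroup F] [NormedSpace ℝ F] [CompleteSpace F]
    {w w' : ℝ → ℝ} {f f' : ℝ → F} (hw : ∀ x ∈ Ioo (0 : ℝ) 1, HasDerivAt w (w' x) x)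
    (hw' : ContinuousOn w' (Ioo 0 1)) (hf : ∀ x, HasDerivAt f (f' x) x) (hf' : Continuous f')
    (hc : HasCompactSupport f) (hs : tsupport f ⊆ Ioo 0 1) :
    (∫ x in Ioo (0 : ℝ) 1, w x • f' x) = - ∫ x in Ioo (0 : ℝ) 1, w' x • f x := by
  have hfc : Continuous f := continuous_iff_continuousAt.2 fun x => (hf x).continuousAt
  have hd : f' = deriv f := funext fun x => (hf x).deriv.symm
  have hsf' : tsupport f' ⊆ tsupport f := by
    rw [hd]; exact closure_minimal (support_deriv_subset) (isClosed_tsupport f)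
  have hc' : HasCompactSupport f' := by rw [hd]; exact hc.deriv
  have hwc : ContinuousOn w (Ioo 0 1) := fun x hx => (hw x hx).continuousAt.continuousWithinAt
  have i1 := integrable_weight hwc hf' hc' (hsf'.trans hs)
  have i2 := integrable_weight hw' hfc hc hs
  have i3 := integrable_weight hwc hfc hc hs
  have hz : ∀ x, x ∉ Ioo (0 : ℝ) 1 → f x = 0 ∧ f' x = 0 := fun x hx =>
    ⟨image_eq_zero_of_notMem_tsupport fun h => hx (hs h),
      image_eq_zero_of_notMem_tsupport fun h => hx (hs (hsf' h))⟩
  rw [setIntegral_eq_integral_of_forall_compl_eq_zero (fun x hx => by simp [(hz x hx).2]),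
    setIntegral_eq_integral_of_forall_compl_eq_zero (fun x hx => by simp [(hz x hx).1])]
  have key : ∫ x, (w x • f' x + w' x • f x) = 0 := by
    refine integral_eq_zero_of_hasDerivAt_of_integrable (f := fun x => w x • f x) ?_ (i1.add i2) i3
    intro x
    by_cases hx : x ∈ tsupport f
    · exact (hw x (hs hx)).smul (hf x)
    · have h1 : f =ᶠ[𝓝 x] 0 := notMem_tsupport_iff_eventuallyEq.1 hx
      have h2 : f' x = 0 := image_eq_zero_of_notMem_tsupport fun h => hx (hsf' h)
      have h3 : f x = 0 := h1.self_of_nhds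
      rw [h2, h3, smul_zero, smul_zero, add_zero]
      refine (hasDerivAt_const x (0 : F)).congr_of_eventuallyEq ?_
      filter_upwards [h1] with y hy
      simp [hy]
  rw [integral_add i1 i2] at key
  exact eq_neg_of_add_eq_zero_left key

lemma continuousOn_rpow (s : ℝ) : ContinuousOn (fun x : ℝ => x ^ s) (Ioo 0 1) :=
  fun x hx => (Real.continuousAt_rpow_const x s (Or.inl hx.1.ne')).continuousWithinAt

lemma TestSpace.tsupport_deriv (f : TestSpace 𝕜 P) : tsupport (deriv f) ⊆ tsupport f :=
  closure_minimal support_deriv_subset (isClosed_tsupport f)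

lemma tsupport_inner_subset (f g : ℝ → 𝕜) :
    tsupport (fun x => inner 𝕜 (f x) (g x)) ⊆ tsupport f := by
  refine closure_mono fun x hx h0 => hx ?_
  have h0' : f x = 0 := h0
  simp [h0']

lemma integrable_inner {w : ℝ → ℝ} (hw : ContinuousOn w (Ioo 0 1)) (f : TestSpace 𝕜 P)
    {u v : ℝ → 𝕜} (hu : Continuous u) (hv : Continuous v) (hs : tsupport u ⊆ tsupport f) :
    Integrable (fun x => w x • inner 𝕜 (u x) (v x)) := by
  have h := (tsupport_inner_subset u v).trans hs
  exact integrable_weight hw (hu.inner hv)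
    (f.hasCompactSupport.of_isClosed_subset (isClosed_tsupport _) h) (h.trans f.tsupport_subset)

lemma continuousOn_pot (P : Params) :
    ContinuousOn (fun x : ℝ => P.μ / x ^ (2 - P.α)) (Ioo 0 1) :=
  continuousOn_const.div (continuousOn_rpow _) fun _ hx => (Real.rpow_pos_of_pos hx.1 _).ne'

lemma integrable_energy1 (f g : TestSpace 𝕜 P) : Integrable (fun x => inner 𝕜 (f x) (g x)) := by
  simpa using integrable_inner (w := fun _ => 1) continuousOn_const f f.contDiff.continuous
    g.contDiff.continuous subset_rfl

lemma integrable_energy2 (f g : TestSpace 𝕜 P) :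
    Integrable (fun x => (x ^ P.α) • inner 𝕜 (deriv f x) (deriv g x)) :=
  integrable_inner (continuousOn_rpow _) f f.contDiff_deriv.continuous
    g.contDiff_deriv.continuous f.tsupport_deriv

lemma integrable_energy3 (f g : TestSpace 𝕜 P) :
    Integrable (fun x => (P.μ / x ^ (2 - P.α)) • inner 𝕜 (f x) (g x)) :=
  integrable_inner (continuousOn_pot P) f f.contDiff.continuous g.contDiff.continuous subset_rfl

lemma integrable_energy (f g : TestSpace 𝕜 P) : Integrable (energyIntegrand f g) :=
  ((integrable_energy1 f g).add (integrable_energy2 f g)).sub (integrable_energy3 f g)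

/-- Hardy's inequality, in the form
`‖φ‖²_{L²} ≤ ‖φ‖²_{L²} + ∫₀¹ (x^α |φ'|² - μ / x^(2-α) |φ|²)`. -/
lemma hardy (f : TestSpace 𝕜 P) :
    ∫ x in Ioo (0 : ℝ) 1, ‖f x‖ ^ 2 ≤ RCLike.re (energyInner f f) := by
  set p : ℝ := (1 - P.α) / 2 with hp
  have hre : RCLike.re (energyInner f f) = ∫ x in Ioo (0 : ℝ) 1,
      (‖f x‖ ^ 2 + x ^ P.α * ‖deriv f x‖ ^ 2 - P.μ / x ^ (2 - P.α) * ‖f x‖ ^ 2) := by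
    unfold energyInner
    rw [← integral_re (integrable_energy f f).integrableOn]
    refine integral_congr_ae (Eventually.of_forall fun x => ?_)
    simp only [energyIntegrand, map_sub, map_add, RCLike.smul_re, inner_self_eq_norm_sq]
  have i1 : Integrable (fun x => ‖f x‖ ^ 2) := by
    simpa only [inner_self_eq_norm_sq] using (integrable_energy1 f f).re
  have i2 : Integrable (fun x => x ^ P.α * ‖deriv f x‖ ^ 2) := by
    simpa only [inner_self_eq_norm_sq, RCLike.smul_re] using (integrable_energy2 f f).re
  have i3 : Integrable (fun x => P.μ / x ^ (2 - P.α) * ‖f x‖ ^ 2) := by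
    simpa only [inner_self_eq_norm_sq, RCLike.smul_re] using (integrable_energy3 f f).re
  have hcs : HasCompactSupport (fun x => ‖f x‖ ^ 2) :=
    f.hasCompactSupport.comp_left (g := fun z : 𝕜 => ‖z‖ ^ 2) (by simp)
  have hts : tsupport (fun x => ‖f x‖ ^ 2) ⊆ Ioo 0 1 := by
    refine (closure_mono ?_).trans f.tsupport_subset
    intro x hx h0
    have h0' : f x = 0 := h0
    exact hx (by simp [h0'])
  have hfd : ∀ x, HasDerivAt (fun x => ‖f x‖ ^ 2) (2 * inner ℝ (f x) (deriv f x)) x :=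
    fun x => (f.differentiable x).hasDerivAt.norm_sq
  have hcont' : Continuous fun x => 2 * inner ℝ (f x) (deriv f x) :=
    continuous_const.mul (f.contDiff.continuous.inner f.contDiff_deriv.continuous)
  have hwd : ∀ x ∈ Ioo (0 : ℝ) 1,
      HasDerivAt (fun x : ℝ => x ^ (P.α - 1)) ((P.α - 1) * x ^ (P.α - 1 - 1)) x :=
    fun x hx => Real.hasDerivAt_rpow_const (Or.inl hx.1.ne')
  have hparts := integral_parts hwd (continuousOn_const.mul (continuousOn_rpow _)) hfd hcont'
    hcs hts
  have i4 : Integrable (fun x : ℝ => ((P.α - 1) * x ^ (P.α - 1 - 1)) • ‖f x‖ ^ 2) :=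
    integrable_weight (continuousOn_const.mul (continuousOn_rpow _))
      (f.contDiff.continuous.norm.pow 2) hcs hts
  have i5 : Integrable (fun x : ℝ => x ^ (P.α - 1) • (2 * inner ℝ (f x) (deriv f x))) := by
    have hd : (fun x => 2 * inner ℝ (f x) (deriv f x)) = deriv (fun x => ‖f x‖ ^ 2) :=
      funext fun x => (hfd x).deriv.symm
    refine integrable_weight (continuousOn_rpow _) hcont' (by rw [hd]; exact hcs.deriv) ?_
    rw [hd]
    exact (closure_minimal support_deriv_subset (isClosed_tsupport _)).trans hts
  have hsum : ∫ x in Ioo (0 : ℝ) 1, p * (x ^ (P.α - 1) • (2 * inner ℝ (f x) (deriv f x)) +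
      ((P.α - 1) * x ^ (P.α - 1 - 1)) • ‖f x‖ ^ 2) = 0 := by
    rw [integral_const_mul, integral_add i5.integrableOn i4.integrableOn, hparts,
      neg_add_cancel, mul_zero]
  rw [hre]
  have hle : ∫ x in Ioo (0 : ℝ) 1, (‖f x‖ ^ 2 +
      p * (x ^ (P.α - 1) • (2 * inner ℝ (f x) (deriv f x)) +
      ((P.α - 1) * x ^ (P.α - 1 - 1)) • ‖f x‖ ^ 2)) ≤ ∫ x in Ioo (0 : ℝ) 1,
      (‖f x‖ ^ 2 + x ^ P.α * ‖deriv f x‖ ^ 2 - P.μ / x ^ (2 - P.α) * ‖f x‖ ^ 2) := by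
    refine setIntegral_mono_on (i1.add ((i5.add i4).const_mul p)).integrableOn
      ((i1.add i2).sub i3).integrableOn measurableSet_Ioo fun x hx => ?_
    have hx0 : 0 < x := hx.1
    have e1 : x ^ (P.α - 1) = x ^ P.α * x⁻¹ := by
      rw [Real.rpow_sub hx0, Real.rpow_one, div_eq_mul_inv]
    have e2 : x ^ (P.α - 1 - 1) = x ^ P.α * x⁻¹ * x⁻¹ := by
      rw [Real.rpow_sub hx0, e1, Real.rpow_one, div_eq_mul_inv]
    have e3 : P.μ / x ^ (2 - P.α) = P.μ * (x ^ P.α * x⁻¹ * x⁻¹) := by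
      rw [← e2, div_eq_mul_inv, ← Real.rpow_neg hx0.le]; congr 2; ring
    have hin : inner ℝ (f x) (deriv f x) ≤ ‖f x‖ * ‖deriv f x‖ := real_inner_le_norm _ _
    have hxa : 0 < x ^ P.α := Real.rpow_pos_of_pos hx0 _
    have hsq : 0 ≤ ‖deriv f x - (p * x⁻¹) • f x‖ ^ 2 := by positivity
    rw [@norm_sub_sq_real, norm_smul, inner_smul_right, real_inner_comm, mul_pow,
      Real.norm_eq_abs, sq_abs] at hsq
    have hmu : 0 ≤ (p ^ 2 - P.μ) * (x⁻¹ * x⁻¹ * ‖f x‖ ^ 2) := by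
      refine mul_nonneg ?_ (by positivity)
      have := P.μ_le
      rw [hp]; nlinarith
    have hα : P.α - 1 = -2 * p := by rw [hp]; ring
    rw [e2, e1, e3, hα, smul_eq_mul, smul_eq_mul]
    have := mul_nonneg hxa.le (add_nonneg hsq hmu)
    nlinarith
  refine le_trans (le_of_eq ?_) hle
  have hadd := integral_add i1.integrableOn (((i5.add i4).const_mul p).integrableOn (s := Ioo 0 1))
  refine Eq.trans ?_ hadd.symm
  refine Eq.trans (add_zero _).symm ?_
  exact congrArg _ hsum.symm

/-- The energy inner product on `C_c^∞(0,1)`. -/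
@[reducible]
def energyCore (𝕜 : Type*) [RCLike 𝕜] (P : Params) :
    PreInnerProductSpace.Core 𝕜 (TestSpace 𝕜 P) where
  inner := energyInner
  conj_inner_symm f g := by
    unfold energyInner
    rw [← integral_conj]
    refine integral_congr_ae (Eventually.of_forall fun x => ?_)
    simp only [energyIntegrand, map_sub, map_add, RCLike.real_smul_eq_coe_mul, map_mul,
      RCLike.conj_ofReal, inner_conj_symm]
  re_inner_nonneg f := (integral_nonneg fun x => by positivity).trans (hardy f)
  add_left f g h := by
    unfold energyInner
    rw [← integral_add (integrable_energy f h).integrableOn (integrable_energy g h).integrableOn]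
    refine integral_congr_ae (Eventually.of_forall fun x => ?_)
    simp only [energyIntegrand, TestSpace.add_apply, TestSpace.deriv_add, inner_add_left, smul_add]
    ring
  smul_left f g c := by
    unfold energyInner
    rw [← integral_const_mul]
    refine integral_congr_ae (Eventually.of_forall fun x => ?_)
    simp only [energyIntegrand, TestSpace.smul_apply, TestSpace.deriv_smul, ← smul_eq_mul (a := c),
      inner_smul_left, RCLike.real_smul_eq_coe_mul]
    ring

instance : SeminormedAddCommGroup (TestSpace 𝕜 P) :=
  @InnerProductSpace.Core.toSeminormedAddCommGroup 𝕜 _ _ _ _ (energyCore 𝕜 P)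

instance : InnerProductSpace 𝕜 (TestSpace 𝕜 P) := InnerProductSpace.ofCore (energyCore 𝕜 P)

lemma TestSpace.inner_def (f g : TestSpace 𝕜 P) : inner 𝕜 f g = energyInner f g := rfl

lemma TestSpace.memLp (f : TestSpace 𝕜 P) : MemLp f 2 vol01 :=
  (f.contDiff.continuous.memLp_of_hasCompactSupport f.hasCompactSupport).restrict _

lemma norm_toLp_sq {u : ℝ → 𝕜} (hu : MemLp u 2 vol01) :
    ‖hu.toLp u‖ ^ 2 = ∫ x in Ioo (0 : ℝ) 1, ‖u x‖ ^ 2 := by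
  rw [← inner_self_eq_norm_sq (𝕜 := 𝕜), L2.inner_def, ← integral_re (L2.integrable_inner _ _)]
  refine integral_congr_ae ?_
  filter_upwards [hu.coeFn_toLp] with x hx
  rw [inner_self_eq_norm_sq, hx]

/-- The inclusion of `C_c^∞(0,1)`, with the energy norm, in `L²(0,1)`. -/
def testToL2 (𝕜 : Type*) [RCLike 𝕜] (P : Params) : TestSpace 𝕜 P →L[𝕜] L2 𝕜 :=
  LinearMap.mkContinuous
    { toFun := fun f => f.memLp.toLp _
      map_add' := fun f g => f.memLp.toLp_add g.memLp
      map_smul' := fun c f => f.memLp.toLp_const_smul c } 1 (by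
    intro f
    rw [one_mul]
    refine le_of_sq_le_sq ?_ (norm_nonneg _)
    rw [← inner_self_eq_norm_sq (𝕜 := 𝕜) f]
    exact (norm_toLp_sq f.memLp).trans_le (hardy f))

lemma testToL2_apply (f : TestSpace 𝕜 P) : testToL2 𝕜 P f = f.memLp.toLp _ := rfl

end TestSpace

/-- The Hilbert space `H^{1,μ}_{α,0}(0,1)`: the completion of `C_c^∞(0,1)` in the energy norm. By
`embed_injective` below it is a space of (classes of) functions, a subspace of `L²(0,1)`. -/
abbrev H1 (𝕜 : Type*) [RCLike 𝕜] (P : Params) : Type _ :=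
  UniformSpace.Completion (TestSpace 𝕜 P)

/-- The inclusion `H^{1,μ}_{α,0}(0,1) ⊂ L²(0,1)`, extending that of `C_c^∞(0,1)`. -/
def embed (𝕜 : Type*) [RCLike 𝕜] (P : Params) : H1 𝕜 P →L[𝕜] L2 𝕜 :=
  (testToL2 𝕜 P).extend (UniformSpace.Completion.toComplL : TestSpace 𝕜 P →L[𝕜] H1 𝕜 P)

section Embed

variable {𝕜 : Type*} [RCLike 𝕜] {P : Params}

lemma embed_coe (f : TestSpace 𝕜 P) : embed 𝕜 P (f : H1 𝕜 P) = f.memLp.toLp _ :=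
  ContinuousLinearMap.extend_eq _ UniformSpace.Completion.denseRange_coe
    (UniformSpace.Completion.isUniformInducing_coe _) f

lemma memLp_weight {w : ℝ → ℝ} {f : ℝ → 𝕜} (hw : ContinuousOn w (Ioo 0 1)) (hf : Continuous f)
    (hc : HasCompactSupport f) (hs : tsupport f ⊆ Ioo 0 1) :
    MemLp (fun x => w x • f x) 2 vol01 := by
  obtain ⟨C, hC⟩ := hc.exists_bound_of_continuousOn ((hw.mono hs).smul hf.continuousOn)
  refine MemLp.of_bound (integrable_weight hw hf hc hs).aestronglyMeasurable.restrict (max C 0) ?_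
  refine Eventually.of_forall fun x => ?_
  by_cases hx : x ∈ tsupport f
  · exact (hC x hx).trans (le_max_left _ _)
  · simp [image_eq_zero_of_notMem_tsupport hx]

/-- The operator `ψ - (x^α ψ')' - μ / x^(2-α) ψ` on test functions. -/
def opFun (g : TestSpace 𝕜 P) (x : ℝ) : 𝕜 :=
  g x - ((P.α * x ^ (P.α - 1)) • deriv g x + x ^ P.α • deriv (deriv g) x)
    - (P.μ / x ^ (2 - P.α)) • g x

lemma TestSpace.tsupport_deriv2 (f : TestSpace 𝕜 P) : tsupport (deriv (deriv f)) ⊆ tsupport f :=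
  (closure_minimal support_deriv_subset (isClosed_tsupport _)).trans f.tsupport_deriv

lemma TestSpace.continuous_deriv2 (f : TestSpace 𝕜 P) : Continuous (deriv (deriv f)) :=
  ((contDiff_infty_iff_deriv).1 f.contDiff_deriv).2.continuous

lemma memLp_opFun (g : TestSpace 𝕜 P) : MemLp (opFun g) 2 vol01 :=
  (g.memLp.sub ((memLp_weight (continuousOn_const.mul (continuousOn_rpow _))
    g.contDiff_deriv.continuous g.hasCompactSupport.deriv
    (g.tsupport_deriv.trans g.tsupport_subset)).add
    (memLp_weight (continuousOn_rpow _) g.continuous_deriv2 g.hasCompactSupport.deriv.deriv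
      (g.tsupport_deriv2.trans g.tsupport_subset)))).sub
    (memLp_weight (continuousOn_pot P) g.contDiff.continuous g.hasCompactSupport g.tsupport_subset)

lemma energyInner_eq (f g : TestSpace 𝕜 P) :
    energyInner f g = ∫ x in Ioo (0 : ℝ) 1, inner 𝕜 (f x) (opFun g x) := by
  have hwd : ∀ x ∈ Ioo (0 : ℝ) 1,
      HasDerivAt (fun x : ℝ => x ^ P.α) (P.α * x ^ (P.α - 1)) x :=
    fun x hx => Real.hasDerivAt_rpow_const (Or.inl hx.1.ne')
  have hg2 : ∀ x, HasDerivAt (deriv g) (deriv (deriv g) x) x := fun x =>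
    (g.contDiff_deriv.differentiable (by simp) x).hasDerivAt
  have hsub := (tsupport_inner_subset (𝕜 := 𝕜) f (deriv g))
  have hcf := f.contDiff.continuous
  have hcf' := f.contDiff_deriv.continuous
  have hcg' := g.contDiff_deriv.continuous
  have hparts := integral_parts hwd (continuousOn_const.mul (continuousOn_rpow _))
    (f := fun x => inner 𝕜 (f x) (deriv g x))
    (f' := fun x => inner 𝕜 (f x) (deriv (deriv g) x) + inner 𝕜 (deriv f x) (deriv g x))
    (fun x => (f.differentiable x).hasDerivAt.inner 𝕜 (hg2 x))
    ((hcf.inner g.continuous_deriv2).add (hcf'.inner hcg'))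
    (f.hasCompactSupport.of_isClosed_subset (isClosed_tsupport _) hsub)
    (hsub.trans f.tsupport_subset)
  have j1 := integrable_inner (w := fun x => x ^ P.α) (continuousOn_rpow _) f hcf
    g.continuous_deriv2 subset_rfl
  have j2 := integrable_energy2 f g
  have j3 := integrable_inner (w := fun x => P.α * x ^ (P.α - 1))
    (continuousOn_const.mul (continuousOn_rpow _)) f hcf hcg' subset_rfl
  have e1 := integrable_energy1 f g
  have e3 := integrable_energy3 f g
  simp only [smul_add] at hparts
  rw [integral_add j1.integrableOn j2.integrableOn] at hparts
  have l1 : energyInner f g = (∫ x in Ioo (0 : ℝ) 1, inner 𝕜 (f x) (g x))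
      + (∫ x in Ioo (0 : ℝ) 1, (x ^ P.α) • inner 𝕜 (deriv f x) (deriv g x))
      - ∫ x in Ioo (0 : ℝ) 1, (P.μ / x ^ (2 - P.α)) • inner 𝕜 (f x) (g x) := by
    have h1 := integral_sub ((e1.add j2).integrableOn (s := Ioo 0 1)) e3.integrableOn
    have h2 := integral_add (e1.integrableOn (s := Ioo 0 1)) j2.integrableOn
    exact h1.trans (congrArg (· - _) h2)
  have l2 : (∫ x in Ioo (0 : ℝ) 1, inner 𝕜 (f x) (opFun g x))
      = (∫ x in Ioo (0 : ℝ) 1, inner 𝕜 (f x) (g x))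
      - ((∫ x in Ioo (0 : ℝ) 1, (P.α * x ^ (P.α - 1)) • inner 𝕜 (f x) (deriv g x))
        + ∫ x in Ioo (0 : ℝ) 1, (x ^ P.α) • inner 𝕜 (f x) (deriv (deriv g) x))
      - ∫ x in Ioo (0 : ℝ) 1, (P.μ / x ^ (2 - P.α)) • inner 𝕜 (f x) (g x) := by
    have h1 := integral_sub ((e1.sub (j3.add j1)).integrableOn (s := Ioo 0 1)) e3.integrableOn
    have h2 := integral_sub (e1.integrableOn (s := Ioo 0 1)) (j3.add j1).integrableOn
    have h3 := integral_add (j3.integrableOn (s := Ioo 0 1)) j1.integrableOn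
    refine Eq.trans ?_ (h1.trans (congrArg (· - _) (h2.trans (congrArg (_ - ·) h3))))
    refine integral_congr_ae (Eventually.of_forall fun x => ?_)
    simp only [opFun, Pi.sub_apply, Pi.add_apply, RCLike.real_smul_eq_coe_smul (K := 𝕜),
      smul_eq_mul, RCLike.inner_apply]
    ring
  rw [l1, l2]
  linear_combination hparts

/-- The map `embed` is injective, so that `H^{1,μ}_{α,0}(0,1)` is a subspace of `L²(0,1)`. -/
theorem embed_injective (𝕜 : Type*) [RCLike 𝕜] (P : Params) :
    Function.Injective (embed 𝕜 P) := by
  refine (injective_iff_map_eq_zero _).2 fun h hh => ?_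
  have key : ∀ (g : TestSpace 𝕜 P) (h : H1 𝕜 P),
      inner 𝕜 h (g : H1 𝕜 P) = inner 𝕜 (embed 𝕜 P h) ((memLp_opFun g).toLp _) := by
    intro g h
    induction h using UniformSpace.Completion.induction_on with
    | hp => exact isClosed_eq (by fun_prop) (by fun_prop)
    | ih f =>
      rw [UniformSpace.Completion.inner_coe, embed_coe, L2.inner_def, TestSpace.inner_def,
        energyInner_eq]
      refine integral_congr_ae ?_
      filter_upwards [f.memLp.coeFn_toLp, (memLp_opFun g).coeFn_toLp] with x h1 h2
      rw [h1, h2]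
  have h0 : ∀ k : H1 𝕜 P, inner 𝕜 h k = 0 := by
    intro k
    induction k using UniformSpace.Completion.induction_on with
    | hp => exact isClosed_eq (by fun_prop) (by fun_prop)
    | ih g => rw [key, hh, inner_zero_left]
  exact inner_self_eq_zero.1 (h0 h)

end Embed

/-- The space `H^{1,μ}_{α,0}(0,1)²`. -/
abbrev H1sq (𝕜 : Type*) [RCLike 𝕜] (P : Params) : Type _ := PiLp 2 (fun _ : Fin 2 => H1 𝕜 P)

/-- The space `H^{-1,μ}_α(0,1)²`, where `H^{-1,μ}_α(0,1)` is the dual of `H^{1,μ}_{α,0}(0,1)`. -/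
abbrev Hneg1sq (𝕜 : Type*) [RCLike 𝕜] (P : Params) : Type _ :=
  PiLp 2 (fun _ : Fin 2 => StrongDual 𝕜 (H1 𝕜 P))

/-- The inclusion `H^{1,μ}_{α,0}(0,1)² ⊂ L²(0,1)²`. -/
def embedSq {𝕜 : Type*} [RCLike 𝕜] {P : Params} (h : H1sq 𝕜 P) : L2sq 𝕜 :=
  WithLp.toLp 2 fun c => embed 𝕜 P (h c)

/-- The duality pairing `⟨F₁, h₁⟩ + ⟨F₂, h₂⟩` of `H^{-1,μ}_α(0,1)²` and `H^{1,μ}_{α,0}(0,1)²`. -/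
def dualPairing {𝕜 : Type*} [RCLike 𝕜] {P : Params} (F : Hneg1sq 𝕜 P) (h : H1sq 𝕜 P) : 𝕜 :=
  ∑ c, F c (h c)

/-- The inclusion `L²(0,1) ⊂ H^{-1,μ}_α(0,1)`: `f` acts by `h ↦ ∫₀¹ f h`. -/
def toDual {𝕜 : Type*} [RCLike 𝕜] (P : Params) (f : L2 𝕜) : StrongDual 𝕜 (H1 𝕜 P) :=
  (innerSL 𝕜 (star f)).comp (embed 𝕜 P)

theorem toDual_apply {𝕜 : Type*} [RCLike 𝕜] (P : Params) (f : L2 𝕜) (h : H1 𝕜 P) :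
    toDual P f h = pairing f (embed 𝕜 P h) := by
  change inner 𝕜 (star f) (embed 𝕜 P h) = _
  rw [L2.inner_def]
  refine integral_congr_ae ?_
  filter_upwards [Lp.coeFn_star f] with x hx
  rw [hx, RCLike.inner_apply, Pi.star_apply, RCLike.star_def, RCLike.conj_conj, mul_comm]

/-- The inclusion `L²(0,1)² ⊂ H^{-1,μ}_α(0,1)²`. -/
def toDualSq {𝕜 : Type*} [RCLike 𝕜] (P : Params) (f : L2sq 𝕜) : Hneg1sq 𝕜 P :=
  WithLp.toLp 2 fun c => toDual P (f c)

end DegSing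

end

/-! The matrices with rows `U_i` and `V_i` are inverse transposes of each other. Hence (f₁, f₂) ↦
f₁U₁ + f₂U₂ is an automorphism of X² for each of the spaces X = L², H¹, H⁻¹, and bases of X² are
obtained by mixing two copies of a basis of X. It remains to show that the scalar functions Φ_n form
an orthonormal basis of L², and unconditional bases of H¹ and of its dual.

Let s = (1-α)/2 + σ be the larger indicial root. The indicial equation factors the scalar operator
formally as D*D, where D f = -x^(α/2+s) (x^(-s) f)', and the energy inner product becomes ⟨f,g⟩ +
⟨Df,Dg⟩ (`energyInner_eq_add`). The inverse of D is an explicit Volterra operator K whose outputs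
satisfy the condition at 1. It is Hilbert–Schmidt because α < 1, and D maps H¹ onto L²
(`surjective_grad`). So K K* is the inverse of the operator; it is compact, self-adjoint and
injective, and its eigenvectors have dense span.

If u = l K K* u, then x^(-s) u solves a first order linear system. Its Wronskian with the regular
solution tends to 0 at 0, so x^(-s) u is a multiple of the regular solution, which is the entire
factor of J_ν at l x^(2-α)/(2-α)². The condition at 1 then ties l to a zero of J_ν
(`exists_eigenfun_of_eq`). Therefore every eigenvector is a multiple of a Bessel eigenfunction. The
converse needs no further computation: an eigenfunction missed by the spectrum would be orthogonal
to all eigenvectors (`eigL2_eq_volterra`).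

Orthonormality comes from the Lagrange identity (distinct zeros) and from a Pohozaev identity
(norms). The latter also shows that the zeros are simple, hence locally finite; completeness forces
them to be infinite in number. So the recursively defined `besselZero` lists them all.

Finally, the weak equation ⟨Φ_n,k⟩_{H¹} = (1+λ_n)⟨Φ_n,k⟩_{L²} transfers orthogonality and
completeness from L² to H¹, and the Riesz isomorphism transfers them to the dual. -/

/-! ### Hilbert–Schmidt operators -/

section HilbertSchmidt

variable {𝕜 E F ι : Type*} [RCLike 𝕜] [NormedAddCommGroup E] [InnerProductSpace 𝕜 E]
  [NormedAddCommGroup F] [InnerProductSpace 𝕜 F] [CompleteSpace F]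

open Filter Topology

/-- An operator with finite Hilbert–Schmidt norm is compact. -/
lemma HilbertBasis.isCompactOperator_of_sum_norm_sq_le (b : HilbertBasis ι 𝕜 E) (T : E →L[𝕜] F)
    {C : ℝ} (hT : ∀ s : Finset ι, ∑ i ∈ s, ‖T (b i)‖ ^ 2 ≤ C) : IsCompactOperator T := by
  classical
  have hsum : Summable fun i => ‖T (b i)‖ ^ 2 :=
    summable_of_sum_le (fun i => sq_nonneg _) hT
  -- Finite-rank truncations of T along b. The tail of the Hilbert–Schmidt sum bounds ‖S s - T‖, so
  -- T is a norm limit of compact operators.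
  set S : Finset ι → E →L[𝕜] F := fun s => ∑ i ∈ s, (innerSL 𝕜 (b i)).smulRight (T (b i)) with hS
  have hSa : ∀ s x, S s x = ∑ i ∈ s, inner 𝕜 (b i) x • T (b i) := by
    intro s x; simp [hS]
  refine isCompactOperator_of_tendsto (F := S) (l := atTop) ?_ (Eventually.of_forall fun s => ?_)
  · have htail : Tendsto (fun s : Finset ι => √(∑' i, ‖T (b i)‖ ^ 2 - ∑ i ∈ s, ‖T (b i)‖ ^ 2))
        atTop (𝓝 0) := by
      have h1 : Tendsto (fun s : Finset ι => ∑ i ∈ s, ‖T (b i)‖ ^ 2) atTop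
        (𝓝 (∑' i, ‖T (b i)‖ ^ 2)) := hsum.hasSum
      have h2 := (tendsto_const_nhds (x := ∑' i, ‖T (b i)‖ ^ 2)).sub h1
      rw [sub_self] at h2
      simpa using h2.sqrt
    rw [tendsto_iff_norm_sub_tendsto_zero]
    refine squeeze_zero (fun _ => norm_nonneg _) (fun s => ?_) htail
    refine ContinuousLinearMap.opNorm_le_bound _ (Real.sqrt_nonneg _) fun x => ?_
    have hx : Tendsto (fun t : Finset ι => S t x) atTop (𝓝 (T x)) := by
      have := (b.hasSum_repr x).mapL T
      simp only [map_smul, b.repr_apply_apply] at this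
      simp only [hSa]
      exact this
    have hlim : Tendsto (fun t : Finset ι => ‖S s x - S t x‖) atTop (𝓝 ‖S s x - T x‖) :=
      (tendsto_const_nhds.sub hx).norm
    -- T x is only available as the limit of S t x, so the bound is proved for S t x - S s x with t
    -- ⊇ s, by Cauchy–Schwarz and Bessel's inequality.
    refine le_of_tendsto hlim ?_
    filter_upwards [eventually_ge_atTop s] with t hst
    have hdiff : S t x - S s x = ∑ i ∈ t \ s, inner 𝕜 (b i) x • T (b i) := by
      rw [hSa, hSa, ← Finset.sum_sdiff hst, add_sub_cancel_right]
    rw [norm_sub_rev, hdiff]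
    calc ‖∑ i ∈ t \ s, inner 𝕜 (b i) x • T (b i)‖
        ≤ ∑ i ∈ t \ s, ‖T (b i)‖ * ‖inner 𝕜 (b i) x‖ := by
          refine (norm_sum_le _ _).trans (Finset.sum_le_sum fun i _ => ?_)
          rw [norm_smul, mul_comm]
      _ ≤ √(∑ i ∈ t \ s, ‖T (b i)‖ ^ 2) * √(∑ i ∈ t \ s, ‖inner 𝕜 (b i) x‖ ^ 2) :=
          Real.sum_mul_le_sqrt_mul_sqrt _ _ _
      _ ≤ _ := by
          gcongr
          · rw [le_sub_iff_add_le, Finset.sum_sdiff hst]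
            exact hsum.sum_le_tsum _ fun i _ => sq_nonneg _
          · rw [Real.sqrt_le_left (norm_nonneg _)]
            exact b.orthonormal.sum_inner_products_le x
  · refine (compactOperator (RingHom.id 𝕜) E F).sum_mem fun i _ => ?_
    change IsCompactOperator fun x => innerSL 𝕜 (b i) x • T (b i)
    have h1 : IsCompactOperator (innerSL 𝕜 (b i)) :=
      isCompactOperator_of_locallyCompactSpace_dom (innerSL 𝕜 (b i))
    exact h1.clm_comp (ContinuousLinearMap.toSpanSingleton 𝕜 (T (b i)))

end HilbertSchmidt

noncomputable section

namespace DegSing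

open MeasureTheory Set Filter Topology
open scoped Distributions ContDiff InnerProductSpace

/-! ### The entire function `∑ (-1)^m z^m / (m! Γ(1+ν+m))` -/

/-- The coefficients of the entire factor of `J_ν`. -/
def besselCoeff (ν : ℝ) (m : ℕ) : ℝ := (-1) ^ m / ((m.factorial : ℝ) * Real.Gamma (1 + ν + m))

/-- The entire factor of `J_ν`: one has `J_ν(x) = (x/2)^ν besselEntire ν (x²/4)`. -/
def besselEntire (ν z : ℝ) : ℝ := ∑' m : ℕ, besselCoeff ν m * z ^ m

lemma abs_besselCoeff_le {ν : ℝ} (hν : 0 ≤ ν) (m : ℕ) :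
    |besselCoeff ν m| ≤ (Real.Gamma (1 + ν))⁻¹ * (1 / m.factorial) := by
  have hG : 0 < Real.Gamma (1 + ν) := Real.Gamma_pos_of_pos (by linarith)
  have hGm := gamma_le ν hν m
  have hf : (0 : ℝ) < m.factorial := by positivity
  unfold besselCoeff
  rw [abs_div, abs_pow, abs_neg, abs_one, one_pow, abs_of_pos (mul_pos hf (hG.trans_le hGm)),
    ← one_div, div_mul_div_comm, one_mul, mul_comm (Real.Gamma (1 + ν))]
  exact one_div_le_one_div_of_le (by positivity) (by gcongr)

lemma summable_besselEntire {ν : ℝ} (hν : 0 ≤ ν) (z : ℝ) :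
    Summable fun m => besselCoeff ν m * z ^ m := by
  refine Summable.of_norm_bounded ((Real.summable_pow_div_factorial |z|).mul_left
    (Real.Gamma (1 + ν))⁻¹) fun m => ?_
  rw [norm_mul, norm_pow, Real.norm_eq_abs, Real.norm_eq_abs]
  calc _ ≤ (Real.Gamma (1 + ν))⁻¹ * (1 / m.factorial) * |z| ^ m := by
        gcongr; exact abs_besselCoeff_le hν m
    _ = _ := by ring

lemma besselCoeff_succ (ν : ℝ) (m : ℕ) :
    (m + 1 : ℕ) * besselCoeff ν (m + 1) = -besselCoeff (ν + 1) m := by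
  unfold besselCoeff
  have hf : ((m.factorial : ℕ) : ℝ) ≠ 0 := by positivity
  have hm : ((m : ℝ) + 1) ≠ 0 := by positivity
  rw [Nat.factorial_succ, pow_succ]
  push_cast
  rw [show 1 + ν + ((m : ℝ) + 1) = 1 + (ν + 1) + m by ring, mul_assoc, ← mul_div_assoc,
    mul_div_mul_left _ _ hm]
  ring

/-- Termwise differentiation, with an exponential-type majorant on the ball of radius |z| + 1. The
factor m cancels against m!, which shifts the index and raises the order by one. -/
lemma hasDerivAt_besselEntire {ν : ℝ} (hν : 0 ≤ ν) (z : ℝ) :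
    HasDerivAt (besselEntire ν) (-besselEntire (ν + 1) z) z := by
  have hG : 0 < Real.Gamma (1 + ν) := Real.Gamma_pos_of_pos (by linarith)
  set R : ℝ := |z| + 1
  have hR : 0 < R := by positivity
  have hu : Summable fun m : ℕ => (Real.Gamma (1 + ν))⁻¹ * (m * R ^ (m - 1) / m.factorial) := by
    refine Summable.mul_left _ ((summable_nat_add_iff 1).1 ?_)
    refine (Real.summable_pow_div_factorial R).congr fun m => ?_
    have hm : ((m : ℝ) + 1) ≠ 0 := by positivity
    rw [Nat.factorial_succ]
    push_cast
    rw [mul_div_mul_left _ _ hm]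
  have hd := hasDerivAt_tsum_of_isPreconnected (𝕜 := ℝ) (u := fun m : ℕ =>
      (Real.Gamma (1 + ν))⁻¹ * (m * R ^ (m - 1) / m.factorial))
    (g := fun m z => besselCoeff ν m * z ^ m) (g' := fun m z => besselCoeff ν m * (m * z ^ (m - 1)))
    (t := Metric.ball 0 R) (y₀ := 0) (y := z) hu Metric.isOpen_ball
    (convex_ball _ _).isPreconnected
    (fun m y _ => (hasDerivAt_pow m y).const_mul _) (fun m y hy => ?_) (by simpa using hR)
    (summable_besselEntire hν 0) (by simp [R])
  · have heq : (∑' m : ℕ, besselCoeff ν m * (m * z ^ (m - 1))) = -besselEntire (ν + 1) z := by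
      have hs : Summable fun m : ℕ => besselCoeff ν m * (m * z ^ (m - 1)) := by
        refine (summable_nat_add_iff 1).1 ?_
        refine ((summable_besselEntire (add_nonneg hν zero_le_one) z).neg).congr fun m => ?_
        rw [Nat.add_sub_cancel, ← mul_assoc, mul_comm (besselCoeff ν _), besselCoeff_succ, neg_mul]
      rw [hs.tsum_eq_zero_add]
      simp only [Nat.cast_zero, zero_mul, mul_zero, zero_add, besselEntire, ← tsum_neg]
      refine tsum_congr fun m => ?_
      rw [Nat.add_sub_cancel, ← mul_assoc, mul_comm (besselCoeff ν _), besselCoeff_succ, neg_mul]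
    rw [← heq]
    exact hd
  · have hy' : |y| ≤ R := by simpa using (mem_ball_zero_iff.1 hy).le
    rw [norm_mul, norm_mul, norm_pow, Real.norm_eq_abs, Real.norm_natCast, Real.norm_eq_abs]
    calc _ ≤ (Real.Gamma (1 + ν))⁻¹ * (1 / m.factorial) * (m * R ^ (m - 1)) := by
          gcongr; exact abs_besselCoeff_le hν m
      _ = _ := by ring

lemma continuous_besselEntire {ν : ℝ} (hν : 0 ≤ ν) : Continuous (besselEntire ν) :=
  continuous_iff_continuousAt.2 fun z => (hasDerivAt_besselEntire hν z).continuousAt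

/-- The functional equation of Γ gives c_ν(m) = (ν+1+m) c_{ν+1}(m). The part ν+1 yields the first
term, and the part m, through `besselCoeff_succ`, the second. This three-term recurrence is what
makes the flux differentiate back to the regular solution. -/
lemma besselEntire_recurrence {ν : ℝ} (hν : 0 ≤ ν) (z : ℝ) :
    besselEntire ν z = (ν + 1) * besselEntire (ν + 1) z - z * besselEntire (ν + 2) z := by
  have h1 := summable_besselEntire (add_nonneg hν zero_le_one) z
  have h2 := summable_besselEntire (add_nonneg hν zero_le_two) z
  have h0 := summable_besselEntire hν z
  have hG : ∀ m : ℕ, besselCoeff ν m = (ν + 1 + m) * besselCoeff (ν + 1) m := by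
    intro m
    have hp : 0 < 1 + ν + m := by positivity
    unfold besselCoeff
    rw [show 1 + (ν + 1) + (m : ℝ) = (1 + ν + m) + 1 by ring, Real.Gamma_add_one hp.ne',
      show ν + 1 + (m : ℝ) = 1 + ν + m by ring, ← mul_div_assoc,
      mul_left_comm (m.factorial : ℝ), mul_div_mul_left _ _ hp.ne']
  have hC : ∀ m : ℕ, ((m : ℝ) + 1) * besselCoeff (ν + 1) (m + 1) = -besselCoeff (ν + 2) m := by
    intro m
    have := besselCoeff_succ (ν + 1) m
    push_cast at this
    rw [this]; congr 2; ring
  unfold besselEntire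
  rw [h0.tsum_eq_zero_add, h1.tsum_eq_zero_add, mul_add, ← tsum_mul_left, ← tsum_mul_left,
    add_sub_assoc,
    ← Summable.tsum_sub (((summable_nat_add_iff 1).2 h1).mul_left _) (h2.mul_left _)]
  congr 1
  · rw [hG 0]; simp
  · refine tsum_congr fun m => ?_
    rw [hG (m + 1)]
    push_cast
    linear_combination (z ^ (m + 1)) * hC m

lemma besselEntire_zero_pos {ν : ℝ} (hν : 0 ≤ ν) : 0 < besselEntire ν 0 := by
  have hG : 0 < Real.Gamma (1 + ν) := Real.Gamma_pos_of_pos (by linarith)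
  have : besselEntire ν 0 = (Real.Gamma (1 + ν))⁻¹ := by
    unfold besselEntire
    rw [tsum_eq_single 0 (fun m hm => by simp [hm])]
    simp [besselCoeff]
  rw [this]
  positivity

lemma besselJ_eq (ν : ℝ) {x : ℝ} (hx : 0 < x) :
    besselJ ν x = (x / 2) ^ ν * besselEntire ν (x ^ 2 / 4) := by
  unfold besselJ besselEntire
  rw [← tsum_mul_left]
  refine tsum_congr fun m => ?_
  unfold besselTerm besselCoeff
  rw [Real.rpow_add (by positivity), Real.rpow_mul (by positivity), Real.rpow_natCast,
    Real.rpow_two, div_pow]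
  ring

lemma besselJ_eq_zero_iff (ν : ℝ) {x : ℝ} (hx : 0 < x) :
    besselJ ν x = 0 ↔ besselEntire ν (x ^ 2 / 4) = 0 := by
  rw [besselJ_eq ν hx, mul_eq_zero, or_iff_right (by positivity)]

/-- At a zero the term with the derivative of the prefactor (x/2)^ν drops out, so only the
derivative of the entire factor remains. -/
lemma deriv_besselJ {ν : ℝ} (hν : 0 ≤ ν) {c : ℝ} (hc : 0 < c) (h0 : besselJ ν c = 0) :
    deriv (besselJ ν) c = -((c / 2) ^ ν * (c / 2) * besselEntire (ν + 1) (c ^ 2 / 4)) := by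
  rw [besselJ_eq_zero_iff ν hc] at h0
  have hev : besselJ ν =ᶠ[𝓝 c] fun x => (x / 2) ^ ν * besselEntire ν (x ^ 2 / 4) := by
    filter_upwards [lt_mem_nhds hc] with x hx using besselJ_eq ν hx
  have h1 : HasDerivAt (fun x : ℝ => x ^ 2 / 4) (2 * c / 4) c := by
    simpa using (hasDerivAt_pow 2 c).div_const 4
  have h2 : HasDerivAt (fun x : ℝ => (x / 2) ^ ν) (1 / 2 * ν * (c / 2) ^ (ν - 1)) c :=
    ((hasDerivAt_id c).div_const 2).rpow_const (Or.inl (by positivity))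
  have h3 := h2.mul ((hasDerivAt_besselEntire hν (c ^ 2 / 4)).comp c h1)
  have h4 := hev.deriv_eq.trans h3.deriv
  rw [h4]
  simp only [Function.comp, h0]
  ring

/-! ### The regular solutions of the eigenvalue equation

With `u = x^s y` the equation `-(x^α u')' - μ x^(α-2) u = l u` becomes the first order system
`y' = x^(-(1+2σ)) w`, `w' = -l x^(2s) y`. -/

/-- `σ = √((1-α)²/4 - μ)`. -/
def Params.σ (P : Params) : ℝ := √((1 - P.α) ^ 2 / 4 - P.μ)

/-- The larger root `s = (1-α)/2 + σ` of the indicial equation `s² - (1-α) s + μ = 0`. -/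
def Params.s (P : Params) : ℝ := (1 - P.α) / 2 + P.σ

lemma Params.σ_nonneg (P : Params) : 0 ≤ P.σ := Real.sqrt_nonneg _

lemma Params.s_pos (P : Params) : 0 < P.s := by
  have := P.α_lt_one
  have := P.σ_nonneg
  unfold Params.s
  linarith

lemma Params.two_s (P : Params) : 2 * P.s = 1 - P.α + 2 * P.σ := by unfold Params.s; ring

lemma Params.indicial (P : Params) : P.s ^ 2 - (1 - P.α) * P.s + P.μ = 0 := by
  have h : P.σ ^ 2 = (1 - P.α) ^ 2 / 4 - P.μ := Real.sq_sqrt (by linarith [P.μ_le])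
  unfold Params.s
  linear_combination h

lemma Params.ν_eq (P : Params) : P.ν = 2 * P.σ / (2 - P.α) := by
  unfold Params.ν Params.σ; ring

/-- The solution of the eigenvalue equation that is regular at `0`, divided by `x^s`. -/
def regSol (P : Params) (l x : ℝ) : ℝ :=
  besselEntire P.ν (l / (2 - P.α) ^ 2 * x ^ (2 - P.α))

/-- The flux `x^(1+2σ) y'` of `y = regSol P l`. -/
def regFlux (P : Params) (l x : ℝ) : ℝ :=
  -(l / (2 - P.α)) * x ^ (2 - P.α + 2 * P.σ) *
    besselEntire (P.ν + 1) (l / (2 - P.α) ^ 2 * x ^ (2 - P.α))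

lemma Params.two_sub_pos (P : Params) : 0 < 2 - P.α := by linarith [P.α_lt_one]

lemma Params.ν_mul (P : Params) : P.ν * (2 - P.α) = 2 * P.σ := by
  rw [P.ν_eq, div_mul_cancel₀ _ P.two_sub_pos.ne']

lemma continuous_regArg (P : Params) (l : ℝ) :
    Continuous fun x : ℝ => l / (2 - P.α) ^ 2 * x ^ (2 - P.α) :=
  continuous_const.mul (Real.continuous_rpow_const P.two_sub_pos.le)

lemma continuous_regSol (P : Params) (l : ℝ) : Continuous (regSol P l) :=
  (continuous_besselEntire P.ν_nonneg).comp (continuous_regArg P l)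

lemma continuous_regFlux (P : Params) (l : ℝ) : Continuous (regFlux P l) :=
  (continuous_const.mul (Real.continuous_rpow_const
    (by linarith [P.two_sub_pos, P.σ_nonneg]))).mul
    ((continuous_besselEntire (by linarith [P.ν_nonneg])).comp (continuous_regArg P l))

lemma regFlux_zero (P : Params) (l : ℝ) : regFlux P l 0 = 0 := by
  unfold regFlux
  rw [Real.zero_rpow (by linarith [P.two_sub_pos, P.σ_nonneg])]
  ring

lemma regSol_zero_pos (P : Params) (l : ℝ) : 0 < regSol P l 0 := by
  unfold regSol
  rw [Real.zero_rpow P.two_sub_pos.ne', mul_zero]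
  exact besselEntire_zero_pos P.ν_nonneg

lemma hasDerivAt_regArg (P : Params) (l : ℝ) {x : ℝ} (hx : 0 < x) :
    HasDerivAt (fun x : ℝ => l / (2 - P.α) ^ 2 * x ^ (2 - P.α))
      (l / (2 - P.α) * x ^ (1 - P.α)) x := by
  have h := (Real.hasDerivAt_rpow_const (p := 2 - P.α) (Or.inl hx.ne')).const_mul
    (l / (2 - P.α) ^ 2)
  refine h.congr_deriv ?_
  have := P.two_sub_pos.ne'
  rw [show 2 - P.α - 1 = 1 - P.α by ring]
  field_simp

lemma hasDerivAt_regSol (P : Params) (l : ℝ) {x : ℝ} (hx : 0 < x) :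
    HasDerivAt (regSol P l) (x ^ (-(1 + 2 * P.σ)) * regFlux P l x) x := by
  have h := (hasDerivAt_besselEntire P.ν_nonneg _).comp x (hasDerivAt_regArg P l hx)
  refine h.congr_deriv ?_
  unfold regFlux
  have : x ^ (1 - P.α) = x ^ (-(1 + 2 * P.σ)) * x ^ (2 - P.α + 2 * P.σ) := by
    rw [← Real.rpow_add hx]; congr 1; ring
  rw [this]
  ring

/-- The power rule produces the order ν+1 and the chain rule the order ν+2. Since 2-α+2σ =
(ν+1)(2-α), they appear with the weights of `besselEntire_recurrence` and recombine to order ν. -/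
lemma hasDerivAt_regFlux (P : Params) (l : ℝ) {x : ℝ} (hx : 0 < x) :
    HasDerivAt (regFlux P l) (-l * x ^ (2 * P.s) * regSol P l x) x := by
  have h1 := (Real.hasDerivAt_rpow_const (p := 2 - P.α + 2 * P.σ) (Or.inl hx.ne')).const_mul
    (-(l / (2 - P.α)))
  have h2 := (hasDerivAt_besselEntire (ν := P.ν + 1) (by linarith [P.ν_nonneg]) _).comp x
    (hasDerivAt_regArg P l hx)
  have h3 := h1.mul h2
  refine h3.congr_deriv ?_
  have hα := P.two_sub_pos.ne'
  have e1 : x ^ (2 - P.α + 2 * P.σ - 1) = x ^ (2 * P.s) := by congr 1; rw [P.two_s]; ring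
  have e2 : x ^ (2 - P.α + 2 * P.σ) * x ^ (1 - P.α) = x ^ (2 * P.s) * x ^ (2 - P.α) := by
    rw [← Real.rpow_add hx, ← Real.rpow_add hx]; congr 1; rw [P.two_s]; ring
  have hrec := besselEntire_recurrence P.ν_nonneg (l / (2 - P.α) ^ 2 * x ^ (2 - P.α))
  have h4 : 2 - P.α + 2 * P.σ = (P.ν + 1) * (2 - P.α) := by linear_combination -P.ν_mul
  rw [show P.ν + 1 + 1 = P.ν + 2 by ring, e1]
  unfold regSol
  rw [hrec]
  simp only [Function.comp]
  generalize besselEntire (P.ν + 1) _ = A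
  generalize besselEntire (P.ν + 2) _ = B
  have : -(l / (2 - P.α)) * x ^ (2 - P.α + 2 * P.σ) * (-B * (l / (2 - P.α) * x ^ (1 - P.α)))
      = l ^ 2 / (2 - P.α) ^ 2 * (x ^ (2 * P.s) * x ^ (2 - P.α)) * B := by
    rw [← e2]; field_simp
  rw [this, h4]
  field_simp
  ring

/-- The integrated form of the Pohozaev identity. -/
lemma integral_regSol_sq (P : Params) (l : ℝ) {x : ℝ} (hx : 0 < x) :
    l * (2 - P.α) * ∫ t in (0 : ℝ)..x, t ^ (2 * P.s) * regSol P l t ^ 2 =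
      x ^ (-(2 * P.σ)) * regFlux P l x ^ 2 + l * x ^ (2 * P.s + 1) * regSol P l x ^ 2
        + 2 * P.σ * (regSol P l x * regFlux P l x) := by
  have hs := P.s_pos
  have hσ := P.σ_nonneg
  have hα := P.two_sub_pos
  -- For x > 0 this is the right-hand side of the identity. Merging the powers of x in the flux term
  -- removes the singular factor x^(-2σ), so that H is continuous at 0 and vanishes there.
  set H : ℝ → ℝ := fun x => (l / (2 - P.α)) ^ 2 * x ^ (2 * (2 - P.α) + 2 * P.σ) *
    besselEntire (P.ν + 1) (l / (2 - P.α) ^ 2 * x ^ (2 - P.α)) ^ 2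
      + l * x ^ (2 * P.s + 1) * regSol P l x ^ 2 + 2 * P.σ * (regSol P l x * regFlux P l x) with hH
  have hHeq : ∀ x : ℝ, 0 < x → H x = x ^ (-(2 * P.σ)) * regFlux P l x ^ 2
      + l * x ^ (2 * P.s + 1) * regSol P l x ^ 2 + 2 * P.σ * (regSol P l x * regFlux P l x) := by
    intro x hx
    simp only [hH]
    congr 2
    unfold regFlux
    have : x ^ (2 * (2 - P.α) + 2 * P.σ) = x ^ (-(2 * P.σ)) * (x ^ (2 - P.α + 2 * P.σ)) ^ 2 := by
      rw [sq, ← Real.rpow_add hx, ← Real.rpow_add hx]; congr 1; ring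
    rw [this]; ring
  have hcont : Continuous H := by
    have h1 := continuous_regSol P l
    have h2 := continuous_regFlux P l
    refine ((Continuous.mul (continuous_const.mul (Real.continuous_rpow_const (by linarith)))
      (((continuous_besselEntire (by linarith [P.ν_nonneg])).comp
        (continuous_regArg P l)).pow 2)).add
      ((continuous_const.mul (Real.continuous_rpow_const (by linarith))).mul (h1.pow 2))).add
      (continuous_const.mul (h1.mul h2))
  have hderiv : ∀ t ∈ Ioo 0 x, HasDerivAt H (l * (2 - P.α) * (t ^ (2 * P.s) * regSol P l t ^ 2)) t
      := by
    intro t ht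
    have ht0 : 0 < t := ht.1
    have hE := hasDerivAt_regSol P l ht0
    have hW := hasDerivAt_regFlux P l ht0
    have p1 := Real.hasDerivAt_rpow_const (x := t) (p := -(2 * P.σ)) (Or.inl ht0.ne')
    have p2 := Real.hasDerivAt_rpow_const (x := t) (p := 2 * P.s + 1) (Or.inl ht0.ne')
    have hev : H =ᶠ[𝓝 t] fun x => x ^ (-(2 * P.σ)) * regFlux P l x ^ 2
      + l * x ^ (2 * P.s + 1) * regSol P l x ^ 2 + 2 * P.σ * (regSol P l x * regFlux P l x) := by
      filter_upwards [lt_mem_nhds ht0] with y hy using hHeq y hy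
    refine HasDerivAt.congr_of_eventuallyEq ?_ hev
    have hd := ((p1.mul (hW.pow 2)).add ((p2.const_mul l).mul (hE.pow 2))).add
      ((hE.mul hW).const_mul (2 * P.σ))
    refine hd.congr_deriv ?_
    have e1 : t ^ (-(2 * P.σ) - 1) = t ^ (-(1 + 2 * P.σ)) := by congr 1; ring
    have e2 : t ^ (2 * P.s + 1 - 1) = t ^ (2 * P.s) := by congr 1; ring
    have e3 : t ^ (2 * P.s + 1) * t ^ (-(1 + 2 * P.σ)) = t ^ (2 * P.s) * t ^ (-(2 * P.σ)) := by
      rw [← Real.rpow_add ht0, ← Real.rpow_add ht0]; congr 1; ring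
    rw [e1, e2]
    have h2s := P.two_s
    -- The squared flux terms cancel and so do the mixed ones (the latter by `e3`). What remains is
    -- l(2s+1-2σ) x^(2s) y², and 2s+1-2σ = 2-α.
    simp only [Nat.cast_ofNat, Pi.pow_apply]
    linear_combination (2 * l * regSol P l t * regFlux P l t) * e3 +
      (l * t ^ (2 * P.s) * regSol P l t ^ 2) * h2s
  have hint : IntervalIntegrable (fun t => l * (2 - P.α) * (t ^ (2 * P.s) * regSol P l t ^ 2))
      volume 0 x := by
    refine Continuous.intervalIntegrable ?_ _ _
    exact continuous_const.mul ((Real.continuous_rpow_const (by linarith)).mul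
      ((continuous_regSol P l).pow 2))
  have hftc := intervalIntegral.integral_eq_sub_of_hasDerivAt_of_le hx.le hcont.continuousOn
    hderiv hint
  rw [intervalIntegral.integral_const_mul] at hftc
  rw [hftc, ← hHeq x hx]
  have : H 0 = 0 := by
    simp only [hH, regFlux_zero]
    rw [Real.zero_rpow (x := 2 * (2 - P.α) + 2 * P.σ) (by linarith),
      Real.zero_rpow (x := 2 * P.s + 1) (by linarith)]
    ring
  rw [this, sub_zero]

/-- The integrand is nonnegative, and the regular solution is positive near 0 because it is
continuous with a positive value there. -/
lemma integral_regSol_sq_pos (P : Params) (l : ℝ) {x : ℝ} (hx : 0 < x) :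
    0 < ∫ t in (0 : ℝ)..x, t ^ (2 * P.s) * regSol P l t ^ 2 := by
  have hs := P.s_pos
  have hc : Continuous fun t => t ^ (2 * P.s) * regSol P l t ^ 2 :=
    (Real.continuous_rpow_const (by linarith)).mul ((continuous_regSol P l).pow 2)
  have hev : ∀ᶠ t in 𝓝 0, 0 < regSol P l t :=
    (continuous_regSol P l).continuousAt.eventually (lt_mem_nhds (regSol_zero_pos P l))
  obtain ⟨ε, hε, hball⟩ := Metric.eventually_nhds_iff.1 hev
  set δ := min (ε / 2) x
  have hδ : 0 < δ := lt_min (by linarith) hx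
  refine intervalIntegral.integral_pos hx hc.continuousOn
    (fun t ht => mul_nonneg (Real.rpow_nonneg ht.1.le _) (sq_nonneg _))
    ⟨δ, ⟨hδ.le, min_le_right _ _⟩, ?_⟩
  have : 0 < regSol P l δ := hball (by
    rw [Real.dist_eq, sub_zero, abs_of_pos hδ]
    exact (min_le_left _ _).trans_lt (by linarith))
  positivity

/-- The regular solution and its flux have no common zero. -/
lemma regSol_sq_add_regFlux_sq_pos (P : Params) {l : ℝ} (hl : 0 < l) {x : ℝ} (hx : 0 < x) :
    0 < regSol P l x ^ 2 + regFlux P l x ^ 2 := by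
  by_contra hcon
  have h1 : regSol P l x = 0 := by nlinarith [sq_nonneg (regSol P l x), sq_nonneg (regFlux P l x)]
  have h2 : regFlux P l x = 0 := by nlinarith [sq_nonneg (regSol P l x), sq_nonneg (regFlux P l x)]
  have h3 := integral_regSol_sq P l hx
  rw [h1, h2] at h3
  have := mul_pos (mul_pos hl P.two_sub_pos) (integral_regSol_sq_pos P l hx)
  simp only [ne_eq, OfNat.ofNat_ne_zero, not_false_eq_true, zero_pow, mul_zero, add_zero] at h3
  linarith

/-- Lagrange's identity: the Wronskian of the two solutions has derivative (l-k) x^(2s) y_l y_k, and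
it vanishes at both ends, at 0 because the fluxes do and at 1 because the solutions do. -/
lemma integral_regSol_mul_regSol (P : Params) {l k : ℝ} (hlk : l ≠ k)
    (hl : regSol P l 1 = 0) (hk : regSol P k 1 = 0) :
    ∫ t in (0 : ℝ)..1, t ^ (2 * P.s) * (regSol P l t * regSol P k t) = 0 := by
  have hs := P.s_pos
  have hderiv : ∀ t ∈ Ioo (0 : ℝ) 1,
      HasDerivAt (fun t => regSol P l t * regFlux P k t - regSol P k t * regFlux P l t)
        ((l - k) * (t ^ (2 * P.s) * (regSol P l t * regSol P k t))) t := by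
    intro t ht
    have hd := ((hasDerivAt_regSol P l ht.1).mul (hasDerivAt_regFlux P k ht.1)).sub
      ((hasDerivAt_regSol P k ht.1).mul (hasDerivAt_regFlux P l ht.1))
    exact hd.congr_deriv (by ring)
  have hcl := continuous_regSol P l
  have hck := continuous_regSol P k
  have hint : IntervalIntegrable (fun t => (l - k) * (t ^ (2 * P.s) *
      (regSol P l t * regSol P k t))) volume 0 1 :=
    (continuous_const.mul ((Real.continuous_rpow_const (by linarith)).mul
      (hcl.mul hck))).intervalIntegrable _ _
  have hftc := intervalIntegral.integral_eq_sub_of_hasDerivAt_of_le zero_le_one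
    ((hcl.mul (continuous_regFlux P k)).sub (hck.mul (continuous_regFlux P l))).continuousOn
    hderiv hint
  rw [intervalIntegral.integral_const_mul] at hftc
  simp only [Pi.sub_apply, Pi.mul_apply, regFlux_zero, hl, hk, zero_mul, mul_zero, sub_zero] at hftc
  exact (mul_eq_zero.1 hftc).resolve_left (sub_ne_zero.2 hlk)

/-! ### The normalized eigenfunctions -/

/-- The eigenvalue `((2-α)/2)² c²` that corresponds to the zero `c` of `J_ν`. -/
def eigOf (P : Params) (c : ℝ) : ℝ := ((2 - P.α) / 2) ^ 2 * c ^ 2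

/-- The normalized eigenfunction that corresponds to the zero `c` of `J_ν`. -/
def eigenfun (P : Params) (c x : ℝ) : ℝ :=
  √(2 - P.α) / |deriv (besselJ P.ν) c| * x ^ ((1 - P.α) / 2) *
    besselJ P.ν (c * x ^ ((2 - P.α) / 2))

lemma eigOf_pos (P : Params) {c : ℝ} (hc : 0 < c) : 0 < eigOf P c := by
  have := P.two_sub_pos
  unfold eigOf
  positivity

lemma eigOf_div (P : Params) (c : ℝ) : eigOf P c / (2 - P.α) ^ 2 = c ^ 2 / 4 := by
  have := P.two_sub_pos.ne'
  unfold eigOf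
  field_simp
  ring

lemma eigOf_injOn (P : Params) {c d : ℝ} (hc : 0 < c) (hd : 0 < d) (h : eigOf P c = eigOf P d) :
    c = d := by
  have h2 := eigOf_div P c
  rw [h, eigOf_div] at h2
  nlinarith

lemma eigenfun_eq (P : Params) {c x : ℝ} (hc : 0 < c) (hx : 0 < x) :
    eigenfun P c x = √(2 - P.α) / |deriv (besselJ P.ν) c| * (c / 2) ^ P.ν *
      (x ^ P.s * regSol P (eigOf P c) x) := by
  unfold eigenfun regSol
  rw [besselJ_eq _ (by positivity), eigOf_div, mul_pow, ← Real.rpow_mul_natCast hx.le]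
  have e1 : x ^ ((2 - P.α) / 2 * (2 : ℕ)) = x ^ (2 - P.α) := by congr 1; push_cast; ring
  have e2 : (c * x ^ ((2 - P.α) / 2) / 2) ^ P.ν = (c / 2) ^ P.ν * x ^ P.σ := by
    rw [show c * x ^ ((2 - P.α) / 2) / 2 = c / 2 * x ^ ((2 - P.α) / 2) by ring,
      Real.mul_rpow (by positivity) (by positivity), ← Real.rpow_mul hx.le]
    congr 2
    linear_combination P.ν_mul / 2
  have e3 : x ^ P.s = x ^ ((1 - P.α) / 2) * x ^ P.σ := by
    rw [← Real.rpow_add hx]; rfl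
  rw [e1, e2, e3, show c ^ 2 * x ^ (2 - P.α) / 4 = c ^ 2 / 4 * x ^ (2 - P.α) by ring]
  ring

lemma regSol_one (P : Params) {c : ℝ} (hc : 0 < c) :
    regSol P (eigOf P c) 1 = 0 ↔ besselJ P.ν c = 0 := by
  rw [besselJ_eq_zero_iff _ hc]
  unfold regSol
  rw [Real.one_rpow, mul_one, eigOf_div]

/-- In the Pohozaev identity at x = 1 only the flux term survives, and the flux there is
proportional to J_ν'(c). This explains the normalizing factor √(2-α)/|J_ν'(c)| of the
eigenfunctions. -/
lemma deriv_besselJ_sq (P : Params) {c : ℝ} (hc : 0 < c) (h0 : besselJ P.ν c = 0) :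
    deriv (besselJ P.ν) c ^ 2 = (2 - P.α) * ((c / 2) ^ P.ν) ^ 2 *
      ∫ t in (0 : ℝ)..1, t ^ (2 * P.s) * regSol P (eigOf P c) t ^ 2 := by
  have h1 := integral_regSol_sq P (eigOf P c) one_pos
  rw [(regSol_one P hc).2 h0, Real.one_rpow] at h1
  have hα := P.two_sub_pos
  have h2 : regFlux P (eigOf P c) 1 =
      -((2 - P.α) * (c ^ 2 / 4)) * besselEntire (P.ν + 1) (c ^ 2 / 4) := by
    unfold regFlux
    rw [Real.one_rpow, Real.one_rpow, mul_one, mul_one, eigOf_div, ← eigOf_div P c]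
    field_simp
  rw [deriv_besselJ P.ν_nonneg hc h0]
  rw [h2] at h1
  have h3 : eigOf P c = (2 - P.α) ^ 2 * (c ^ 2 / 4) := by unfold eigOf; ring
  have h4 : (2 - P.α) ^ 2 * (c ^ 2 / 4) ≠ 0 := by positivity
  refine mul_left_cancel₀ (h3 ▸ h4) ?_
  linear_combination -((c / 2) ^ P.ν) ^ 2 * h1 +
    ((c / 2) ^ P.ν) ^ 2 * (c / 2) ^ 2 * besselEntire (P.ν + 1) (c ^ 2 / 4) ^ 2 * h3

lemma deriv_besselJ_ne_zero (P : Params) {c : ℝ} (hc : 0 < c) (h0 : besselJ P.ν c = 0) :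
    deriv (besselJ P.ν) c ≠ 0 := by
  intro h
  have h1 := deriv_besselJ_sq P hc h0
  have h2 := mul_pos (mul_pos P.two_sub_pos (sq_pos_of_pos (Real.rpow_pos_of_pos
    (half_pos hc) P.ν))) (integral_regSol_sq_pos P (eigOf P c) one_pos)
  rw [h] at h1
  linarith

lemma integral_eigenfun_mul (P : Params) {c d : ℝ} (hc : 0 < c) (hd : 0 < d)
    (hc0 : besselJ P.ν c = 0) (hd0 : besselJ P.ν d = 0) :
    ∫ x in Ioo (0 : ℝ) 1, eigenfun P c x * eigenfun P d x = if c = d then 1 else 0 := by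
  have h1 : ∀ x ∈ Ioo (0 : ℝ) 1, eigenfun P c x * eigenfun P d x =
      √(2 - P.α) / |deriv (besselJ P.ν) c| * (c / 2) ^ P.ν *
      (√(2 - P.α) / |deriv (besselJ P.ν) d| * (d / 2) ^ P.ν) *
      (x ^ (2 * P.s) * (regSol P (eigOf P c) x * regSol P (eigOf P d) x)) := by
    intro x hx
    rw [eigenfun_eq P hc hx.1, eigenfun_eq P hd hx.1, two_mul, Real.rpow_add hx.1]
    ring
  rw [setIntegral_congr_fun measurableSet_Ioo h1, integral_const_mul,
    ← integral_Ioc_eq_integral_Ioo, ← intervalIntegral.integral_of_le zero_le_one]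
  split_ifs with h
  · subst h
    have h2 := deriv_besselJ_sq P hc hc0
    have h3 := deriv_besselJ_ne_zero P hc hc0
    have h4 : √(2 - P.α) ^ 2 = 2 - P.α := Real.sq_sqrt P.two_sub_pos.le
    simp only [← sq] at h2 ⊢
    have h5 : |deriv (besselJ P.ν) c| ^ 2 ≠ 0 := by rw [sq_abs]; positivity
    rw [mul_pow, div_pow, h4, sq_abs, div_mul_eq_mul_div, div_mul_eq_mul_div, ← h2, div_self]
    positivity
  · rw [integral_regSol_mul_regSol P (fun h' => h (eigOf_injOn P hc hd h'))
      ((regSol_one P hc).2 hc0) ((regSol_one P hd).2 hd0), mul_zero]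

/-! ### Zeros of `J_ν` -/

/-- The positive zeros of `J_ν`. -/
def besselZeros (ν : ℝ) : Set ℝ := {x | 0 < x ∧ besselJ ν x = 0}

/-- An accumulation point a in [0,R] is impossible: a = 0 because the entire factor is positive at
0, and a > 0 because zeros are simple. Working with the entire factor instead of J_ν covers both
cases with one differentiable function. -/
lemma finite_besselZeros (P : Params) (R : ℝ) : (besselZeros P.ν ∩ Iic R).Finite := by
  by_contra hinf
  have hν := P.ν_nonneg
  obtain ⟨a, ha, hacc⟩ := Set.Infinite.exists_accPt_of_subset_isCompact hinf
    (isCompact_Icc (a := 0) (b := R)) fun x hx => ⟨hx.1.1.le, hx.2⟩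
  set f : ℝ → ℝ := fun x => besselEntire P.ν (x ^ 2 / 4) with hf
  have hd : ∀ x, HasDerivAt f (-besselEntire (P.ν + 1) (x ^ 2 / 4) * (2 * x / 4)) x := by
    intro x
    have h1 : HasDerivAt (fun x : ℝ => x ^ 2 / 4) (2 * x / 4) x := by
      simpa using (hasDerivAt_pow 2 x).div_const 4
    exact (hasDerivAt_besselEntire hν (x ^ 2 / 4)).comp x h1
  have hfr : ∃ᶠ x in 𝓝[≠] a, f x = 0 := by
    rw [accPt_iff_frequently_nhdsNE] at hacc
    refine hacc.mono fun x hx => ?_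
    exact (besselJ_eq_zero_iff _ hx.1.1).1 hx.1.2
  have hfa : f a = 0 := by
    by_contra hne
    have := ((hd a).continuousAt.eventually_ne hne).filter_mono (nhdsWithin_le_nhds (s := {a}ᶜ))
    exact hfr (this.mono fun x hx => hx)
  rcases ha.1.eq_or_lt with h0 | h0
  · rw [← h0] at hfa
    have := besselEntire_zero_pos hν
    simp only [hf, ne_eq, OfNat.ofNat_ne_zero, not_false_eq_true, zero_pow, zero_div] at hfa
    linarith
  · have hJ : besselJ P.ν a = 0 := (besselJ_eq_zero_iff _ h0).2 hfa
    have hne := deriv_besselJ_ne_zero P h0 hJ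
    rw [deriv_besselJ hν h0 hJ] at hne
    have hd0 : -besselEntire (P.ν + 1) (a ^ 2 / 4) * (2 * a / 4) ≠ 0 := by
      intro h
      apply hne
      linear_combination (a / 2) ^ P.ν * h
    exact hfr ((hd a).eventually_ne hd0)

/-- Infinitely many zeros and local finiteness give a zero c beyond b and only finitely many
candidates up to c. This makes the `sInf` in `besselZero` an attained minimum instead of the default
value on an empty set. -/
lemma exists_isLeast_besselZeros (P : Params) (h : (besselZeros P.ν).Infinite) (b : ℝ) :
    ∃ a, IsLeast {x | x ∈ besselZeros P.ν ∧ b < x} a := by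
  obtain ⟨c, hc, hbc⟩ : ∃ c ∈ besselZeros P.ν, b < c := by
    by_contra hcon
    push Not at hcon
    exact h ((finite_besselZeros P b).subset fun x hx => ⟨hx, hcon x hx⟩)
  have hfin : ({x | x ∈ besselZeros P.ν ∧ b < x} ∩ Iic c).Finite :=
    (finite_besselZeros P c).subset fun x hx => ⟨hx.1.1, hx.2⟩
  obtain ⟨a, ha, hmin⟩ := hfin.exists_minimal ⟨c, ⟨hc, hbc⟩, le_refl c⟩
  refine ⟨a, ha.1, fun x hx => ?_⟩
  rcases le_total x c with h1 | h1
  · by_contra hlt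
    exact hlt (hmin ⟨hx, h1⟩ (not_le.1 hlt).le)
  · exact le_trans ha.2 h1

lemma isLeast_besselZero_zero (P : Params) (h : (besselZeros P.ν).Infinite) :
    IsLeast (besselZeros P.ν) (besselZero P.ν 0) := by
  obtain ⟨a, ha⟩ := exists_isLeast_besselZeros P h 0
  have : {x | x ∈ besselZeros P.ν ∧ 0 < x} = besselZeros P.ν :=
    Set.ext fun x => ⟨fun hx => hx.1, fun hx => ⟨hx, hx.1⟩⟩
  rw [this] at ha
  have h2 : besselZero P.ν 0 = a := ha.csInf_eq
  rwa [h2]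

lemma isLeast_besselZero_succ (P : Params) (h : (besselZeros P.ν).Infinite) (n : ℕ) :
    IsLeast {x | x ∈ besselZeros P.ν ∧ besselZero P.ν n < x} (besselZero P.ν (n + 1)) := by
  obtain ⟨a, ha⟩ := exists_isLeast_besselZeros P h (besselZero P.ν n)
  have : {x | x ∈ besselZeros P.ν ∧ besselZero P.ν n < x}
      = {x | besselZero P.ν n < x ∧ besselJ P.ν x = 0} :=
    Set.ext fun x => ⟨fun hx => ⟨hx.2, hx.1.2⟩,
      fun hx => ⟨⟨(besselZero_nonneg P.ν n).trans_lt hx.1, hx.2⟩, hx.1⟩⟩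
  have h2 : besselZero P.ν (n + 1) = a := by
    rw [this] at ha
    exact ha.csInf_eq
  rwa [h2]

lemma besselZero_mem (P : Params) (h : (besselZeros P.ν).Infinite) (n : ℕ) :
    besselZero P.ν n ∈ besselZeros P.ν := by
  cases n with
  | zero => exact (isLeast_besselZero_zero P h).1
  | succ n => exact (isLeast_besselZero_succ P h n).1.1

lemma strictMono_besselZero (P : Params) (h : (besselZeros P.ν).Infinite) :
    StrictMono (besselZero P.ν) :=
  strictMono_nat_of_lt_succ fun n => (isLeast_besselZero_succ P h n).1.2

/-- A zero z missed by the enumeration would, by minimality at each stage, exceed every `besselZero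
P.ν n`; there would then be infinitely many zeros below z. -/
lemma exists_besselZero_eq (P : Params) (h : (besselZeros P.ν).Infinite) {z : ℝ}
    (hz : z ∈ besselZeros P.ν) : ∃ n, besselZero P.ν n = z := by
  by_contra hcon
  push Not at hcon
  have hlt : ∀ n, besselZero P.ν n < z := by
    intro n
    induction n with
    | zero => exact lt_of_le_of_ne ((isLeast_besselZero_zero P h).2 hz) (hcon 0)
    | succ n ih => exact lt_of_le_of_ne ((isLeast_besselZero_succ P h n).2 ⟨hz, ih⟩) (hcon _)
  refine Set.infinite_of_injective_forall_mem (strictMono_besselZero P h).injective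
    (fun n => (⟨besselZero_mem P h n, (hlt n).le⟩ :
      besselZero P.ν n ∈ besselZeros P.ν ∩ Iic z)) (finite_besselZeros P z)

/-! ### The Volterra operator `(K d)(x) = x^s ∫_x^1 t^(-(1/2+σ)) d(t) dt` -/

section Volterra

variable {𝕜 : Type*} [RCLike 𝕜] {P : Params}

/-- The weight `t^(-(1/2+σ))`. -/
def rho (P : Params) (t : ℝ) : ℝ := t ^ (-(1 / 2 + P.σ))

lemma rho_pos (P : Params) {t : ℝ} (ht : 0 < t) : 0 < rho P t := Real.rpow_pos_of_pos ht _

lemma rho_sq (P : Params) {t : ℝ} (ht : 0 < t) : rho P t * rho P t = t ^ (-(1 + 2 * P.σ)) := by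
  unfold rho
  rw [← Real.rpow_add ht]; congr 1; ring

lemma rho_anti (P : Params) {x t : ℝ} (hx : 0 < x) (hxt : x ≤ t) : rho P t ≤ rho P x :=
  Real.rpow_le_rpow_of_nonpos hx hxt (by linarith [P.σ_nonneg])

lemma continuousOn_rho (P : Params) : ContinuousOn (rho P) (Ioi 0) :=
  fun x hx => (Real.continuousAt_rpow_const x _ (Or.inl (ne_of_gt hx))).continuousWithinAt

lemma memLp_indicator_rho (𝕜 : Type*) [RCLike 𝕜] (P : Params) {x : ℝ} (hx : 0 < x) :
    MemLp ((Ioi x).indicator fun t => (rho P t : 𝕜)) 2 vol01 := by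
  refine MemLp.of_bound ?_ (rho P x) (Eventually.of_forall fun t => ?_)
  · refine AEStronglyMeasurable.restrict ?_
    rw [aestronglyMeasurable_indicator_iff measurableSet_Ioi]
    refine ContinuousOn.aestronglyMeasurable ?_ measurableSet_Ioi
    exact RCLike.continuous_ofReal.comp_continuousOn
      ((continuousOn_rho P).mono (Ioi_subset_Ioi hx.le))
  · by_cases ht : x < t
    · rw [indicator_of_mem (mem_Ioi.2 ht), RCLike.norm_ofReal, abs_of_pos (rho_pos P (hx.trans ht))]
      exact rho_anti P hx ht.le
    · rw [indicator_of_notMem (by simpa using ht), norm_zero]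
      exact (rho_pos P hx).le

/-- The function `t ↦ t^(-(1/2+σ)) 1_{t > x}` as an element of `L²(0,1)`, for `x > 0`. -/
def rhoTail (𝕜 : Type*) [RCLike 𝕜] (P : Params) (x : ℝ) : L2 𝕜 :=
  if hx : 0 < x then (memLp_indicator_rho 𝕜 P hx).toLp _ else 0

lemma rhoTail_ae (𝕜 : Type*) [RCLike 𝕜] (P : Params) {x : ℝ} (hx : 0 < x) :
    rhoTail 𝕜 P x =ᵐ[vol01] (Ioi x).indicator fun t => (rho P t : 𝕜) := by
  unfold rhoTail
  rw [dif_pos hx]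
  exact (memLp_indicator_rho 𝕜 P hx).coeFn_toLp

lemma inner_rhoTail_ae {x : ℝ} (hx : 0 < x) (d : L2 𝕜) :
    (fun t => inner 𝕜 (rhoTail 𝕜 P x t) (d t)) =ᵐ[vol01]
      (Ioi x).indicator fun t => (rho P t : 𝕜) * d t := by
  filter_upwards [rhoTail_ae 𝕜 P hx] with t ht
  rw [ht, RCLike.inner_apply]
  by_cases h : t ∈ Ioi x
  · rw [indicator_of_mem h, indicator_of_mem h, RCLike.conj_ofReal, mul_comm]
  · rw [indicator_of_notMem h, indicator_of_notMem h, map_zero, mul_zero]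

lemma integrableOn_rho_mul {x : ℝ} (hx : 0 < x) (d : L2 𝕜) :
    IntegrableOn (fun t => (rho P t : 𝕜) * d t) (Ioc x 1) := by
  have h := (L2.integrable_inner (𝕜 := 𝕜) (rhoTail 𝕜 P x) d).congr (inner_rhoTail_ae hx d)
  rw [integrable_indicator_iff measurableSet_Ioi, IntegrableOn, Measure.restrict_restrict
    measurableSet_Ioi, Ioi_inter_Ioo, sup_eq_left.2 hx.le] at h
  exact (integrableOn_Ioc_iff_integrableOn_Ioo enorm_ne_top).2 h

lemma inner_rhoTail {x : ℝ} (hx : x ∈ Ioo (0 : ℝ) 1) (d : L2 𝕜) :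
    inner 𝕜 (rhoTail 𝕜 P x) d = ∫ t in x..1, (rho P t : 𝕜) * d t := by
  rw [L2.inner_def, integral_congr_ae (inner_rhoTail_ae hx.1 d),
    integral_indicator measurableSet_Ioi, Measure.restrict_restrict measurableSet_Ioi,
    Ioi_inter_Ioo, sup_eq_left.2 hx.1.le, intervalIntegral.integral_of_le hx.2.le,
    integral_Ioc_eq_integral_Ioo]

lemma norm_rhoTail_le {x : ℝ} (hx : x ∈ Ioo (0 : ℝ) 1) : ‖rhoTail 𝕜 P x‖ ≤ rho P x := by
  have h := Lp.norm_le_of_ae_bound (f := rhoTail 𝕜 P x) (C := rho P x) (rho_pos P hx.1).le (by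
    filter_upwards [rhoTail_ae 𝕜 P hx.1] with t ht
    rw [ht]
    by_cases h : t ∈ Ioi x
    · rw [indicator_of_mem h, RCLike.norm_ofReal, abs_of_pos (rho_pos P (hx.1.trans h))]
      exact rho_anti P hx.1 (le_of_lt h)
    · rw [indicator_of_notMem h, norm_zero]
      exact (rho_pos P hx.1).le)
  have h1 : measureUnivNNReal vol01 = 1 := by simp [measureUnivNNReal]
  simpa [h1] using h

lemma continuousOn_inner_rhoTail (d : L2 𝕜) :
    ContinuousOn (fun x => inner 𝕜 (rhoTail 𝕜 P x) d) (Ioo 0 1) := by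
  have h : ContinuousOn (fun x => ∫ t in x..1, (rho P t : 𝕜) * d t) (Ioo 0 1) := by
    intro x hx
    have hx2 : 0 < x / 2 := half_pos hx.1
    have hle : x / 2 ≤ 1 := by linarith [hx.2, hx.1]
    have hI : IntegrableOn (fun t => (rho P t : 𝕜) * d t) (uIcc (x / 2) 1) := by
      rw [uIcc_of_le hle]
      exact (integrableOn_Icc_iff_integrableOn_Ioc enorm_ne_top).2 (integrableOn_rho_mul hx2 d)
    have hc := intervalIntegral.continuousOn_primitive_interval_left hI
    rw [uIcc_of_le hle] at hc
    exact (hc.continuousAt (Icc_mem_nhds (by linarith [hx.1]) hx.2)).continuousWithinAt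
  exact h.congr fun x hx => inner_rhoTail hx d

/-- The function `K d`. -/
def volterraFun (P : Params) (d : L2 𝕜) (x : ℝ) : 𝕜 :=
  (x ^ P.s : ℝ) * inner 𝕜 (rhoTail 𝕜 P x) d

lemma continuousOn_volterraFun (d : L2 𝕜) : ContinuousOn (volterraFun P d) (Ioo 0 1) :=
  (RCLike.continuous_ofReal.comp_continuousOn (continuousOn_rpow _)).mul
    (continuousOn_inner_rhoTail d)

/-- The exponent is 2s - (1+2σ) = -α. This function dominates the squared row norms of the kernel of
K, and α < 1 is exactly its integrability on (0,1). -/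
lemma rpow_s_mul_rho {x : ℝ} (hx : 0 < x) :
    (x ^ P.s * rho P x) ^ 2 = x ^ (-P.α) := by
  unfold rho
  rw [← Real.rpow_add hx, ← Real.rpow_mul_natCast hx.le]
  congr 1
  push_cast
  linear_combination P.two_s

lemma integrableOn_rpow_neg_α (P : Params) : IntegrableOn (fun x : ℝ => x ^ (-P.α)) (Ioo 0 1) :=
  (intervalIntegral.integrableOn_Ioo_rpow_iff one_pos).2 (by linarith [P.α_lt_one])

lemma sq_rpow_s_mul_norm_le {x : ℝ} (hx : x ∈ Ioo (0 : ℝ) 1) :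
    (x ^ P.s) ^ 2 * ‖rhoTail 𝕜 P x‖ ^ 2 ≤ x ^ (-P.α) := by
  rw [← mul_pow, ← rpow_s_mul_rho hx.1]
  have := Real.rpow_pos_of_pos hx.1 P.s
  have := norm_rhoTail_le (𝕜 := 𝕜) (P := P) hx
  gcongr

lemma norm_volterraFun_sq (d : L2 𝕜) (x : ℝ) :
    ‖volterraFun P d x‖ ^ 2 = (x ^ P.s) ^ 2 * ‖inner 𝕜 (rhoTail 𝕜 P x) d‖ ^ 2 := by
  unfold volterraFun
  rw [norm_mul, RCLike.norm_ofReal, mul_pow, sq_abs]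

lemma norm_volterraFun_sq_le (d : L2 𝕜) {x : ℝ} (hx : x ∈ Ioo (0 : ℝ) 1) :
    ‖volterraFun P d x‖ ^ 2 ≤ x ^ (-P.α) * ‖d‖ ^ 2 := by
  rw [norm_volterraFun_sq d x]
  calc _ ≤ (x ^ P.s) ^ 2 * (‖rhoTail 𝕜 P x‖ * ‖d‖) ^ 2 := by
        gcongr; exact norm_inner_le_norm _ _
    _ = (x ^ P.s) ^ 2 * ‖rhoTail 𝕜 P x‖ ^ 2 * ‖d‖ ^ 2 := by ring
    _ ≤ _ := by gcongr; exact sq_rpow_s_mul_norm_le hx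

lemma memLp_volterraFun (P : Params) (d : L2 𝕜) : MemLp (volterraFun P d) 2 vol01 := by
  have hm := (continuousOn_volterraFun (P := P) d).aestronglyMeasurable (μ := volume)
    measurableSet_Ioo
  refine (memLp_two_iff_integrable_sq_norm hm).2 ?_
  refine Integrable.mono' ((integrableOn_rpow_neg_α P).mul_const (‖d‖ ^ 2)) (hm.norm.pow 2) ?_
  filter_upwards [ae_restrict_mem measurableSet_Ioo] with x hx
  rw [Real.norm_of_nonneg (sq_nonneg _)]
  exact norm_volterraFun_sq_le d hx

lemma integrable_norm_volterraFun_sq (P : Params) (d : L2 𝕜) :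
    IntegrableOn (fun x => ‖volterraFun P d x‖ ^ 2) (Ioo 0 1) :=
  (memLp_two_iff_integrable_sq_norm (memLp_volterraFun P d).1).1 (memLp_volterraFun P d)

/-- The Volterra operator `(K d)(x) = x^s ∫_x^1 t^(-(1/2+σ)) d(t) dt` on `L²(0,1)`. -/
def volterra (𝕜 : Type*) [RCLike 𝕜] (P : Params) : L2 𝕜 →L[𝕜] L2 𝕜 :=
  LinearMap.mkContinuous
    { toFun := fun d => (memLp_volterraFun P d).toLp _
      map_add' := fun d e => by
        rw [← MemLp.toLp_add]
        congr 1
        ext x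
        simp only [volterraFun, Pi.add_apply, inner_add_right, mul_add]
      map_smul' := fun c d => by
        rw [RingHom.id_apply, ← MemLp.toLp_const_smul]
        congr 1
        ext x
        simp only [volterraFun, Pi.smul_apply, inner_smul_right, smul_eq_mul]
        ring } (√(∫ x in Ioo (0 : ℝ) 1, x ^ (-P.α))) (fun d => by
    have h0 : 0 ≤ ∫ x in Ioo (0 : ℝ) 1, x ^ (-P.α) :=
      setIntegral_nonneg measurableSet_Ioo fun x hx => Real.rpow_nonneg (le_of_lt hx.1) _
    refine le_of_sq_le_sq ?_ (by positivity)
    rw [mul_pow, Real.sq_sqrt h0, ← integral_mul_const]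
    refine (norm_toLp_sq (memLp_volterraFun P d)).trans_le ?_
    exact setIntegral_mono_on (integrable_norm_volterraFun_sq P d)
      ((integrableOn_rpow_neg_α P).mul_const _) measurableSet_Ioo
      fun x hx => norm_volterraFun_sq_le d hx)

lemma volterra_apply (d : L2 𝕜) : volterra 𝕜 P d = (memLp_volterraFun P d).toLp _ := rfl

/-- K is Hilbert–Schmidt: for fixed x, Bessel's inequality bounds the sum of |(K b_i)(x)|² by x^(2s)
‖ρ 1_{(x,1)}‖² ≤ x^(-α), and this is integrated over x. -/
lemma isCompactOperator_volterra (𝕜 : Type*) [RCLike 𝕜] (P : Params) :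
    IsCompactOperator (volterra 𝕜 P) := by
  obtain ⟨w, b, -⟩ := exists_hilbertBasis 𝕜 (L2 𝕜)
  refine b.isCompactOperator_of_sum_norm_sq_le (volterra 𝕜 P)
    (C := ∫ x in Ioo (0 : ℝ) 1, x ^ (-P.α)) fun s => ?_
  have h : ∀ i ∈ s, ‖volterra 𝕜 P (b i)‖ ^ 2 = ∫ x in Ioo (0 : ℝ) 1, ‖volterraFun P (b i) x‖ ^ 2 :=
    fun i _ => norm_toLp_sq (memLp_volterraFun P (b i))
  rw [Finset.sum_congr rfl h, ← integral_finsetSum _ fun i _ => integrable_norm_volterraFun_sq P _]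
  refine setIntegral_mono_on (integrable_finsetSum _ fun i _ => integrable_norm_volterraFun_sq P _)
    (integrableOn_rpow_neg_α P) measurableSet_Ioo fun x hx => ?_
  rw [Finset.sum_congr rfl fun i _ => norm_volterraFun_sq (b i) x, ← Finset.mul_sum]
  refine le_trans ?_ (sq_rpow_s_mul_norm_le (𝕜 := 𝕜) hx)
  gcongr
  simp only [norm_inner_symm (rhoTail 𝕜 P x)]
  exact b.orthonormal.sum_inner_products_le _

end Volterra

/-! ### The first order factor of the operator -/

section Factor

variable {𝕜 : Type*} [RCLike 𝕜] {P : Params}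

/-- The first order expression `D f = s x^(α/2-1) f - x^(α/2) f'`. -/
def gradFun (f : TestSpace 𝕜 P) (x : ℝ) : 𝕜 :=
  (P.s * x ^ (P.α / 2 - 1)) • f x - (x ^ (P.α / 2)) • deriv f x

lemma memLp_gradFun (f : TestSpace 𝕜 P) : MemLp (gradFun f) 2 vol01 :=
  (memLp_weight (continuousOn_const.mul (continuousOn_rpow _)) f.contDiff.continuous
    f.hasCompactSupport f.tsupport_subset).sub
    (memLp_weight (continuousOn_rpow _) f.contDiff_deriv.continuous f.hasCompactSupport.deriv
      (f.tsupport_deriv.trans f.tsupport_subset))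

/-- Completing the square. The integrands on the two sides differ by s times the derivative of
x^(α-1) times the pointwise inner product of f and g, which integrates to 0. The coefficients of
x^(α-2) match precisely by the indicial equation for s. -/
lemma energyInner_eq_add (f g : TestSpace 𝕜 P) :
    energyInner f g = (∫ x in Ioo (0 : ℝ) 1, inner 𝕜 (f x) (g x)) +
      ∫ x in Ioo (0 : ℝ) 1, inner 𝕜 (gradFun f x) (gradFun g x) := by
  have hwd : ∀ x ∈ Ioo (0 : ℝ) 1,
      HasDerivAt (fun x : ℝ => x ^ (P.α - 1)) ((P.α - 1) * x ^ (P.α - 1 - 1)) x :=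
    fun x hx => Real.hasDerivAt_rpow_const (Or.inl hx.1.ne')
  have hcf := f.contDiff.continuous
  have hcg := g.contDiff.continuous
  have hcf' := f.contDiff_deriv.continuous
  have hcg' := g.contDiff_deriv.continuous
  have hsub := tsupport_inner_subset (𝕜 := 𝕜) f g
  have hparts := integral_parts hwd (continuousOn_const.mul (continuousOn_rpow _))
    (f := fun x => inner 𝕜 (f x) (g x))
    (f' := fun x => inner 𝕜 (f x) (deriv g x) + inner 𝕜 (deriv f x) (g x))
    (fun x => (f.differentiable x).hasDerivAt.inner 𝕜 (g.differentiable x).hasDerivAt)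
    ((hcf.inner hcg').add (hcf'.inner hcg))
    (f.hasCompactSupport.of_isClosed_subset (isClosed_tsupport _) hsub)
    (hsub.trans f.tsupport_subset)
  have j1 : Integrable fun x => x ^ (P.α - 1) •
      (inner 𝕜 (f x) (deriv g x) + inner 𝕜 (deriv f x) (g x)) := by
    simp only [smul_add]
    exact (integrable_inner (continuousOn_rpow _) f hcf hcg' subset_rfl).add
      (integrable_inner (continuousOn_rpow _) f hcf' hcg f.tsupport_deriv)
  have j2 : Integrable fun x => ((P.α - 1) * x ^ (P.α - 1 - 1)) • inner 𝕜 (f x) (g x) :=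
    integrable_inner (continuousOn_const.mul (continuousOn_rpow _)) f hcf hcg subset_rfl
  have e1 := integrable_energy1 f g
  have hG : Integrable (fun x => inner 𝕜 (gradFun f x) (gradFun g x)) vol01 := by
    refine (L2.integrable_inner (𝕜 := 𝕜) ((memLp_gradFun f).toLp _)
      ((memLp_gradFun g).toLp _)).congr ?_
    filter_upwards [(memLp_gradFun f).coeFn_toLp, (memLp_gradFun g).coeFn_toLp] with x h1 h2
    rw [h1, h2]
  have hkey : (∫ x in Ioo (0 : ℝ) 1, (inner 𝕜 (f x) (g x) + inner 𝕜 (gradFun f x) (gradFun g x)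
      + P.s • (x ^ (P.α - 1) • (inner 𝕜 (f x) (deriv g x) + inner 𝕜 (deriv f x) (g x))
        + ((P.α - 1) * x ^ (P.α - 1 - 1)) • inner 𝕜 (f x) (g x)))) = energyInner f g := by
    refine setIntegral_congr_fun measurableSet_Ioo fun x hx => ?_
    have hx0 : 0 < x := hx.1
    have hα : x ^ (P.α / 2) * x ^ (P.α / 2) = x ^ P.α := by
      rw [← Real.rpow_add hx0]; congr 1; ring
    have q1 : x ^ (P.α / 2 - 1) = x ^ (P.α / 2) * x⁻¹ := by
      rw [Real.rpow_sub hx0, Real.rpow_one, div_eq_mul_inv]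
    have q2 : x ^ (P.α - 1) = x ^ P.α * x⁻¹ := by
      rw [Real.rpow_sub hx0, Real.rpow_one, div_eq_mul_inv]
    have q3 : x ^ (P.α - 1 - 1) = x ^ P.α * x⁻¹ * x⁻¹ := by
      rw [Real.rpow_sub hx0, q2, Real.rpow_one, div_eq_mul_inv]
    have q4 : P.μ / x ^ (2 - P.α) = P.μ * (x ^ P.α * x⁻¹ * x⁻¹) := by
      rw [← q3, div_eq_mul_inv, ← Real.rpow_neg hx0.le]; congr 2; ring
    have hind := congrArg (fun r : ℝ => (r : 𝕜)) P.indicial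
    push_cast at hind
    simp only [energyIntegrand, gradFun]
    rw [q1, q2, q3, q4, ← hα]
    simp only [RCLike.real_smul_eq_coe_mul, RCLike.inner_apply, map_sub, map_mul,
      RCLike.conj_ofReal]
    push_cast
    linear_combination ((x ^ (P.α / 2) : ℝ) : 𝕜) ^ 2 * ((x : 𝕜)⁻¹) ^ 2 * (g x) *
      (starRingEnd 𝕜) (f x) * hind
  have hz : (∫ x in Ioo (0 : ℝ) 1, P.s • (x ^ (P.α - 1) •
      (inner 𝕜 (f x) (deriv g x) + inner 𝕜 (deriv f x) (g x))
        + ((P.α - 1) * x ^ (P.α - 1 - 1)) • inner 𝕜 (f x) (g x))) = 0 := by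
    rw [integral_smul, integral_add j1.integrableOn j2.integrableOn, hparts, neg_add_cancel,
      smul_zero]
  have h1 := integral_add ((e1.integrableOn (s := Ioo 0 1)).add hG)
    (((j1.add j2).smul P.s).integrableOn (s := Ioo 0 1))
  have h2 := integral_add (e1.integrableOn (s := Ioo 0 1)) hG
  rw [← hkey]
  exact h1.trans ((congrArg₂ (· + ·) h2 hz).trans (add_zero _))

/-- Here t^(-(1/2+σ)) D f = -(t^(-s) f)', so the integral over (x,1) is x^(-s) f(x), as f vanishes
at 1. Thus K is a left inverse of D. -/
lemma volterraFun_gradFun (f : TestSpace 𝕜 P) {x : ℝ} (hx : x ∈ Ioo (0 : ℝ) 1) :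
    volterraFun P ((memLp_gradFun f).toLp _) x = f x := by
  unfold volterraFun
  rw [inner_rhoTail hx]
  have hd : ∀ t ∈ uIcc x 1, HasDerivAt (fun t : ℝ => -(t ^ (-P.s) • f t))
      (-(t ^ (-P.s) • deriv f t + (-P.s * t ^ (-P.s - 1)) • f t)) t := by
    intro t ht
    rw [uIcc_of_le hx.2.le] at ht
    exact ((Real.hasDerivAt_rpow_const (Or.inl (hx.1.trans_le ht.1).ne')).smul
      (f.differentiable t).hasDerivAt).neg
  have hcd : ContinuousOn (fun t : ℝ =>
      -(t ^ (-P.s) • deriv f t + (-P.s * t ^ (-P.s - 1)) • f t)) (uIcc x 1) := by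
    rw [uIcc_of_le hx.2.le]
    have hr : ∀ r : ℝ, ContinuousOn (fun t : ℝ => t ^ r) (Icc x 1) := fun r t ht =>
      (Real.continuousAt_rpow_const t r (Or.inl (hx.1.trans_le ht.1).ne')).continuousWithinAt
    exact (((hr _).smul f.contDiff_deriv.continuous.continuousOn).add
      ((continuousOn_const.mul (hr _)).smul f.contDiff.continuous.continuousOn)).neg
  have hftc := intervalIntegral.integral_eq_sub_of_hasDerivAt hd hcd.intervalIntegrable
  have hf1 : f 1 = 0 := image_eq_zero_of_notMem_tsupport fun h => by
    have := (f.tsupport_subset h).2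
    linarith
  have heq : (∫ t in x..1, (rho P t : 𝕜) * (memLp_gradFun f).toLp (gradFun f) t) =
      ∫ t in x..1, -(t ^ (-P.s) • deriv f t + (-P.s * t ^ (-P.s - 1)) • f t) := by
    rw [intervalIntegral.integral_of_le hx.2.le, intervalIntegral.integral_of_le hx.2.le,
      integral_Ioc_eq_integral_Ioo, integral_Ioc_eq_integral_Ioo]
    refine integral_congr_ae ?_
    have h1 := ae_mono (Measure.restrict_mono (Ioo_subset_Ioo_left hx.1.le) le_rfl)
      (memLp_gradFun f).coeFn_toLp
    filter_upwards [h1, ae_restrict_mem measurableSet_Ioo] with t ht hmem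
    have ht0 : 0 < t := hx.1.trans hmem.1
    rw [ht]
    have e1 : rho P t * t ^ (P.α / 2) = t ^ (-P.s) := by
      unfold rho Params.s
      rw [← Real.rpow_add ht0]; congr 1; ring
    have e2 : rho P t * t ^ (P.α / 2 - 1) = t ^ (-P.s - 1) := by
      unfold rho Params.s
      rw [← Real.rpow_add ht0]; congr 1; ring
    rw [← e1, ← e2]
    simp only [gradFun, RCLike.real_smul_eq_coe_mul]
    push_cast
    ring
  rw [heq, hftc, hf1, smul_zero, neg_zero, zero_sub, neg_neg, RCLike.real_smul_eq_coe_mul,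
    ← mul_assoc, ← RCLike.ofReal_mul, ← Real.rpow_add hx.1]
  simp

/-- The operator `D` on test functions with the energy norm. -/
def testGrad (𝕜 : Type*) [RCLike 𝕜] (P : Params) : TestSpace 𝕜 P →L[𝕜] L2 𝕜 :=
  LinearMap.mkContinuous
    { toFun := fun f => (memLp_gradFun f).toLp _
      map_add' := fun f g => by
        rw [← MemLp.toLp_add]
        congr 1
        ext x
        simp only [gradFun, Pi.add_apply, TestSpace.add_apply, TestSpace.deriv_add, smul_add]
        ring
      map_smul' := fun c f => by
        rw [RingHom.id_apply, ← MemLp.toLp_const_smul]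
        congr 1
        ext x
        simp only [gradFun, Pi.smul_apply, TestSpace.smul_apply, TestSpace.deriv_smul,
          smul_eq_mul, RCLike.real_smul_eq_coe_mul]
        ring } 1 (by
    intro f
    rw [one_mul]
    refine le_of_sq_le_sq ?_ (norm_nonneg _)
    refine (norm_toLp_sq (memLp_gradFun f)).trans_le ?_
    rw [← inner_self_eq_norm_sq (𝕜 := 𝕜) f, TestSpace.inner_def, energyInner_eq_add, map_add]
    have h1 : (∫ x in Ioo (0 : ℝ) 1, inner 𝕜 (f x) (f x))
        = ((∫ x in Ioo (0 : ℝ) 1, ‖f x‖ ^ 2 : ℝ) : 𝕜) := by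
      rw [← integral_ofReal]; simp only [inner_self_eq_norm_sq_to_K, RCLike.ofReal_pow]
    have h2 : (∫ x in Ioo (0 : ℝ) 1, inner 𝕜 (gradFun f x) (gradFun f x))
        = ((∫ x in Ioo (0 : ℝ) 1, ‖gradFun f x‖ ^ 2 : ℝ) : 𝕜) := by
      rw [← integral_ofReal]; simp only [inner_self_eq_norm_sq_to_K, RCLike.ofReal_pow]
    rw [h1, h2, RCLike.ofReal_re, RCLike.ofReal_re]
    exact le_add_of_nonneg_left (integral_nonneg fun x => sq_nonneg _))

/-- The operator `D` on `H^{1,μ}_{α,0}(0,1)`. -/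
def grad (𝕜 : Type*) [RCLike 𝕜] (P : Params) : H1 𝕜 P →L[𝕜] L2 𝕜 :=
  (testGrad 𝕜 P).extend (UniformSpace.Completion.toComplL : TestSpace 𝕜 P →L[𝕜] H1 𝕜 P)

lemma grad_coe (f : TestSpace 𝕜 P) : grad 𝕜 P (f : H1 𝕜 P) = (memLp_gradFun f).toLp _ :=
  ContinuousLinearMap.extend_eq _ UniformSpace.Completion.denseRange_coe
    (UniformSpace.Completion.isUniformInducing_coe _) f

lemma embed_eq_volterra_grad (h : H1 𝕜 P) : embed 𝕜 P h = volterra 𝕜 P (grad 𝕜 P h) := by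
  induction h using UniformSpace.Completion.induction_on with
  | hp => exact isClosed_eq (by fun_prop) (by fun_prop)
  | ih f =>
    rw [embed_coe, grad_coe, volterra_apply]
    refine MemLp.toLp_congr _ _ ?_
    filter_upwards [ae_restrict_mem measurableSet_Ioo] with x hx
    exact (volterraFun_gradFun f hx).symm

lemma inner_eq_add (h k : H1 𝕜 P) :
    inner 𝕜 h k = inner 𝕜 (embed 𝕜 P h) (embed 𝕜 P k) + inner 𝕜 (grad 𝕜 P h) (grad 𝕜 P k) := by
  induction h, k using UniformSpace.Completion.induction_on₂ with
  | hp => exact isClosed_eq (by fun_prop) (by fun_prop)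
  | ih f g =>
    rw [UniformSpace.Completion.inner_coe, TestSpace.inner_def, energyInner_eq_add, embed_coe,
      embed_coe, grad_coe, grad_coe, L2.inner_def, L2.inner_def]
    congr 1
    · refine integral_congr_ae ?_
      filter_upwards [f.memLp.coeFn_toLp, g.memLp.coeFn_toLp] with x h1 h2
      rw [h1, h2]
    · refine integral_congr_ae ?_
      filter_upwards [(memLp_gradFun f).coeFn_toLp, (memLp_gradFun g).coeFn_toLp] with x h1 h2
      rw [h1, h2]

/-- Since h = K D h in L², one has ‖h‖² = ‖K D h‖² + ‖D h‖² ≤ (1+‖K‖²) ‖D h‖², so D is bounded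
below. -/
lemma isClosed_range_grad : IsClosed (range (grad 𝕜 P)) := by
  refine AntilipschitzWith.isClosed_range (K := ⟨√(1 + ‖volterra 𝕜 P‖ ^ 2), Real.sqrt_nonneg _⟩)
    (AddMonoidHomClass.antilipschitz_of_bound _ fun h => ?_) (grad 𝕜 P).uniformContinuous
  change ‖h‖ ≤ √(1 + ‖volterra 𝕜 P‖ ^ 2) * ‖grad 𝕜 P h‖
  refine le_of_sq_le_sq ?_ (by positivity)
  have h1 := congrArg RCLike.re (inner_eq_add h h)
  rw [map_add, inner_self_eq_norm_sq, inner_self_eq_norm_sq, inner_self_eq_norm_sq,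
    embed_eq_volterra_grad] at h1
  rw [mul_pow, Real.sq_sqrt (by positivity), h1]
  have h2 := (volterra 𝕜 P).le_opNorm (grad 𝕜 P h)
  have h3 : ‖volterra 𝕜 P (grad 𝕜 P h)‖ ^ 2 ≤ (‖volterra 𝕜 P‖ * ‖grad 𝕜 P h‖) ^ 2 := by gcongr
  linarith [mul_pow ‖volterra 𝕜 P‖ ‖grad 𝕜 P h‖ 2]

end Factor

/-! ### Density arguments with test functions -/

section TestFunctions

variable {𝕜 : Type*} [RCLike 𝕜] {P : Params}

/-- A smooth function with compact support in `(0,1)` as an element of the test space. -/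
def TestSpace.ofFun (P : Params) (f : ℝ → 𝕜) (h1 : ContDiff ℝ ∞ f) (h2 : HasCompactSupport f)
    (h3 : tsupport f ⊆ Ioo 0 1) : TestSpace 𝕜 P :=
  (TestFunction.mk f h1 h2 h3 : 𝓓(unitIoo, 𝕜))

lemma TestSpace.eq_zero_of_notMem (f : TestSpace 𝕜 P) {x : ℝ} (hx : x ∉ Ioo (0 : ℝ) 1) : f x = 0 :=
  image_eq_zero_of_notMem_tsupport fun h => hx (f.tsupport_subset h)

lemma TestSpace.integral_Ioo (f : TestSpace 𝕜 P) : ∫ x in Ioo (0 : ℝ) 1, f x = ∫ x, f x :=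
  setIntegral_eq_integral_of_forall_compl_eq_zero fun _ hx => f.eq_zero_of_notMem hx

lemma ae_eq_zero_of_forall_test (P : Params) {F : ℝ → 𝕜} (hF : IntegrableOn F (Ioo 0 1))
    (h : ∀ f : TestSpace 𝕜 P, ∫ x in Ioo (0 : ℝ) 1, f x * F x = 0) : F =ᵐ[vol01] 0 := by
  have := isOpen_Ioo.ae_eq_zero_of_integral_contDiff_smul_eq_zero (U := Ioo (0 : ℝ) 1)
    hF.locallyIntegrableOn (fun g h1 h2 h3 => by
      have ht : tsupport (fun x => (g x : 𝕜)) ⊆ tsupport g :=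
        closure_mono fun x hx h0 => hx (by simp only [h0, RCLike.ofReal_zero])
      have h4 := h (TestSpace.ofFun P (fun x => (g x : 𝕜))
        ((RCLike.ofRealCLM (K := 𝕜)).contDiff.comp h1)
        (h2.comp_left (g := fun r : ℝ => (r : 𝕜)) RCLike.ofReal_zero) (ht.trans h3))
      rw [setIntegral_eq_integral_of_forall_compl_eq_zero] at h4
      · refine Eq.trans (integral_congr_ae (Eventually.of_forall fun x => ?_)) h4
        exact RCLike.real_smul_eq_coe_mul (g x) (F x)
      · intro x hx
        rw [TestSpace.eq_zero_of_notMem _ hx, zero_mul])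
  exact (ae_restrict_iff' measurableSet_Ioo).2 this

/-- The power is singular only at 0, which stays away from the support. -/
lemma TestSpace.exists_rpow_smul (r : ℝ) (f : TestSpace 𝕜 P) :
    ∃ g : TestSpace 𝕜 P, ∀ x, g x = x ^ r • f x := by
  have hsub : tsupport (fun x => x ^ r • f x) ⊆ tsupport f :=
    closure_mono fun x hx h0 => hx (by
      have h0' : f x = 0 := h0
      simp only [h0', smul_zero])
  refine ⟨TestSpace.ofFun P (fun x => x ^ r • f x) ?_
    (f.hasCompactSupport.of_isClosed_subset (isClosed_tsupport _) hsub)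
    (hsub.trans f.tsupport_subset), fun x => rfl⟩
  rw [contDiff_iff_contDiffAt]
  intro x
  by_cases hx : x ∈ tsupport f
  · exact (Real.contDiffAt_rpow_const_of_ne (f.tsupport_subset hx).1.ne').smul f.contDiff.contDiffAt
  · refine (contDiffAt_const (c := (0 : 𝕜))).congr_of_eventuallyEq ?_
    filter_upwards [notMem_tsupport_iff_eventuallyEq.1 hx] with y hy
    simp [hy]

lemma TestSpace.exists_tsupport_subset_Icc (f : TestSpace 𝕜 P) :
    ∃ a b : ℝ, 0 < a ∧ b < 1 ∧ a ≤ b ∧ tsupport f ⊆ Icc a b := by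
  rcases (tsupport f).eq_empty_or_nonempty with he | hne
  · exact ⟨1 / 2, 1 / 2, by norm_num, by norm_num, le_rfl, by simp [he]⟩
  · have hc : IsCompact (tsupport f) := f.hasCompactSupport
    obtain ⟨a, ha⟩ := hc.exists_isLeast hne
    obtain ⟨b, hb⟩ := hc.exists_isGreatest hne
    exact ⟨a, b, (f.tsupport_subset ha.1).1, (f.tsupport_subset hb.1).2, ha.2 hb.1,
      fun x hx => ⟨ha.2 hx, hb.2 hx⟩⟩

/-- A test function with mean zero has a primitive that is a test function. -/
lemma TestSpace.exists_primitive (f : TestSpace 𝕜 P) (hf : ∫ x in Ioo (0 : ℝ) 1, f x = 0) :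
    ∃ g : TestSpace 𝕜 P, ∀ x, deriv g x = f x := by
  obtain ⟨a, b, ha, hb, hab, hsub⟩ := f.exists_tsupport_subset_Icc
  have hz : ∀ x, x ∉ Icc a b → f x = 0 := fun x hx =>
    image_eq_zero_of_notMem_tsupport fun h => hx (hsub h)
  have hcf := f.contDiff.continuous
  set g : ℝ → 𝕜 := fun x => ∫ t in (0 : ℝ)..x, f t
  have hd : ∀ x, HasDerivAt g (f x) x := fun x =>
    intervalIntegral.integral_hasDerivAt_right (hcf.intervalIntegrable _ _)
      (hcf.stronglyMeasurableAtFilter _ _) hcf.continuousAt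
  have hderiv : deriv g = f := funext fun x => (hd x).deriv
  have hsupp : tsupport g ⊆ Icc a b := by
    refine closure_minimal (fun x hx => ?_) isClosed_Icc
    by_contra hmem
    apply hx
    rw [mem_Icc, not_and_or, not_le, not_le] at hmem
    rcases hmem with hlt | hlt
    · refine (intervalIntegral.integral_congr (g := fun _ => (0 : 𝕜)) fun t ht => ?_).trans
        (by simp)
      refine hz t fun h => ?_
      rw [mem_uIcc] at ht
      rcases ht with ht | ht <;> linarith [h.1]
    · change (∫ t in (0 : ℝ)..x, f t) = 0
      rw [intervalIntegral.integral_of_le (by linarith),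
        setIntegral_eq_integral_of_forall_compl_eq_zero, ← f.integral_Ioo, hf]
      intro t ht
      refine hz t fun h => ht ⟨by linarith [h.1], by linarith [h.2]⟩
  refine ⟨TestSpace.ofFun P g ?_ (isCompact_Icc.of_isClosed_subset
    (isClosed_tsupport _) hsupp) (hsupp.trans fun x hx => ⟨by linarith [hx.1], by linarith [hx.2]⟩),
    fun x => (hd x).deriv⟩
  rw [contDiff_infty_iff_deriv, hderiv]
  exact ⟨fun x => (hd x).differentiableAt, f.contDiff⟩

/-- `C_c^∞(0,1)` is dense in `L²(0,1)`. -/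
lemma eq_zero_of_forall_inner_test (P : Params) (d : L2 𝕜)
    (h : ∀ f : TestSpace 𝕜 P, inner 𝕜 d (f.memLp.toLp f) = 0) : d = 0 := by
  have hm1 : MemLp (fun _ : ℝ => (1 : 𝕜)) 2 vol01 := memLp_const 1
  have hI : Integrable (fun x => inner 𝕜 (d x) (1 : 𝕜)) vol01 := by
    refine (L2.integrable_inner (𝕜 := 𝕜) d (hm1.toLp _)).congr ?_
    filter_upwards [hm1.coeFn_toLp] with x hx
    rw [hx]
  have h0 := ae_eq_zero_of_forall_test P hI fun f => by
    rw [← h f, L2.inner_def]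
    refine integral_congr_ae ?_
    filter_upwards [f.memLp.coeFn_toLp] with x hx
    rw [hx]
    simp
  refine (Lp.eq_zero_iff_ae_eq_zero).2 ?_
  filter_upwards [h0] with x hx
  simpa using hx

/-- D annihilates x^s, so on x^s g only the derivative of g survives. -/
lemma gradFun_eq_of_deriv (f g k : TestSpace 𝕜 P) (hg : ∀ x, deriv g x = f x)
    (hk : ∀ x, k x = x ^ P.s • g x) {x : ℝ} (hx : 0 < x) :
    gradFun k x = -(x ^ (1 / 2 + P.σ) • f x) := by
  have hd : HasDerivAt k (x ^ P.s • f x + (P.s * x ^ (P.s - 1)) • g x) x := by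
    have h1 := (Real.hasDerivAt_rpow_const (x := x) (p := P.s) (Or.inl hx.ne')).smul
      (g.differentiable x).hasDerivAt
    rw [hg] at h1
    exact h1.congr_of_eventuallyEq (Eventually.of_forall hk)
  unfold gradFun
  rw [hd.deriv, hk]
  have e1 : x ^ (P.α / 2 - 1) * x ^ P.s = x ^ (P.α / 2) * x ^ (P.s - 1) := by
    rw [← Real.rpow_add hx, ← Real.rpow_add hx]; congr 1; ring
  have e2 : x ^ (1 / 2 + P.σ) = x ^ (P.α / 2) * x ^ P.s := by
    rw [← Real.rpow_add hx]; congr 1; unfold Params.s; ring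
  have e1' := congrArg (fun r : ℝ => (r : 𝕜)) e1
  push_cast at e1'
  rw [e2]
  simp only [RCLike.real_smul_eq_coe_mul]
  push_cast
  linear_combination (P.s : 𝕜) * g x * e1'

lemma memLp_rpow_smul {r : ℝ} (f : TestSpace 𝕜 P) :
    MemLp (fun x => x ^ r • f x) 2 vol01 :=
  memLp_weight (continuousOn_rpow r) f.contDiff.continuous f.hasCompactSupport f.tsupport_subset

/-- Du Bois-Reymond's argument, with q = 1/2+σ: testing against D(x^s g) shows that the conjugate of
d times x^q is orthogonal to all derivatives of test functions, hence is constant. A nonzero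
constant is excluded because x^(-q) is not square integrable at 0. -/
lemma eq_zero_of_forall_inner_gradFun (d : L2 𝕜)
    (h : ∀ f : TestSpace 𝕜 P, inner 𝕜 d ((memLp_gradFun f).toLp _) = 0) : d = 0 := by
  set q : ℝ := 1 / 2 + P.σ with hq
  have hq0 : 0 < q := by have := P.σ_nonneg; rw [hq]; linarith
  have hmq : MemLp (fun x : ℝ => ((x ^ q : ℝ) : 𝕜)) 2 vol01 := by
    refine MemLp.of_bound ?_ 1 ?_
    · exact (RCLike.continuous_ofReal.comp
        (Real.continuous_rpow_const hq0.le)).aestronglyMeasurable.restrict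
    · filter_upwards [ae_restrict_mem measurableSet_Ioo] with x hx
      rw [RCLike.norm_ofReal, abs_of_nonneg (Real.rpow_nonneg (le_of_lt hx.1) _)]
      exact Real.rpow_le_one (le_of_lt hx.1) (le_of_lt hx.2) hq0.le
  have hI : Integrable (fun x => inner 𝕜 (d x) ((x ^ q : ℝ) : 𝕜)) vol01 := by
    refine (L2.integrable_inner (𝕜 := 𝕜) d (hmq.toLp _)).congr ?_
    filter_upwards [hmq.coeFn_toLp] with x hx
    rw [hx]
  set A : TestSpace 𝕜 P → 𝕜 := fun f =>
    ∫ x in Ioo (0 : ℝ) 1, f x * inner 𝕜 (d x) ((x ^ q : ℝ) : 𝕜) with hA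
  set B : TestSpace 𝕜 P → 𝕜 := fun f => ∫ x in Ioo (0 : ℝ) 1, f x with hB
  have hAI : ∀ f : TestSpace 𝕜 P,
      Integrable (fun x => f x * inner 𝕜 (d x) ((x ^ q : ℝ) : 𝕜)) vol01 := by
    intro f
    refine (L2.integrable_inner (𝕜 := 𝕜) d ((memLp_rpow_smul (r := q) f).toLp _)).congr ?_
    filter_upwards [(memLp_rpow_smul (r := q) f).coeFn_toLp] with x hx
    rw [hx, RCLike.real_smul_eq_coe_mul, RCLike.inner_apply, RCLike.inner_apply]
    ring
  have hBI : ∀ f : TestSpace 𝕜 P, Integrable f vol01 := fun f =>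
    (f.contDiff.continuous.integrable_of_hasCompactSupport f.hasCompactSupport).restrict
  -- A mean-zero f is g' for a test function g, and D(x^s g) = -x^q f.
  have hA0 : ∀ f, B f = 0 → A f = 0 := by
    intro f hf
    obtain ⟨g, hg⟩ := f.exists_primitive hf
    obtain ⟨k, hk⟩ := g.exists_rpow_smul P.s
    have h1 := h k
    rw [L2.inner_def] at h1
    rw [← neg_eq_zero, ← h1, hA]
    simp only
    rw [← integral_neg]
    refine integral_congr_ae ?_
    filter_upwards [(memLp_gradFun k).coeFn_toLp, ae_restrict_mem measurableSet_Ioo] with x hx hmem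
    rw [hx, gradFun_eq_of_deriv f g k hg hk hmem.1, inner_neg_right, RCLike.real_smul_eq_coe_mul,
      RCLike.inner_apply, RCLike.inner_apply]
    ring
  have hAlin : ∀ (f g : TestSpace 𝕜 P) (a b : 𝕜), A (a • f + b • g) = a * A f + b * A g := by
    intro f g a b
    simp only [hA]
    rw [← integral_const_mul, ← integral_const_mul,
      ← integral_add ((hAI f).const_mul a) ((hAI g).const_mul b)]
    refine integral_congr_ae (Eventually.of_forall fun x => ?_)
    simp only [TestSpace.add_apply, TestSpace.smul_apply]
    ring
  have hBlin : ∀ (f g : TestSpace 𝕜 P) (a b : 𝕜), B (a • f + b • g) = a * B f + b * B g := by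
    intro f g a b
    simp only [hB]
    rw [← integral_const_mul, ← integral_const_mul,
      ← integral_add ((hBI f).const_mul a) ((hBI g).const_mul b)]
    refine integral_congr_ae (Eventually.of_forall fun x => ?_)
    simp only [TestSpace.add_apply, TestSpace.smul_apply]
  -- Two linear functionals with ker B ⊆ ker A are proportional.
  obtain ⟨c, hc⟩ : ∃ c : 𝕜, ∀ f, A f = c * B f := by
    by_cases hex : ∃ η, B η ≠ 0
    · obtain ⟨η, hη⟩ := hex
      refine ⟨A η / B η, fun f => ?_⟩
      have h1 := hA0 (B η • f + (-B f) • η) (by rw [hBlin]; ring)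
      rw [hAlin] at h1
      field_simp
      linear_combination h1
    · push Not at hex
      exact ⟨0, fun f => by rw [hA0 f (hex f), zero_mul]⟩
  have hF := ae_eq_zero_of_forall_test P (F := fun x => inner 𝕜 (d x) ((x ^ q : ℝ) : 𝕜) - c)
    (hI.sub (integrable_const c)) (fun f => by
      have h1 := hc f
      simp only [hA, hB] at h1
      simp only [mul_sub]
      rw [integral_sub (hAI f) ((hBI f).mul_const c), h1, integral_mul_const]
      ring)
  have hval : ∀ᵐ x ∂vol01, ‖d x‖ * x ^ q = ‖c‖ := by
    filter_upwards [hF, ae_restrict_mem measurableSet_Ioo] with x hx hmem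
    have h1 := sub_eq_zero.1 hx
    rw [← h1, RCLike.inner_apply, norm_mul, RCLike.norm_ofReal, RCLike.norm_conj,
      abs_of_nonneg (Real.rpow_nonneg (le_of_lt hmem.1) _), mul_comm]
  -- Otherwise |d|² = |c|² x^(-2q) would be integrable, with exponent -2q = -(1+2σ) ≤ -1.
  have hc0 : c = 0 := by
    by_contra hne
    have hd2 := (memLp_two_iff_integrable_sq_norm (Lp.aestronglyMeasurable d)).1 (Lp.memLp d)
    have h1 : IntegrableOn (fun x : ℝ => x ^ (-(1 + 2 * P.σ))) (Ioo 0 1) := by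
      refine (hd2.mul_const (‖c‖ ^ 2)⁻¹).congr ?_
      filter_upwards [hval, ae_restrict_mem measurableSet_Ioo] with x hx hmem
      have hxq := Real.rpow_pos_of_pos hmem.1 q
      have hnc : ‖c‖ ≠ 0 := norm_ne_zero_iff.2 hne
      have e1 : x ^ (-(1 + 2 * P.σ)) = ((x ^ q) ^ 2)⁻¹ := by
        rw [← Real.rpow_mul_natCast (le_of_lt hmem.1), ← Real.rpow_neg (le_of_lt hmem.1)]
        congr 1
        rw [hq]; push_cast; ring
      have hdne : ‖d x‖ ≠ 0 := fun h0 => hnc (by rw [← hx, h0, zero_mul])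
      rw [e1, ← hx]
      field_simp
    have := (intervalIntegral.integrableOn_Ioo_rpow_iff one_pos).1 h1
    linarith [P.σ_nonneg]
  refine (Lp.eq_zero_iff_ae_eq_zero).2 ?_
  filter_upwards [hval, ae_restrict_mem measurableSet_Ioo] with x hx hmem
  rw [hc0, norm_zero] at hx
  exact norm_eq_zero.1 ((mul_eq_zero.1 hx).resolve_right (Real.rpow_pos_of_pos hmem.1 q).ne')

/-- The range is closed and its orthogonal complement is trivial. -/
lemma surjective_grad : Function.Surjective (grad 𝕜 P) := by
  set R : Submodule 𝕜 (L2 𝕜) := LinearMap.range (grad 𝕜 P).toLinearMap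
  have hR : (R : Set (L2 𝕜)) = range (grad 𝕜 P) := rfl
  have hbot : Rᗮ = ⊥ := by
    refine (Submodule.eq_bot_iff _).2 fun d hd =>
      eq_zero_of_forall_inner_gradFun (P := P) d fun f => ?_
    rw [← grad_coe]
    exact (Submodule.mem_orthogonal' _ _).1 hd _ ⟨_, rfl⟩
  have htop := (Submodule.topologicalClosure_eq_top_iff).2 hbot
  have hcl : IsClosed (R : Set (L2 𝕜)) := by rw [hR]; exact isClosed_range_grad
  rw [hcl.submodule_topologicalClosure_eq] at htop
  intro d
  have : d ∈ R := htop ▸ Submodule.mem_top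
  exact this

/-- Each test function f equals K D f, so the range of K is dense. -/
lemma injective_adjoint_volterra :
    Function.Injective (ContinuousLinearMap.adjoint (volterra 𝕜 P)) := by
  refine (injective_iff_map_eq_zero _).2 fun d hd => eq_zero_of_forall_inner_test P d fun f => ?_
  rw [← embed_coe, embed_eq_volterra_grad, ← ContinuousLinearMap.adjoint_inner_left, hd,
    inner_zero_left]

end TestFunctions

/-! ### Identification of the eigenfunctions -/

section Eigenfunctions

variable {𝕜 : Type*} [RCLike 𝕜] {P : Params}

lemma hasDerivAt_ofReal_comp {f : ℝ → ℝ} {f' x : ℝ} (h : HasDerivAt f f' x) :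
    HasDerivAt (fun x => (f x : 𝕜)) (f' : 𝕜) x :=
  (RCLike.ofRealCLM (K := 𝕜)).hasFDerivAt.comp_hasDerivAt x h

/-- A solution of the first order system whose Wronskian with the regular solution vanishes at `0`
is a multiple of the regular solution. -/
lemma exists_eq_mul_regSol {l : ℝ} (hl : 0 < l) {g v : ℝ → 𝕜}
    (hg : ∀ x ∈ Ioo (0 : ℝ) 1, HasDerivAt g (((x ^ (-(1 + 2 * P.σ)) : ℝ) : 𝕜) * v x) x)
    (hv : ∀ x ∈ Ioo (0 : ℝ) 1, HasDerivAt v (((-l * x ^ (2 * P.s) : ℝ) : 𝕜) * g x) x)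
    (hW : Tendsto (fun x => g x * (regFlux P l x : 𝕜) - (regSol P l x : 𝕜) * v x)
      (𝓝[>] 0) (𝓝 0)) :
    ∃ C : 𝕜, ∀ x ∈ Ioo (0 : ℝ) 1, g x = C * (regSol P l x : 𝕜) := by
  have hE : ∀ x ∈ Ioo (0 : ℝ) 1, HasDerivAt (fun x => (regSol P l x : 𝕜))
      (((x ^ (-(1 + 2 * P.σ)) : ℝ) : 𝕜) * (regFlux P l x : 𝕜)) x := fun x hx => by
    have := hasDerivAt_ofReal_comp (𝕜 := 𝕜) (hasDerivAt_regSol P l hx.1)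
    rwa [RCLike.ofReal_mul] at this
  have hF : ∀ x ∈ Ioo (0 : ℝ) 1, HasDerivAt (fun x => (regFlux P l x : 𝕜))
      (((-l * x ^ (2 * P.s) : ℝ) : 𝕜) * (regSol P l x : 𝕜)) x := fun x hx => by
    have := hasDerivAt_ofReal_comp (𝕜 := 𝕜) (hasDerivAt_regFlux P l hx.1)
    rwa [RCLike.ofReal_mul] at this
  have hWd : ∀ x ∈ Ioo (0 : ℝ) 1, HasDerivAt
      (fun x => g x * (regFlux P l x : 𝕜) - (regSol P l x : 𝕜) * v x) 0 x := fun x hx =>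
    (((hg x hx).mul (hF x hx)).sub ((hE x hx).mul (hv x hx))).congr_deriv (by ring)
  obtain ⟨w, hw⟩ := isOpen_Ioo.exists_is_const_of_deriv_eq_zero isPreconnected_Ioo
    (fun x hx => (hWd x hx).differentiableAt.differentiableWithinAt)
    (fun x hx => (hWd x hx).deriv)
  have hw0 : w = 0 := by
    refine tendsto_nhds_unique (tendsto_const_nhds.congr' ?_) hW
    filter_upwards [Ioo_mem_nhdsGT (zero_lt_one' ℝ)] with x hx using (hw x hx).symm
  have hN : ∀ x ∈ Ioo (0 : ℝ) 1,
      (regSol P l x : 𝕜) ^ 2 + (regFlux P l x : 𝕜) ^ 2 ≠ 0 := fun x hx => by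
    exact_mod_cast (regSol_sq_add_regFlux_sq_pos P hl hx.1).ne'
  -- The constant is the coefficient of the projection of (g, v) on (`regSol`, `regFlux`). Its
  -- denominator never vanishes, whereas g / `regSol` breaks down at the zeros of `regSol`. Its
  -- derivative is a multiple of the Wronskian, hence 0.
  have hCd : ∀ x ∈ Ioo (0 : ℝ) 1, HasDerivAt
      (fun x => ((regSol P l x : 𝕜) * g x + (regFlux P l x : 𝕜) * v x) /
        ((regSol P l x : 𝕜) ^ 2 + (regFlux P l x : 𝕜) ^ 2)) 0 x := by
    intro x hx
    have h1 := (((hE x hx).mul (hg x hx)).add ((hF x hx).mul (hv x hx))).div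
      (((hE x hx).pow 2).add ((hF x hx).pow 2)) (hN x hx)
    refine h1.congr_deriv ?_
    have h2 := hw x hx
    rw [hw0] at h2
    rw [div_eq_zero_iff]
    left
    simp only [Nat.cast_ofNat, Pi.add_apply, Pi.mul_apply, Pi.pow_apply]
    linear_combination (((x ^ (-(1 + 2 * P.σ)) : ℝ) : 𝕜) + ((-l * x ^ (2 * P.s) : ℝ) : 𝕜)) *
      ((regFlux P l x : 𝕜) ^ 2 - (regSol P l x : 𝕜) ^ 2) * h2
  obtain ⟨C, hC⟩ := isOpen_Ioo.exists_is_const_of_deriv_eq_zero isPreconnected_Ioo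
    (fun x hx => (hCd x hx).differentiableAt.differentiableWithinAt)
    (fun x hx => (hCd x hx).deriv)
  refine ⟨C, fun x hx => ?_⟩
  have h1 := hC x hx
  have h2 := hw x hx
  rw [hw0] at h2
  rw [div_eq_iff (hN x hx)] at h1
  refine mul_left_cancel₀ (hN x hx) ?_
  linear_combination (regSol P l x : 𝕜) * h1 + (regFlux P l x : 𝕜) * h2

/-! ### Green's kernel of `K K*` and the eigenvalue equation -/

/-- The integral `∫_x^1 t^(-(1+2σ)) dt`. -/
def tailInt (P : Params) (x : ℝ) : ℝ := ∫ t in x..1, t ^ (-(1 + 2 * P.σ))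

lemma hasDerivAt_tailInt (P : Params) {x : ℝ} (hx : 0 < x) :
    HasDerivAt (tailInt P) (-x ^ (-(1 + 2 * P.σ))) x := by
  have hc : ContinuousOn (fun t : ℝ => t ^ (-(1 + 2 * P.σ))) (Ioi 0) := fun t ht =>
    (Real.continuousAt_rpow_const t _ (Or.inl (ne_of_gt ht))).continuousWithinAt
  refine intervalIntegral.integral_hasDerivAt_left ?_
    (hc.stronglyMeasurableAtFilter isOpen_Ioi x hx) (hc.continuousAt (Ioi_mem_nhds hx))
  refine (hc.mono ?_).intervalIntegrable
  intro t ht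
  exact lt_of_lt_of_le (lt_min hx one_pos) ht.1

lemma inner_rhoTail_rhoTail {x y : ℝ} (hx : x ∈ Ioo (0 : ℝ) 1) (hy : y ∈ Ioo (0 : ℝ) 1) :
    inner 𝕜 (rhoTail 𝕜 P x) (rhoTail 𝕜 P y) = (tailInt P (max x y) : 𝕜) := by
  have hm : max x y < 1 := max_lt hx.2 hy.2
  rw [L2.inner_def]
  have h1 : (fun t => inner 𝕜 (rhoTail 𝕜 P x t) (rhoTail 𝕜 P y t)) =ᵐ[vol01]
      (Ioi (max x y)).indicator fun t => ((t ^ (-(1 + 2 * P.σ)) : ℝ) : 𝕜) := by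
    filter_upwards [rhoTail_ae 𝕜 P hx.1, rhoTail_ae 𝕜 P hy.1, ae_restrict_mem measurableSet_Ioo]
      with t h1 h2 ht
    rw [h1, h2, RCLike.inner_apply]
    have hr : ((t ^ (-(1 + 2 * P.σ)) : ℝ) : 𝕜) = (rho P t : 𝕜) * (rho P t : 𝕜) := by
      rw [← rho_sq P ht.1, RCLike.ofReal_mul]
    simp only [indicator_apply, mem_Ioi, max_lt_iff, hr]
    by_cases hxt : x < t <;> by_cases hyt : y < t <;> simp [hxt, hyt]
  rw [integral_congr_ae h1, integral_indicator measurableSet_Ioi,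
    Measure.restrict_restrict measurableSet_Ioi, Ioi_inter_Ioo,
    sup_eq_left.2 (hx.1.le.trans (le_max_left _ _)), integral_ofReal, tailInt,
    intervalIntegral.integral_of_le hm.le, integral_Ioc_eq_integral_Ioo]

/-- Multiplied by x^s this is (K K* u)(x), so K K* has the Green kernel x^s y^s `tailInt P (max x
y)`. -/
lemma inner_volterra_rhoTail {x : ℝ} (hx : x ∈ Ioo (0 : ℝ) 1) (u : L2 𝕜) :
    inner 𝕜 (volterra 𝕜 P (rhoTail 𝕜 P x)) u =
      ∫ y in Ioo (0 : ℝ) 1, ((y ^ P.s * tailInt P (max x y) : ℝ) : 𝕜) * u y := by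
  rw [L2.inner_def, volterra_apply]
  refine integral_congr_ae ?_
  filter_upwards [(memLp_volterraFun P (rhoTail 𝕜 P x)).coeFn_toLp,
    ae_restrict_mem measurableSet_Ioo] with y h1 hy
  rw [h1, volterraFun, inner_rhoTail_rhoTail hy hx, RCLike.inner_apply, max_comm,
    ← RCLike.ofReal_mul, RCLike.conj_ofReal, mul_comm]

lemma integrable_rpow_mul (u : L2 𝕜) {r : ℝ} (hr : 0 ≤ r) :
    IntegrableOn (fun y => ((y ^ r : ℝ) : 𝕜) * u y) (Ioo 0 1) := by
  have hu : Integrable u vol01 := (Lp.memLp u).integrable (by norm_num)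
  refine hu.bdd_mul (c := 1) ?_ ?_
  · exact (RCLike.continuous_ofReal.comp
      (Real.continuous_rpow_const hr)).aestronglyMeasurable.restrict
  · filter_upwards [ae_restrict_mem measurableSet_Ioo] with x hx
    rw [RCLike.norm_ofReal, abs_of_nonneg (Real.rpow_nonneg (le_of_lt hx.1) _)]
    exact Real.rpow_le_one (le_of_lt hx.1) (le_of_lt hx.2) hr

/-- The first order system satisfied by `g`, where `u = x^s g` and `u = l K K* u`. -/
lemma hasDerivAt_inner_rhoTail (u : L2 𝕜) (l : ℝ)
    (hu : u = volterra 𝕜 P ((l : 𝕜) • ContinuousLinearMap.adjoint (volterra 𝕜 P) u))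
    {g v : ℝ → 𝕜}
    (hg : g = fun x => inner 𝕜 (rhoTail 𝕜 P x)
      ((l : 𝕜) • ContinuousLinearMap.adjoint (volterra 𝕜 P) u))
    (hv : v = fun x => -(l : 𝕜) * ∫ y in (0 : ℝ)..x, ((y ^ (2 * P.s) : ℝ) : 𝕜) * g y) :
    IntervalIntegrable (fun y => ((y ^ (2 * P.s) : ℝ) : 𝕜) * g y) volume 0 1 ∧
    (∀ x ∈ Ioo (0 : ℝ) 1, HasDerivAt g (((x ^ (-(1 + 2 * P.σ)) : ℝ) : 𝕜) * v x) x) ∧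
    (∀ x ∈ Ioo (0 : ℝ) 1, HasDerivAt v (((-l * x ^ (2 * P.s) : ℝ) : 𝕜) * g x) x) := by
  set d := (l : 𝕜) • ContinuousLinearMap.adjoint (volterra 𝕜 P) u with hd
  have hgc : ContinuousOn g (Ioo 0 1) := by rw [hg]; exact continuousOn_inner_rhoTail d
  have hug : ∀ᵐ y ∂vol01, u y = ((y ^ P.s : ℝ) : 𝕜) * g y := by
    have h1 : u = (memLp_volterraFun P d).toLp _ := hu
    filter_upwards [(memLp_volterraFun P d).coeFn_toLp] with y hy
    rw [h1, hy, hg]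
    rfl
  have h2s : ∀ y : ℝ, 0 < y → y ^ P.s * y ^ P.s = y ^ (2 * P.s) := fun y hy => by
    rw [← Real.rpow_add hy]; congr 1; ring
  set f : ℝ → 𝕜 := fun y => ((y ^ (2 * P.s) : ℝ) : 𝕜) * g y with hf
  have hfI : IntervalIntegrable f volume 0 1 := by
    rw [intervalIntegrable_iff_integrableOn_Ioo_of_le zero_le_one]
    refine (integrable_rpow_mul u P.s_pos.le).congr ?_
    filter_upwards [hug, ae_restrict_mem measurableSet_Ioo] with y hy hmem
    rw [hy, hf, ← mul_assoc, ← RCLike.ofReal_mul, h2s y hmem.1]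
  have hfc : ContinuousOn f (Ioo 0 1) :=
    (RCLike.continuous_ofReal.comp_continuousOn (continuousOn_rpow _)).mul hgc
  have htc : ∀ x, 0 < x → ContinuousAt (fun y => (tailInt P y : 𝕜)) x := fun x hx =>
    (hasDerivAt_ofReal_comp (hasDerivAt_tailInt P hx)).continuousAt
  have hsub : ∀ {a b : ℝ}, a ∈ Icc (0 : ℝ) 1 → b ∈ Icc (0 : ℝ) 1 →
      IntervalIntegrable f volume a b := fun ha hb =>
    hfI.mono_set (by rw [uIcc_of_le zero_le_one]; exact uIcc_subset_Icc ha hb)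
  have hTI : ∀ x ∈ Ioo (0 : ℝ) 1,
      IntervalIntegrable (fun y => (tailInt P y : 𝕜) * f y) volume x 1 := by
    intro x hx
    refine (hsub ⟨hx.1.le, hx.2.le⟩ ⟨zero_le_one, le_rfl⟩).continuousOn_mul ?_
    intro y hy
    rw [uIcc_of_le hx.2.le] at hy
    exact (htc y (hx.1.trans_le hy.1)).continuousWithinAt
  have hTc : ContinuousOn (fun y => (tailInt P y : 𝕜) * f y) (Ioo 0 1) :=
    ContinuousOn.mul (fun y hy => (htc y hy.1).continuousWithinAt) hfc
  -- The kernel is split at y = x. On differentiating, the two boundary terms cancel and only the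
  -- derivative of `tailInt` remains, which gives v.
  have hformula : ∀ x ∈ Ioo (0 : ℝ) 1, g x = (l : 𝕜) * ((tailInt P x : 𝕜) *
      (∫ y in (0 : ℝ)..x, f y) + ∫ y in x..1, (tailInt P y : 𝕜) * f y) := by
    intro x hx
    have h1 : g x = (l : 𝕜) * inner 𝕜 (volterra 𝕜 P (rhoTail 𝕜 P x)) u := by
      rw [hg, hd]
      simp only
      rw [inner_smul_right, ContinuousLinearMap.adjoint_inner_right]
    rw [h1, inner_volterra_rhoTail hx]
    congr 1
    have h2 : (∫ y in Ioo (0 : ℝ) 1, ((y ^ P.s * tailInt P (max x y) : ℝ) : 𝕜) * u y) =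
        ∫ y in (0 : ℝ)..1, (tailInt P (max x y) : 𝕜) * f y := by
      rw [intervalIntegral.integral_of_le zero_le_one, integral_Ioc_eq_integral_Ioo]
      refine integral_congr_ae ?_
      filter_upwards [hug, ae_restrict_mem measurableSet_Ioo] with y hy hmem
      rw [hy, hf]
      simp only
      rw [← h2s y hmem.1]
      push_cast
      ring
    have e1 : EqOn (fun y => (tailInt P x : 𝕜) * f y)
        (fun y => (tailInt P (max x y) : 𝕜) * f y) (uIcc 0 x) := by
      intro y hy
      rw [uIcc_of_le hx.1.le] at hy
      simp only [max_eq_left hy.2]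
    have e2 : EqOn (fun y => (tailInt P y : 𝕜) * f y)
        (fun y => (tailInt P (max x y) : 𝕜) * f y) (uIcc x 1) := by
      intro y hy
      rw [uIcc_of_le hx.2.le] at hy
      simp only [max_eq_right hy.1]
    have i1 : IntervalIntegrable (fun y => (tailInt P x : 𝕜) * f y) volume 0 x :=
      (hsub ⟨le_rfl, zero_le_one⟩ ⟨hx.1.le, hx.2.le⟩).const_mul _
    rw [h2, ← intervalIntegral.integral_add_adjacent_intervals
      (i1.congr (e1.mono uIoc_subset_uIcc))
      ((hTI x hx).congr (e2.mono uIoc_subset_uIcc)), ← intervalIntegral.integral_congr e1,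
      ← intervalIntegral.integral_congr e2, intervalIntegral.integral_const_mul]
  have hV : ∀ x ∈ Ioo (0 : ℝ) 1, HasDerivAt (fun x => ∫ y in (0 : ℝ)..x, f y) (f x) x := by
    intro x hx
    exact intervalIntegral.integral_hasDerivAt_right
      (hsub ⟨le_rfl, zero_le_one⟩ ⟨hx.1.le, hx.2.le⟩)
      (hfc.stronglyMeasurableAtFilter isOpen_Ioo x hx) (hfc.continuousAt (Ioo_mem_nhds hx.1 hx.2))
  refine ⟨hfI, fun x hx => ?_, fun x hx => ?_⟩
  · have hT := intervalIntegral.integral_hasDerivAt_left (hTI x hx)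
      (hTc.stronglyMeasurableAtFilter isOpen_Ioo x hx) (hTc.continuousAt (Ioo_mem_nhds hx.1 hx.2))
    have h3 := (((hasDerivAt_ofReal_comp (𝕜 := 𝕜) (hasDerivAt_tailInt P hx.1)).mul
      (hV x hx)).add hT).const_mul (l : 𝕜)
    have h4 : HasDerivAt g _ x := h3.congr_of_eventuallyEq (by
      filter_upwards [Ioo_mem_nhds hx.1 hx.2] with y hy using hformula y hy)
    refine h4.congr_deriv ?_
    rw [hv]
    push_cast
    ring
  · rw [hv]
    refine ((hV x hx).const_mul (-(l : 𝕜))).congr_deriv ?_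
    rw [hf]
    push_cast
    ring

/-- This limit is what excludes the solutions singular at 0. By Cauchy–Schwarz |g| ≤ ‖d‖
x^(-(1/2+σ)), while the regular flux is O(x^(2-α+2σ)); the product has exponent 3/2-α+σ > 0. In the
other term `regSol` stays bounded and v is a multiple of an integral from 0 to x. -/
lemma tendsto_wronskian (d : L2 𝕜) (l : ℝ) {g v : ℝ → 𝕜}
    (hg : g = fun x => inner 𝕜 (rhoTail 𝕜 P x) d)
    (hv : v = fun x => -(l : 𝕜) * ∫ y in (0 : ℝ)..x, ((y ^ (2 * P.s) : ℝ) : 𝕜) * g y)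
    (hI : IntervalIntegrable (fun y => ((y ^ (2 * P.s) : ℝ) : 𝕜) * g y) volume 0 1) :
    Tendsto (fun x => g x * (regFlux P l x : 𝕜) - (regSol P l x : 𝕜) * v x) (𝓝[>] 0) (𝓝 0) := by
  have hIoo := Ioo_mem_nhdsGT (zero_lt_one' ℝ)
  have h1 : Tendsto (fun x => g x * (regFlux P l x : 𝕜)) (𝓝[>] 0) (𝓝 0) := by
    set K : ℝ → ℝ := fun x => ‖d‖ * x ^ (3 / 2 - P.α + P.σ) * |l / (2 - P.α)| *
      |besselEntire (P.ν + 1) (l / (2 - P.α) ^ 2 * x ^ (2 - P.α))| with hK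
    have hα := P.α_lt_one
    have hσ := P.σ_nonneg
    have hKc : Continuous K := (((continuous_const.mul (Real.continuous_rpow_const
      (by linarith))).mul continuous_const).mul ((continuous_besselEntire
        (by linarith [P.ν_nonneg])).comp (continuous_regArg P l)).abs)
    have hK0 : Tendsto K (𝓝[>] 0) (𝓝 0) := by
      have h0 := hKc.tendsto 0
      have : K 0 = 0 := by
        simp only [hK]
        rw [Real.zero_rpow (x := 3 / 2 - P.α + P.σ) (by linarith)]
        ring
      rw [this] at h0
      exact h0.mono_left nhdsWithin_le_nhds
    refine squeeze_zero_norm' ?_ hK0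
    filter_upwards [hIoo] with x hx
    have h2 : ‖g x‖ ≤ rho P x * ‖d‖ := by
      rw [hg]
      refine (norm_inner_le_norm _ _).trans ?_
      gcongr
      exact norm_rhoTail_le hx
    have h3 : rho P x * x ^ (2 - P.α + 2 * P.σ) = x ^ (3 / 2 - P.α + P.σ) := by
      unfold rho
      rw [← Real.rpow_add hx.1]; congr 1; ring
    have hx0 := Real.rpow_pos_of_pos hx.1 (2 - P.α + 2 * P.σ)
    rw [norm_mul, RCLike.norm_ofReal, regFlux, abs_mul, abs_mul, abs_neg, abs_of_pos hx0]
    simp only [hK]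
    rw [← h3]
    calc _ ≤ rho P x * ‖d‖ * (|l / (2 - P.α)| * x ^ (2 - P.α + 2 * P.σ) *
          |besselEntire (P.ν + 1) (l / (2 - P.α) ^ 2 * x ^ (2 - P.α))|) := by gcongr
      _ = _ := by ring
  have h2 : Tendsto v (𝓝[>] 0) (𝓝 0) := by
    have hc := intervalIntegral.continuousOn_primitive_interval
      ((intervalIntegrable_iff_integrableOn_Icc_of_le zero_le_one enorm_ne_top).1 hI |>.mono_set
        (uIcc_of_le (zero_le_one' ℝ)).le)
    rw [uIcc_of_le (zero_le_one' ℝ)] at hc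
    have h0 := (hc 0 ⟨le_rfl, zero_le_one⟩).tendsto
    rw [intervalIntegral.integral_same] at h0
    have h3 := (h0.mono_left
      (nhdsWithin_le_of_mem (mem_of_superset hIoo Ioo_subset_Icc_self))).const_mul
      (-(l : 𝕜))
    rw [mul_zero] at h3
    rw [hv]
    exact h3
  have h3 : Tendsto (fun x => (regSol P l x : 𝕜)) (𝓝[>] 0) (𝓝 (regSol P l 0 : 𝕜)) :=
    ((RCLike.continuous_ofReal.comp (continuous_regSol P l)).tendsto 0).mono_left
      nhdsWithin_le_nhds
  simpa using h1.sub (h3.mul h2)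

/-- The integral over (x,1) shrinks to nothing: the Dirichlet condition at 1 is built into K. -/
lemma tendsto_inner_rhoTail_one (d : L2 𝕜) :
    Tendsto (fun x => inner 𝕜 (rhoTail 𝕜 P x) d) (𝓝[<] 1) (𝓝 0) := by
  have hI : IntegrableOn (fun t => (rho P t : 𝕜) * d t) (uIcc (1 / 2) 1) := by
    rw [uIcc_of_le (by norm_num)]
    exact (integrableOn_Icc_iff_integrableOn_Ioc enorm_ne_top).2
      (integrableOn_rho_mul (by norm_num) d)
  have hc := intervalIntegral.continuousOn_primitive_interval_left hI
  rw [uIcc_of_le (by norm_num : (1 / 2 : ℝ) ≤ 1)] at hc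
  have h0 := (hc 1 ⟨by norm_num, le_rfl⟩).tendsto
  rw [intervalIntegral.integral_same] at h0
  have hmem : Ioo (1 / 2 : ℝ) 1 ∈ 𝓝[<] (1 : ℝ) := Ioo_mem_nhdsLT (by norm_num)
  refine (h0.mono_left (nhdsWithin_le_of_mem (mem_of_superset hmem Ioo_subset_Icc_self))).congr' ?_
  filter_upwards [hmem] with x hx
  exact (inner_rhoTail ⟨by linarith [hx.1], hx.2⟩ d).symm

/-- The `L²` function `u` is a multiple of the normalized eigenfunction of a zero of `J_ν`. -/
lemma exists_eigenfun_of_eq (u : L2 𝕜) (hu0 : u ≠ 0) {l : ℝ} (hl : 0 < l)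
    (hu : u = volterra 𝕜 P ((l : 𝕜) • ContinuousLinearMap.adjoint (volterra 𝕜 P) u)) :
    ∃ c ∈ besselZeros P.ν, eigOf P c = l ∧
      ∃ C : 𝕜, ∀ᵐ x ∂vol01, u x = C * (eigenfun P c x : 𝕜) := by
  set d := (l : 𝕜) • ContinuousLinearMap.adjoint (volterra 𝕜 P) u
  set g : ℝ → 𝕜 := fun x => inner 𝕜 (rhoTail 𝕜 P x) d with hg
  set v : ℝ → 𝕜 := fun x => -(l : 𝕜) * ∫ y in (0 : ℝ)..x, ((y ^ (2 * P.s) : ℝ) : 𝕜) * g y with hv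
  obtain ⟨hI, h1, h2⟩ := hasDerivAt_inner_rhoTail u l hu hg hv
  obtain ⟨C, hC⟩ := exists_eq_mul_regSol hl h1 h2 (tendsto_wronskian d l hg hv hI)
  have hug : ∀ᵐ y ∂vol01, u y = ((y ^ P.s : ℝ) : 𝕜) * (C * (regSol P l y : 𝕜)) := by
    have h1 : u = (memLp_volterraFun P d).toLp _ := hu
    filter_upwards [(memLp_volterraFun P d).coeFn_toLp, ae_restrict_mem measurableSet_Ioo]
      with y hy hmem
    rw [h1, hy, ← hC y hmem]
    rfl
  have hC0 : C ≠ 0 := by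
    rintro rfl
    refine hu0 ((Lp.eq_zero_iff_ae_eq_zero).2 ?_)
    filter_upwards [hug] with y hy
    simpa using hy
  have hone : regSol P l 1 = 0 := by
    have hlim : Tendsto (fun x => C * (regSol P l x : 𝕜)) (𝓝[<] 1) (𝓝 (C * (regSol P l 1 : 𝕜))) :=
      ((continuous_const.mul (RCLike.continuous_ofReal.comp (continuous_regSol P l))).tendsto
        1).mono_left nhdsWithin_le_nhds
    have hlim2 : Tendsto (fun x => C * (regSol P l x : 𝕜)) (𝓝[<] 1) (𝓝 0) := by
      refine (tendsto_inner_rhoTail_one (P := P) d).congr' ?_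
      filter_upwards [Ioo_mem_nhdsLT (zero_lt_one' ℝ)] with x hx using hC x hx
    have := tendsto_nhds_unique hlim hlim2
    exact_mod_cast (mul_eq_zero.1 this).resolve_left hC0
  have hα := P.two_sub_pos
  -- The positive solution of `eigOf P c = l`.
  set c : ℝ := 2 / (2 - P.α) * √l with hc
  have hcpos : 0 < c := by positivity
  have heig : eigOf P c = l := by
    unfold eigOf
    rw [hc, mul_pow, Real.sq_sqrt hl.le]
    field_simp
  have hJ : besselJ P.ν c = 0 := by rw [← regSol_one P hcpos, heig]; exact hone
  set κ : ℝ := √(2 - P.α) / |deriv (besselJ P.ν) c| * (c / 2) ^ P.ν with hκ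
  have hκ0 : κ ≠ 0 := by
    have := abs_pos.2 (deriv_besselJ_ne_zero P hcpos hJ)
    positivity
  refine ⟨c, ⟨hcpos, hJ⟩, heig, C / κ, ?_⟩
  filter_upwards [hug, ae_restrict_mem measurableSet_Ioo] with y hy hmem
  rw [hy, eigenfun_eq P hcpos hmem.1, heig, ← hκ]
  have : (κ : 𝕜) ≠ 0 := by exact_mod_cast hκ0
  push_cast
  field_simp

end Eigenfunctions

/-! ### The orthonormal basis of `L²(0,1)` and the orthogonal basis of `H^{1,μ}_{α,0}(0,1)` -/

section ScalarBasis

variable {𝕜 : Type*} [RCLike 𝕜] {P : Params}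

lemma continuousOn_eigenfun (P : Params) {c : ℝ} (hc : 0 ≤ c) :
    ContinuousOn (eigenfun P c) (Icc 0 1) := by
  have h1 := P.α_lt_one
  unfold eigenfun
  refine ContinuousOn.mul (continuousOn_const.mul
    (Real.continuous_rpow_const (by linarith)).continuousOn) ?_
  refine (continuousOn_besselJ P.ν P.ν_nonneg (c + 1) (by linarith)).comp
    (continuous_const.mul (Real.continuous_rpow_const (by linarith))).continuousOn ?_
  intro x hx
  have hx1 : x ^ ((2 - P.α) / 2) ≤ 1 := Real.rpow_le_one hx.1 hx.2 (by linarith)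
  have hx0 : 0 ≤ x ^ ((2 - P.α) / 2) := Real.rpow_nonneg hx.1 _
  exact ⟨by positivity, by nlinarith⟩

lemma memLp_eigenfun (𝕜 : Type*) [RCLike 𝕜] (P : Params) {c : ℝ} (hc : 0 ≤ c) :
    MemLp (fun x => (eigenfun P c x : 𝕜)) 2 vol01 := by
  have h := RCLike.continuous_ofReal (K := 𝕜).comp_continuousOn (continuousOn_eigenfun P hc)
  obtain ⟨C, hC⟩ := isCompact_Icc.exists_bound_of_continuousOn h
  refine MemLp.of_bound ((h.mono Ioo_subset_Icc_self).aestronglyMeasurable measurableSet_Ioo) C ?_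
  exact (ae_restrict_mem measurableSet_Ioo).mono fun x hx => hC x (Ioo_subset_Icc_self hx)

/-- The normalized eigenfunctions as elements of `L²(0,1)`. -/
def eigL2 (𝕜 : Type*) [RCLike 𝕜] (P : Params) (c : besselZeros P.ν) : L2 𝕜 :=
  (memLp_eigenfun 𝕜 P c.2.1.le).toLp _

lemma eigL2_ae (c : besselZeros P.ν) :
    eigL2 𝕜 P c =ᵐ[vol01] fun x => (eigenfun P c x : 𝕜) := MemLp.coeFn_toLp _

lemma orthonormal_eigL2 (𝕜 : Type*) [RCLike 𝕜] (P : Params) : Orthonormal 𝕜 (eigL2 𝕜 P) := by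
  classical
  rw [orthonormal_iff_ite]
  intro c d
  have h := integral_eigenfun_mul P c.2.1 d.2.1 c.2.2 d.2.2
  have h1 : inner 𝕜 (eigL2 𝕜 P c) (eigL2 𝕜 P d) =
      ((∫ x in Ioo (0 : ℝ) 1, eigenfun P c x * eigenfun P d x : ℝ) : 𝕜) := by
    rw [L2.inner_def, ← integral_ofReal]
    refine integral_congr_ae ?_
    filter_upwards [eigL2_ae (𝕜 := 𝕜) c, eigL2_ae (𝕜 := 𝕜) d] with x hc hd
    rw [hc, hd, RCLike.inner_apply, RCLike.conj_ofReal, RCLike.ofReal_mul, mul_comm]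
  rw [h1, h]
  simp only [Subtype.ext_iff]
  split_ifs <;> simp

/-! ### Spectral theorem for `K K*` and completeness of the eigenfunctions -/

/-- The operator `K K*`. -/
def greenOp (𝕜 : Type*) [RCLike 𝕜] (P : Params) : L2 𝕜 →L[𝕜] L2 𝕜 :=
  (volterra 𝕜 P).comp (ContinuousLinearMap.adjoint (volterra 𝕜 P))

/-- From ⟨K K* u, u⟩ = ‖K* u‖² and the injectivity of K* the eigenvalue is real and positive, with
inverse l = ‖u‖²/‖K* u‖². The analysis of the differential equation then applies with this l. -/
lemma exists_eigL2_of_mem_eigenspace {m : 𝕜} {u : L2 𝕜}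
    (hu : u ∈ Module.End.eigenspace (greenOp 𝕜 P).toLinearMap m) (hu0 : u ≠ 0) :
    ∃ (c : besselZeros P.ν) (C : 𝕜), u = C • eigL2 𝕜 P c ∧
      u = volterra 𝕜 P ((eigOf P c : 𝕜) • ContinuousLinearMap.adjoint (volterra 𝕜 P) u) := by
  have h1 : volterra 𝕜 P (ContinuousLinearMap.adjoint (volterra 𝕜 P) u) = m • u :=
    Module.End.mem_eigenspace_iff.1 hu
  set w := ContinuousLinearMap.adjoint (volterra 𝕜 P) u with hw
  have hw0 : w ≠ 0 := fun h => hu0 (injective_adjoint_volterra (P := P) (by rw [map_zero, ← hw, h]))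
  have hwn : 0 < ‖w‖ := norm_pos_iff.2 hw0
  have hun : 0 < ‖u‖ := norm_pos_iff.2 hu0
  have h2 : (‖w‖ : 𝕜) ^ 2 = m * (‖u‖ : 𝕜) ^ 2 := by
    rw [← inner_self_eq_norm_sq_to_K (𝕜 := 𝕜) w, ← inner_self_eq_norm_sq_to_K (𝕜 := 𝕜) u,
      ← inner_smul_right, ← h1]
    nth_rewrite 1 [hw]
    exact ContinuousLinearMap.adjoint_inner_left _ _ _
  set l : ℝ := ‖u‖ ^ 2 / ‖w‖ ^ 2 with hl
  have hlm : (l : 𝕜) * m = 1 := by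
    have hwn' : (‖w‖ : 𝕜) ≠ 0 := by exact_mod_cast hwn.ne'
    rw [hl]
    push_cast
    field_simp
    rw [h2]; ring
  have hul : u = volterra 𝕜 P ((l : 𝕜) • w) := by
    rw [map_smul, h1, smul_smul, hlm, one_smul]
  obtain ⟨c, hc, hcl, C, hC⟩ := exists_eigenfun_of_eq u hu0 (by positivity) hul
  refine ⟨⟨c, hc⟩, C, ?_, by rw [hcl]; exact hul⟩
  refine Lp.ext ?_
  filter_upwards [hC, Lp.coeFn_smul C (eigL2 𝕜 P ⟨c, hc⟩),
    eigL2_ae (𝕜 := 𝕜) (⟨c, hc⟩ : besselZeros P.ν)]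
    with x h3 h4 h5
  rw [h3, h4, Pi.smul_apply, h5, smul_eq_mul]

lemma orthogonal_iSup_eigenspace_greenOp (𝕜 : Type*) [RCLike 𝕜] (P : Params) :
    (⨆ m : 𝕜, Module.End.eigenspace (greenOp 𝕜 P).toLinearMap m)ᗮ = ⊥ := by
  refine ContinuousLinearMap.orthogonalComplement_iSup_eigenspaces_eq_bot ?_ ?_
  · exact (isCompactOperator_volterra 𝕜 P).comp_clm _
  · exact (IsSelfAdjoint.mul_star_self (volterra 𝕜 P)).isSymmetric

lemma orthogonal_span_eigL2 (𝕜 : Type*) [RCLike 𝕜] (P : Params) :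
    (Submodule.span 𝕜 (range (eigL2 𝕜 P)))ᗮ = ⊥ := by
  rw [eq_bot_iff, ← orthogonal_iSup_eigenspace_greenOp 𝕜 P]
  refine Submodule.orthogonal_le (iSup_le fun m u hu => ?_)
  by_cases hu0 : u = 0
  · rw [hu0]; exact Submodule.zero_mem _
  · obtain ⟨c, C, h, -⟩ := exists_eigL2_of_mem_eigenspace hu hu0
    rw [h]
    exact Submodule.smul_mem _ _ (Submodule.subset_span ⟨c, rfl⟩)

/-- Orthogonality replaces a direct verification. If the equation failed at c, no eigenvector would
be a multiple of the eigenfunction of c; all eigenvectors would be multiples of the others, hence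
orthogonal to it, and by the spectral theorem this unit vector would be 0. -/
lemma eigL2_eq_volterra (c : besselZeros P.ν) :
    eigL2 𝕜 P c = volterra 𝕜 P ((eigOf P c : 𝕜) •
      ContinuousLinearMap.adjoint (volterra 𝕜 P) (eigL2 𝕜 P c)) := by
  by_contra hcon
  have hon := orthonormal_eigL2 𝕜 P
  have hmem : eigL2 𝕜 P c ∈ (⨆ m : 𝕜, Module.End.eigenspace (greenOp 𝕜 P).toLinearMap m)ᗮ := by
    rw [← Submodule.iInf_orthogonal, Submodule.mem_iInf]
    intro m
    rw [Submodule.mem_orthogonal]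
    intro u hu
    by_cases hu0 : u = 0
    · rw [hu0, inner_zero_left]
    obtain ⟨d, C, h, h'⟩ := exists_eigL2_of_mem_eigenspace hu hu0
    have hC : C ≠ 0 := by rintro rfl; exact hu0 (by rw [h, zero_smul])
    have hdc : d ≠ c := by
      rintro rfl
      apply hcon
      rw [h] at h'
      simp only [map_smul] at h' ⊢
      rw [smul_comm] at h'
      exact smul_right_injective _ hC h'
    rw [h, inner_smul_left, hon.2 hdc, mul_zero]
  rw [orthogonal_iSup_eigenspace_greenOp, Submodule.mem_bot] at hmem
  have := hon.1 c
  rw [hmem, norm_zero] at this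
  exact zero_ne_one this

/-- With finitely many zeros, the dense span of the eigenfunctions would be finite-dimensional,
hence closed, hence all of L². But each of its elements has a representative tending to 0 at 1, and
the constant 1 has none. -/
lemma infinite_besselZeros (P : Params) : (besselZeros P.ν).Infinite := by
  intro hfin
  have : Finite (besselZeros P.ν) := hfin
  set R := Submodule.span ℝ (range (eigL2 ℝ P)) with hR
  have hfd : FiniteDimensional ℝ R := FiniteDimensional.span_of_finite ℝ (finite_range _)
  have htop : R = ⊤ := by
    have := (Submodule.topologicalClosure_eq_top_iff).2 (orthogonal_span_eigL2 ℝ P)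
    rwa [(Submodule.closed_of_finiteDimensional R).submodule_topologicalClosure_eq] at this
  have hR' : ∀ u ∈ R, ∃ f : ℝ → ℝ, u =ᵐ[vol01] f ∧ Tendsto f (𝓝[<] 1) (𝓝 0) := by
    intro u hu
    induction hu using Submodule.span_induction with
    | mem u hu =>
      obtain ⟨c, rfl⟩ := hu
      refine ⟨eigenfun P c, eigL2_ae (𝕜 := ℝ) c, ?_⟩
      have h1 : eigenfun P c 1 = 0 := by
        unfold eigenfun
        rw [Real.one_rpow, Real.one_rpow, mul_one, mul_one, c.2.2, mul_zero]
      have h2 := (continuousOn_eigenfun P c.2.1.le 1 ⟨zero_le_one, le_rfl⟩).tendsto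
      rw [h1] at h2
      exact h2.mono_left (nhdsWithin_le_of_mem
        (mem_of_superset (Ioo_mem_nhdsLT zero_lt_one) Ioo_subset_Icc_self))
    | zero => exact ⟨0, Lp.coeFn_zero _ _ _, tendsto_const_nhds⟩
    | add u v _ _ hu hv =>
      obtain ⟨f, hf, hf'⟩ := hu
      obtain ⟨g, hg, hg'⟩ := hv
      exact ⟨f + g, (Lp.coeFn_add u v).trans (hf.add hg), by
        have h := hf'.add hg'
        rw [add_zero] at h
        exact h⟩
    | smul a u _ hu =>
      obtain ⟨f, hf, hf'⟩ := hu
      exact ⟨a • f, (Lp.coeFn_smul a u).trans (hf.const_smul a), by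
        have h := hf'.const_smul a
        rw [smul_zero] at h
        exact h⟩
  have hm1 : MemLp (fun _ : ℝ => (1 : ℝ)) 2 vol01 := memLp_const 1
  obtain ⟨f, hf, hf'⟩ := hR' (hm1.toLp _) (htop ▸ Submodule.mem_top)
  have hev := hf'.eventually (gt_mem_nhds (zero_lt_one' ℝ))
  obtain ⟨a, ha, hsub⟩ := (mem_nhdsLT_iff_exists_Ioo_subset).1 hev
  have hae : ∀ᵐ x ∂vol01, x ∉ Ioo (max a 0) 1 := by
    filter_upwards [hf, hm1.coeFn_toLp] with x h1 h2 hx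
    have h3 : f x < 1 := hsub ⟨(le_max_left _ _).trans_lt hx.1, hx.2⟩
    rw [← h1, h2] at h3
    exact lt_irrefl _ h3
  rw [ae_iff] at hae
  simp only [not_not, ofPred_mem_eq] at hae
  rw [Measure.restrict_apply measurableSet_Ioo, Ioo_inter_Ioo, max_eq_left (le_max_right a 0),
    min_self, Real.volume_Ioo, ENNReal.ofReal_eq_zero] at hae
  have : max a 0 < 1 := max_lt ha zero_lt_one
  linarith

/-- The `n`-th zero as an element of the set of zeros. -/
def zeroIdx (P : Params) (n : ℕ) : besselZeros P.ν :=
  ⟨besselZero P.ν n, besselZero_mem P (infinite_besselZeros P) n⟩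

lemma phi_eq_eigL2 (n : ℕ) : phi 𝕜 P n = eigL2 𝕜 P (zeroIdx P n) := rfl

lemma injective_zeroIdx (P : Params) : Function.Injective (zeroIdx P) := fun _ _ h =>
  (strictMono_besselZero P (infinite_besselZeros P)).injective (congrArg Subtype.val h)

lemma range_phi (𝕜 : Type*) [RCLike 𝕜] (P : Params) : range (phi 𝕜 P) = range (eigL2 𝕜 P) := by
  refine Subset.antisymm (range_subset_iff.2 fun n => ⟨zeroIdx P n, rfl⟩)
    (range_subset_iff.2 fun c => ?_)
  obtain ⟨n, hn⟩ := exists_besselZero_eq P (infinite_besselZeros P) c.2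
  exact ⟨n, by rw [phi_eq_eigL2]; congr 1; exact Subtype.ext hn⟩

lemma orthonormal_phi (𝕜 : Type*) [RCLike 𝕜] (P : Params) : Orthonormal 𝕜 (phi 𝕜 P) := by
  have h : phi 𝕜 P = eigL2 𝕜 P ∘ zeroIdx P := funext fun n => phi_eq_eigL2 n
  rw [h]
  exact (orthonormal_eigL2 𝕜 P).comp _ (injective_zeroIdx P)

/-- The Hilbert basis `Φ_n` of `L²(0,1)`. -/
def phiBasis (𝕜 : Type*) [RCLike 𝕜] (P : Params) : HilbertBasis ℕ 𝕜 (L2 𝕜) :=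
  HilbertBasis.mkOfOrthogonalEqBot (orthonormal_phi 𝕜 P)
    (by rw [range_phi]; exact orthogonal_span_eigL2 𝕜 P)

lemma coe_phiBasis (𝕜 : Type*) [RCLike 𝕜] (P : Params) : ⇑(phiBasis 𝕜 P) = phi 𝕜 P :=
  HilbertBasis.coe_mkOfOrthogonalEqBot _ _

lemma pairing_phi (n : ℕ) (f : L2 𝕜) : pairing (phi 𝕜 P n) f = inner 𝕜 (phi 𝕜 P n) f := by
  rw [L2.inner_def]
  refine integral_congr_ae ?_
  filter_upwards [eigL2_ae (𝕜 := 𝕜) (zeroIdx P n)] with x hx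
  rw [phi_eq_eigL2, hx, RCLike.inner_apply, RCLike.conj_ofReal, mul_comm]

lemma inner_phi (n k : ℕ) : inner 𝕜 (phi 𝕜 P n) (phi 𝕜 P k) = if n = k then 1 else 0 := by
  rw [← coe_phiBasis]
  exact orthonormal_iff_ite.1 (phiBasis 𝕜 P).orthonormal n k

/-! ### The eigenfunctions in the energy space -/

/-- `1` plus the `n`-th eigenvalue. -/
def shiftedEig (P : Params) (n : ℕ) : ℝ := 1 + eigOf P (besselZero P.ν n)

lemma shiftedEig_pos (P : Params) (n : ℕ) : 0 < shiftedEig P n := by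
  have := eigOf_pos P (zeroIdx P n).2.1
  exact add_pos one_pos this

/-- Membership in H¹ comes from the surjectivity of D: solve D h = λ K* Φ_n, so that h = K D h = Φ_n
in L². The weak equation follows from ⟨λ K* Φ_n, D k⟩ = λ ⟨Φ_n, K D k⟩ = λ ⟨Φ_n, k⟩. -/
lemma exists_phiH1 (𝕜 : Type*) [RCLike 𝕜] (P : Params) (n : ℕ) :
    ∃ h : H1 𝕜 P, embed 𝕜 P h = phi 𝕜 P n ∧
      ∀ k : H1 𝕜 P, inner 𝕜 h k = (shiftedEig P n : 𝕜) * inner 𝕜 (phi 𝕜 P n) (embed 𝕜 P k) := by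
  obtain ⟨h, hh⟩ := surjective_grad (P := P) ((eigOf P (besselZero P.ν n) : 𝕜) •
    ContinuousLinearMap.adjoint (volterra 𝕜 P) (phi 𝕜 P n))
  have he : embed 𝕜 P h = phi 𝕜 P n := by
    rw [embed_eq_volterra_grad, hh]
    exact (eigL2_eq_volterra (𝕜 := 𝕜) (zeroIdx P n)).symm
  refine ⟨h, he, fun k => ?_⟩
  rw [inner_eq_add, he, hh, inner_smul_left, ContinuousLinearMap.adjoint_inner_left,
    ← embed_eq_volterra_grad, RCLike.conj_ofReal, shiftedEig]
  push_cast
  ring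

/-- `Φ_n` as an element of `H^{1,μ}_{α,0}(0,1)`. -/
def phiH1 (𝕜 : Type*) [RCLike 𝕜] (P : Params) (n : ℕ) : H1 𝕜 P := (exists_phiH1 𝕜 P n).choose

lemma embed_phiH1 (n : ℕ) : embed 𝕜 P (phiH1 𝕜 P n) = phi 𝕜 P n :=
  (exists_phiH1 𝕜 P n).choose_spec.1

lemma inner_phiH1 (n : ℕ) (k : H1 𝕜 P) :
    inner 𝕜 (phiH1 𝕜 P n) k = (shiftedEig P n : 𝕜) * inner 𝕜 (phi 𝕜 P n) (embed 𝕜 P k) :=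
  (exists_phiH1 𝕜 P n).choose_spec.2 k

/-- The normalization of `phiH1`. -/
def unitH1 (𝕜 : Type*) [RCLike 𝕜] (P : Params) (n : ℕ) : H1 𝕜 P :=
  (((√(shiftedEig P n))⁻¹ : ℝ) : 𝕜) • phiH1 𝕜 P n

lemma phiH1_eq_smul (n : ℕ) : phiH1 𝕜 P n = ((√(shiftedEig P n) : ℝ) : 𝕜) • unitH1 𝕜 P n := by
  have h := (Real.sqrt_pos.2 (shiftedEig_pos P n)).ne'
  rw [unitH1, smul_smul, ← RCLike.ofReal_mul, mul_inv_cancel₀ h, RCLike.ofReal_one, one_smul]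

lemma inner_unitH1 (n : ℕ) (k : H1 𝕜 P) : inner 𝕜 (unitH1 𝕜 P n) k =
    ((√(shiftedEig P n) : ℝ) : 𝕜) * inner 𝕜 (phi 𝕜 P n) (embed 𝕜 P k) := by
  have h := (Real.sqrt_pos.2 (shiftedEig_pos P n)).ne'
  have h2 := Real.mul_self_sqrt (shiftedEig_pos P n).le
  rw [unitH1, inner_smul_left, RCLike.conj_ofReal, inner_phiH1, ← mul_assoc, ← RCLike.ofReal_mul]
  congr 2
  nth_rewrite 2 [← h2]
  field_simp

lemma orthonormal_unitH1 (𝕜 : Type*) [RCLike 𝕜] (P : Params) : Orthonormal 𝕜 (unitH1 𝕜 P) := by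
  rw [orthonormal_iff_ite]
  intro n k
  have h := (Real.sqrt_pos.2 (shiftedEig_pos P n)).ne'
  rw [inner_unitH1, unitH1, map_smul, embed_phiH1, inner_smul_right, inner_phi]
  split_ifs with hnk
  · rw [← hnk, mul_one, ← RCLike.ofReal_mul, mul_inv_cancel₀ h, RCLike.ofReal_one]
  · rw [mul_zero, mul_zero]

/-- By the weak equation, orthogonality to Φ_n in H¹ is orthogonality in L², where the Φ_n are
complete; `embed` is injective. -/
lemma orthogonal_span_unitH1 (𝕜 : Type*) [RCLike 𝕜] (P : Params) :
    (Submodule.span 𝕜 (range (unitH1 𝕜 P)))ᗮ = ⊥ := by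
  refine (Submodule.eq_bot_iff _).2 fun k hk => embed_injective 𝕜 P ?_
  rw [map_zero, ← Submodule.mem_bot 𝕜]
  have h0 := (Submodule.topologicalClosure_eq_top_iff).1 (phiBasis 𝕜 P).dense_span
  rw [← h0, coe_phiBasis]
  refine fun u hu => ?_
  induction hu using Submodule.span_induction with
  | mem u hu =>
    obtain ⟨n, rfl⟩ := hu
    have h1 := hk (unitH1 𝕜 P n) (Submodule.subset_span ⟨n, rfl⟩)
    rw [inner_unitH1] at h1
    have h := (Real.sqrt_pos.2 (shiftedEig_pos P n)).ne'
    exact (mul_eq_zero.1 h1).resolve_left (by exact_mod_cast h)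
  | zero => exact inner_zero_left _
  | add u v _ _ hu hv => rw [inner_add_left, hu, hv, add_zero]
  | smul a u _ hu => rw [inner_smul_left, hu, mul_zero]

/-- The Hilbert basis of `H^{1,μ}_{α,0}(0,1)` given by the normalized `Φ_n`. -/
def basisH1 (𝕜 : Type*) [RCLike 𝕜] (P : Params) : HilbertBasis ℕ 𝕜 (H1 𝕜 P) :=
  HilbertBasis.mkOfOrthogonalEqBot (orthonormal_unitH1 𝕜 P) (orthogonal_span_unitH1 𝕜 P)

lemma coe_basisH1 (𝕜 : Type*) [RCLike 𝕜] (P : Params) : ⇑(basisH1 𝕜 P) = unitH1 𝕜 P :=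
  HilbertBasis.coe_mkOfOrthogonalEqBot _ _

/-! ### Scalar Schauder bases of the energy space and of its dual -/

lemma toDual_phi_apply (n : ℕ) (k : H1 𝕜 P) :
    toDual P (phi 𝕜 P n) k = inner 𝕜 (phi 𝕜 P n) (embed 𝕜 P k) := by
  rw [toDual_apply, pairing_phi]

lemma toDual_phi_phiH1 (n m : ℕ) : toDual P (phi 𝕜 P n) (phiH1 𝕜 P m) = if n = m then 1 else 0 := by
  rw [toDual_phi_apply, embed_phiH1, inner_phi]

/-- The unconditional Schauder basis `Φ_n` of `H^{1,μ}_{α,0}(0,1)`. -/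
def schauderH1 (𝕜 : Type*) [RCLike 𝕜] (P : Params) : UnconditionalSchauderBasis ℕ 𝕜 (H1 𝕜 P) where
  basis := phiH1 𝕜 P
  -- The factor 1+λ_n of the weak equation cancels against the squared H¹ norm of Φ_n, which leaves
  -- the L² coefficient. So the coordinates are the Φ_n viewed in the dual, and these form the basis
  -- of H⁻¹.
  coord n := toDual P (phi 𝕜 P n)
  ortho n m := by simp [toDual_phi_phiH1, Pi.single_apply]
  expansion k := by
    have h := (basisH1 𝕜 P).hasSum_repr k
    refine h.congr_fun fun n => ?_
    rw [(basisH1 𝕜 P).repr_apply_apply, coe_basisH1, inner_unitH1, toDual_phi_apply,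
      phiH1_eq_smul, smul_smul, mul_comm]

end ScalarBasis

/-- Expand the Riesz representative of F. Its coefficients are the conjugates of F(b_i), and the
conjugate linearity of the Riesz isomorphism undoes the conjugation. -/
lemma _root_.HilbertBasis.hasSum_dual {𝕜 E ι : Type*} [RCLike 𝕜] [NormedAddCommGroup E]
    [InnerProductSpace 𝕜 E] [CompleteSpace E] (b : HilbertBasis ι 𝕜 E) (F : StrongDual 𝕜 E) :
    HasSum (fun i => F (b i) • innerSL 𝕜 (b i)) F := by
  have h := (b.hasSum_repr ((InnerProductSpace.toDual 𝕜 E).symm F)).map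
    (InnerProductSpace.toDual 𝕜 E) (InnerProductSpace.toDual 𝕜 E).continuous
  rw [LinearIsometryEquiv.apply_symm_apply] at h
  refine h.congr_fun fun i => ?_
  simp only [Function.comp, map_smulₛₗ, b.repr_apply_apply, inner_conj_symm]
  rw [InnerProductSpace.toDual_symm_apply]
  rfl

/-- The unconditional Schauder basis `Φ_n` of `H^{-1,μ}_α(0,1)`. -/
def schauderDual (𝕜 : Type*) [RCLike 𝕜] (P : Params) :
    UnconditionalSchauderBasis ℕ 𝕜 (StrongDual 𝕜 (H1 𝕜 P)) where
  basis n := toDual P (phi 𝕜 P n)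
  coord n := ContinuousLinearMap.apply 𝕜 𝕜 (phiH1 𝕜 P n)
  ortho n m := by
    simp [toDual_phi_phiH1, Pi.single_apply, eq_comm]
  expansion F := by
    refine ((basisH1 𝕜 P).hasSum_dual F).congr_fun fun n => ?_
    ext k
    simp only [coe_basisH1, ContinuousLinearMap.apply_apply, smul_apply, smul_eq_mul,
      innerSL_apply_apply, inner_unitH1, toDual_phi_apply]
    rw [phiH1_eq_smul, map_smul, smul_eq_mul]
    ring

/-! ### Passing from scalar to vector valued functions -/

section Vector

variable {𝕜 : Type*} [RCLike 𝕜]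

/-! ### Eigenvalues and eigenvectors of the coupling matrix -/

lemma eig1_add_eig2 (a₁ a₂ : ℝ) : eig1 𝕜 a₁ a₂ + eig2 𝕜 a₁ a₂ = a₂ := by
  unfold eig1 eig2
  split_ifs
  · push_cast; ring
  · ring

/-- In the case of a negative discriminant the identity I² = -1 is needed; `RCLike.I` is 0 over a
real field, which is why nonvanishing of `RCLike.I` is required there. -/
lemma eig1_mul_eig2 {a₁ a₂ : ℝ}
    (hA : 0 < a₂ ^ 2 + 4 * a₁ ∨ (a₂ ^ 2 + 4 * a₁ < 0 ∧ (RCLike.I : 𝕜) ≠ 0)) :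
    eig1 𝕜 a₁ a₂ * eig2 𝕜 a₁ a₂ = -a₁ := by
  unfold eig1 eig2
  rcases hA with h | ⟨h, hI⟩
  · rw [if_pos h, if_pos h, ← RCLike.ofReal_mul]
    have := Real.sq_sqrt h.le
    rw [← RCLike.ofReal_neg]
    congr 1
    linear_combination -this / 4
  · rw [if_neg h.not_gt, if_neg h.not_gt]
    have h1 := congrArg (fun r : ℝ => (r : 𝕜)) (Real.sq_sqrt (neg_nonneg.2 h.le))
    have hI2 : (RCLike.I : 𝕜) * RCLike.I = -1 := RCLike.I_mul_I_of_nonzero hI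
    push_cast at h1
    linear_combination -((√(-(a₂ ^ 2 + 4 * a₁)) : ℝ) : 𝕜) ^ 2 / 4 * hI2 + h1 / 4

/-- The square of the difference is the discriminant. -/
lemma eig2_sub_eig1_ne_zero {a₁ a₂ : ℝ}
    (hA : 0 < a₂ ^ 2 + 4 * a₁ ∨ (a₂ ^ 2 + 4 * a₁ < 0 ∧ (RCLike.I : 𝕜) ≠ 0)) :
    eig2 𝕜 a₁ a₂ - eig1 𝕜 a₁ a₂ ≠ 0 := by
  intro h
  have h1 := eig1_add_eig2 (𝕜 := 𝕜) a₁ a₂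
  have h2 := eig1_mul_eig2 hA
  have h3 : ((a₂ ^ 2 + 4 * a₁ : ℝ) : 𝕜) = 0 := by
    push_cast
    linear_combination (eig2 𝕜 a₁ a₂ - eig1 𝕜 a₁ a₂) * h + 4 * h2 -
      (a₂ + eig1 𝕜 a₁ a₂ + eig2 𝕜 a₁ a₂) * h1
  have h4 : a₂ ^ 2 + 4 * a₁ = 0 := by exact_mod_cast h3
  rcases hA with h | h
  · exact h.ne' h4
  · exact h.1.ne h4

/-- Since α₁α₂ = -a₁, the two quantities are α₁(α₁-α₂) and α₂(α₂-α₁). They are the denominators in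
`vecU` and `vecV`. -/
lemma eig_sq_add_ne_zero {a₁ a₂ : ℝ} (ha₁ : a₁ ≠ 0)
    (hA : 0 < a₂ ^ 2 + 4 * a₁ ∨ (a₂ ^ 2 + 4 * a₁ < 0 ∧ (RCLike.I : 𝕜) ≠ 0)) :
    eig1 𝕜 a₁ a₂ ^ 2 + a₁ ≠ 0 ∧ eig2 𝕜 a₁ a₂ ^ 2 + a₁ ≠ 0 := by
  have h2 := eig1_mul_eig2 hA
  have h3 := eig2_sub_eig1_ne_zero hA
  have ha : (a₁ : 𝕜) ≠ 0 := by exact_mod_cast ha₁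
  have he1 : eig1 𝕜 a₁ a₂ ≠ 0 := fun h => ha (by linear_combination -eig2 𝕜 a₁ a₂ * h + h2)
  have he2 : eig2 𝕜 a₁ a₂ ≠ 0 := fun h => ha (by linear_combination -eig1 𝕜 a₁ a₂ * h + h2)
  constructor
  · intro h
    refine mul_ne_zero he1 h3 ?_
    linear_combination h2 - h
  · intro h
    refine mul_ne_zero he2 h3 ?_
    linear_combination h - h2

/-- The vectors `U_i` and `V_j` are biorthogonal. -/
lemma vecU_dot_vecV {a₁ a₂ : ℝ} (ha₁ : a₁ ≠ 0)
    (hA : 0 < a₂ ^ 2 + 4 * a₁ ∨ (a₂ ^ 2 + 4 * a₁ < 0 ∧ (RCLike.I : 𝕜) ≠ 0)) (i j : Fin 2) :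
    ∑ c, vecU 𝕜 a₁ a₂ i c * vecV 𝕜 a₁ a₂ j c = if i = j then 1 else 0 := by
  have h2 := eig1_mul_eig2 hA
  obtain ⟨h4, h5⟩ := eig_sq_add_ne_zero ha₁ hA
  have ha : (a₁ : 𝕜) ≠ 0 := by exact_mod_cast ha₁
  fin_cases i <;> fin_cases j <;> simp [vecU, vecV, Fin.sum_univ_two] <;> field_simp <;>
    first | ring1 | linear_combination h2 | linear_combination (a₁ : 𝕜) * h2

/-! ### Mixing two scalar copies by a biorthogonal system -/

/-- Biorthogonal systems `U`, `V` of vectors of `𝕜²`. -/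
def Biorthogonal (U V : Fin 2 → Fin 2 → 𝕜) : Prop :=
  ∀ i j, ∑ c, U i c * V j c = if i = j then 1 else 0

/-- For square matrices U Vᵀ = 1 implies Vᵀ U = 1. Biorthogonality thus yields the resolution of the
identity used in the expansions. -/
lemma Biorthogonal.sum_eq {U V : Fin 2 → Fin 2 → 𝕜} (h : Biorthogonal U V) (c d : Fin 2) :
    ∑ i, U i c * V i d = if c = d then 1 else 0 := by
  have h1 : Matrix.of U * (Matrix.of V).transpose = 1 := by
    ext i j
    rw [Matrix.mul_apply, Matrix.one_apply, ← h i j]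
    rfl
  have h2 : ((Matrix.of V).transpose * Matrix.of U) d c = (1 : Matrix (Fin 2) (Fin 2) 𝕜) d c := by
    rw [mul_eq_one_comm.1 h1]
  rw [Matrix.mul_apply, Matrix.one_apply] at h2
  simp only [Matrix.transpose_apply, Matrix.of_apply] at h2
  simp only [mul_comm (U _ c), h2, eq_comm]

lemma Biorthogonal.symm {U V : Fin 2 → Fin 2 → 𝕜} (h : Biorthogonal U V) : Biorthogonal V U := by
  intro i j
  simp only [mul_comm (V i _), h j i, eq_comm]

section Transform

variable {X : Type*} [NormedAddCommGroup X] [NormedSpace 𝕜 X]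

/-- The operator `(f₁, f₂) ↦ f₁ U₁ + f₂ U₂`. -/
def mixing (X : Type*) [NormedAddCommGroup X] [NormedSpace 𝕜 X] (U : Fin 2 → Fin 2 → 𝕜) :
    PiLp 2 (fun _ : Fin 2 => X) →L[𝕜] PiLp 2 (fun _ : Fin 2 => X) :=
  (PiLp.continuousLinearEquiv 2 𝕜 fun _ : Fin 2 => X).symm.toContinuousLinearMap.comp
    ((ContinuousLinearMap.pi fun c => ∑ i, U i c • ContinuousLinearMap.proj i).comp
      (PiLp.continuousLinearEquiv 2 𝕜 fun _ : Fin 2 => X).toContinuousLinearMap)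

lemma mixing_apply (U : Fin 2 → Fin 2 → 𝕜) (f : PiLp 2 (fun _ : Fin 2 => X)) (c : Fin 2) :
    mixing X U f c = ∑ i, U i c • f i := by
  simp [mixing]

/-- The operator `mixing X U` as an equivalence. -/
def Biorthogonal.mixingEquiv {U V : Fin 2 → Fin 2 → 𝕜} (h : Biorthogonal U V) (X : Type*)
    [NormedAddCommGroup X] [NormedSpace 𝕜 X] :
    PiLp 2 (fun _ : Fin 2 => X) ≃L[𝕜] PiLp 2 (fun _ : Fin 2 => X) :=
  ContinuousLinearEquiv.equivOfInverse (mixing X U) (mixing X fun c i => V i c)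
    (fun f => by
      ext i
      simp only [mixing_apply, Finset.smul_sum, smul_smul]
      rw [Finset.sum_comm]
      simp only [← Finset.sum_smul, mul_comm (V i _), h _ i]
      simp)
    (fun f => by
      ext c
      simp only [mixing_apply, Finset.smul_sum, smul_smul]
      rw [Finset.sum_comm]
      simp only [← Finset.sum_smul, h.sum_eq c]
      simp)

lemma Biorthogonal.mixingEquiv_apply {U V : Fin 2 → Fin 2 → 𝕜} (h : Biorthogonal U V)
    (f : PiLp 2 (fun _ : Fin 2 => X)) (c : Fin 2) : h.mixingEquiv X f c = ∑ i, U i c • f i :=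
  mixing_apply U f c

lemma hasSum_prod_fin_two {F : Type*} [NormedAddCommGroup F] {f : ℕ × Fin 2 → F} {a : Fin 2 → F}
    (h : ∀ i, HasSum (fun n => f (n, i)) (a i)) : HasSum f (∑ i, a i) := by
  have h1 : ∀ i ∈ Finset.univ, HasSum (fun p : ℕ × Fin 2 => if p.2 = i then f p else 0) (a i) := by
    intro i _
    have hinj : Function.Injective fun n : ℕ => (n, i) := fun m n hmn => congrArg Prod.fst hmn
    rw [← hinj.hasSum_iff]
    · simpa [Function.comp_def] using h i
    · rintro ⟨n, j⟩ hj
      rw [if_neg]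
      rintro rfl
      exact hj ⟨n, rfl⟩
  refine (hasSum_sum h1).congr_fun fun p => ?_
  simp

/-- The Schauder basis `U_i b_n` of `X²` obtained from a basis `b_n` of `X`. -/
def Biorthogonal.schauderBasis {U V : Fin 2 → Fin 2 → 𝕜} (h : Biorthogonal U V)
    (b : UnconditionalSchauderBasis ℕ 𝕜 X) : SchauderBasis 𝕜 (PiLp 2 (fun _ : Fin 2 => X)) where
  basis k := WithLp.toLp 2 fun c => U (idx k).2 c • b (idx k).1
  coord k := ∑ c, V (idx k).2 c • (b.coord (idx k).1).comp (PiLp.proj 2 (fun _ : Fin 2 => X) c)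
  ortho k l := by
    have h1 : b.coord (idx k).1 (b (idx l).1) = if (idx k).1 = (idx l).1 then 1 else 0 := by
      simp [b.ortho, Pi.single_apply]
    have h2 := h (idx l).2 (idx k).2
    have h3 : (k = l) ↔ ((idx k).1 = (idx l).1 ∧ (idx l).2 = (idx k).2) := by
      rw [← idx.injective.eq_iff, Prod.ext_iff, eq_comm (a := (idx k).2)]
    have h4 : (∑ c, V (idx k).2 c • (b.coord (idx k).1).comp
        (PiLp.proj 2 (fun _ : Fin 2 => X) c)) (WithLp.toLp 2 fun c => U (idx l).2 c • b (idx l).1) =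
        (∑ c, U (idx l).2 c * V (idx k).2 c) * b.coord (idx k).1 (b (idx l).1) := by
      simp only [sum_apply, smul_apply, ContinuousLinearMap.comp_apply, PiLp.proj_apply, map_smul,
        smul_eq_mul, Finset.sum_mul]
      exact Finset.sum_congr rfl fun c _ => by ring
    refine h4.trans ?_
    rw [h1, h2]
    rcases eq_or_ne k l with rfl | hkl
    · simp
    · by_cases hp : (idx k).1 = (idx l).1
      · have hq : (idx l).2 ≠ (idx k).2 := fun hq => hkl (h3.2 ⟨hp, hq⟩)
        simp [hkl, hq]
      · simp [hkl, hp]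
  expansion F := by
    -- Convergence along initial segments follows from unconditional summability, which is
    -- insensitive to the enumeration `idx`.
    refine Filter.Tendsto.mono_left (?_ : HasSum _ F) SummationFilter.le_atTop
    set T := PiLp.continuousLinearEquiv 2 𝕜 fun _ : Fin 2 => X
    rw [← T.symm_apply_apply F]
    refine HasSum.mapL (φ := T.symm.toContinuousLinearMap) (f := fun k => fun c =>
      (∑ c', V (idx k).2 c' • (b.coord (idx k).1) (F c')) • (U (idx k).2 c • b (idx k).1)) ?_
      |>.congr_fun fun k => ?_
    · rw [Pi.hasSum]
      intro c
      have h1 : ∀ i : Fin 2, HasSum (fun n => (∑ c', V i c' • b.coord n (F c')) • (U i c • b n))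
          (∑ c', (U i c * V i c') • F c') := by
        intro i
        have h2 := hasSum_sum fun (c' : Fin 2) (_ : c' ∈ Finset.univ) =>
          (b.expansion (F c')).const_smul (U i c * V i c')
        refine h2.congr_fun fun n => ?_
        rw [Finset.sum_smul]
        refine Finset.sum_congr rfl fun c' _ => ?_
        rw [smul_smul, smul_smul, smul_eq_mul]
        congr 1
        ring
      have h3 := hasSum_prod_fin_two (f := fun p : ℕ × Fin 2 =>
        (∑ c', V p.2 c' • b.coord p.1 (F c')) • (U p.2 c • b p.1)) h1
      -- Summing over i first, the resolution of the identity collapses the double sum to F c.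
      rw [Finset.sum_comm] at h3
      simp only [← Finset.sum_smul, h.sum_eq c] at h3
      simp only [ite_smul, one_smul, zero_smul, Finset.sum_ite_eq, Finset.mem_univ, if_true] at h3
      exact (idx.hasSum_iff (f := fun p : ℕ × Fin 2 =>
        (∑ c', V p.2 c' • b.coord p.1 (F c')) • (U p.2 c • b p.1))).2 h3
    · ext c
      simp [T]

lemma Biorthogonal.schauderBasis_apply {U V : Fin 2 → Fin 2 → 𝕜} (h : Biorthogonal U V)
    (b : UnconditionalSchauderBasis ℕ 𝕜 X) (k : ℕ) :
    h.schauderBasis b k = WithLp.toLp 2 fun c => U (idx k).2 c • b (idx k).1 := rfl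

end Transform

variable {P : Params}

/-! ### The vector valued families in `L²(0,1)²` -/

/-- The orthonormal family `Φ_n e_i` of `L²(0,1)²`. -/
def unitL2sq (𝕜 : Type*) [RCLike 𝕜] (P : Params) (k : ℕ × Fin 2) : L2sq 𝕜 :=
  WithLp.toLp 2 (Pi.single k.2 (phi 𝕜 P k.1))

lemma inner_unitL2sq (k : ℕ × Fin 2) (f : L2sq 𝕜) :
    inner 𝕜 (unitL2sq 𝕜 P k) f = inner 𝕜 (phi 𝕜 P k.1) (f k.2) := by
  rw [PiLp.inner_apply, Finset.sum_eq_single k.2]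
  · simp [unitL2sq]
  · intro c _ hc
    simp [unitL2sq, hc]
  · simp

/-- The Hilbert basis `Φ_n e_i` of `L²(0,1)²`. -/
def basisL2sq (𝕜 : Type*) [RCLike 𝕜] (P : Params) : HilbertBasis (ℕ × Fin 2) 𝕜 (L2sq 𝕜) :=
  HilbertBasis.mkOfOrthogonalEqBot (v := unitL2sq 𝕜 P)
    (by
      rw [orthonormal_iff_ite]
      rintro ⟨n, i⟩ ⟨m, j⟩
      rw [inner_unitL2sq]
      simp only [unitL2sq, Prod.mk.injEq]
      by_cases hij : i = j
      · subst hij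
        simp [inner_phi]
      · simp [hij])
    (by
      refine (Submodule.eq_bot_iff _).2 fun f hf => ?_
      have h1 : ∀ (n : ℕ) (i : Fin 2), inner 𝕜 (phi 𝕜 P n) (f i) = 0 := fun n i => by
        rw [← inner_unitL2sq (n, i)]
        exact hf _ (Submodule.subset_span ⟨(n, i), rfl⟩)
      ext1 i
      refine (phiBasis 𝕜 P).repr.map_eq_zero_iff.1 (lp.ext (funext fun n => ?_))
      rw [(phiBasis 𝕜 P).repr_apply_apply, coe_phiBasis, h1]
      rfl)

lemma coe_basisL2sq : ⇑(basisL2sq 𝕜 P) = unitL2sq 𝕜 P := HilbertBasis.coe_mkOfOrthogonalEqBot _ _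

/-- The mixing automorphism sends the orthonormal vector Φ_n e_i to U_i Φ_n. -/
lemma Biorthogonal.isRieszBasis {U V : Fin 2 → Fin 2 → 𝕜} (h : Biorthogonal U V) (P : Params) :
    IsRieszBasis 𝕜 fun k : ℕ × Fin 2 =>
      (WithLp.toLp 2 fun c => U k.2 c • phi 𝕜 P k.1 : L2sq 𝕜) := by
  refine ⟨basisL2sq 𝕜 P, h.mixingEquiv (L2 𝕜), fun k => ?_⟩
  ext1 c
  rw [h.mixingEquiv_apply, coe_basisL2sq, Finset.sum_eq_single k.2]
  · simp [unitL2sq]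
  · intro i _ hi
    simp [unitL2sq, hi]
  · simp

/-- A continuous surjection maps dense sets to dense sets. -/
lemma IsRieszBasis.topologicalClosure_span {ι E : Type*} [NormedAddCommGroup E]
    [InnerProductSpace 𝕜 E] {f : ι → E} (h : IsRieszBasis 𝕜 f) :
    (Submodule.span 𝕜 (range f)).topologicalClosure = ⊤ := by
  obtain ⟨e, T, hT⟩ := h
  have hf : f = T ∘ e := funext hT
  have h1 : Dense (Submodule.span 𝕜 (range e) : Set E) :=
    (Submodule.dense_iff_topologicalClosure_eq_top).2 e.dense_span
  rw [← Submodule.dense_iff_topologicalClosure_eq_top, hf, range_comp]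
  have h2 : (Submodule.span 𝕜 (T '' range e) : Set E) =
      T '' (Submodule.span 𝕜 (range e) : Set E) := by
    have := Submodule.span_image (s := range e) T.toLinearEquiv.toLinearMap
    exact congrArg (fun S : Submodule 𝕜 E => (S : Set E)) this
  rw [h2]
  exact T.surjective.denseRange.dense_image T.continuous h1

lemma biorthogonal_vecU_vecV {a₁ a₂ : ℝ} (ha₁ : a₁ ≠ 0)
    (hA : 0 < a₂ ^ 2 + 4 * a₁ ∨ (a₂ ^ 2 + 4 * a₁ < 0 ∧ (RCLike.I : 𝕜) ≠ 0)) :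
    Biorthogonal (vecU 𝕜 a₁ a₂) (vecV 𝕜 a₁ a₂) := vecU_dot_vecV ha₁ hA

/-- The inclusion is linear, not conjugate linear: the `star` in `toDual` compensates the
conjugation of the inner product. -/
lemma toDual_smul (c : 𝕜) (f : L2 𝕜) : toDual P (c • f) = c • toDual P f := by
  ext h
  rw [smul_apply, toDual_apply, toDual_apply]
  unfold pairing
  rw [smul_eq_mul, ← integral_const_mul]
  refine integral_congr_ae ?_
  filter_upwards [Lp.coeFn_smul c f] with x hx
  rw [hx, Pi.smul_apply, smul_eq_mul, mul_assoc]

lemma pairingSq_family {a₁ a₂ : ℝ} (ha₁ : a₁ ≠ 0)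
    (hA : 0 < a₂ ^ 2 + 4 * a₁ ∨ (a₂ ^ 2 + 4 * a₁ < 0 ∧ (RCLike.I : 𝕜) ≠ 0)) (k l : ℕ × Fin 2) :
    pairingSq (familyB 𝕜 P a₁ a₂ k) (familyBstar 𝕜 P a₁ a₂ l) = if k = l then 1 else 0 := by
  have h1 : ∀ c, pairing (familyB 𝕜 P a₁ a₂ k c) (familyBstar 𝕜 P a₁ a₂ l c) =
      vecU 𝕜 a₁ a₂ k.2 c * vecV 𝕜 a₁ a₂ l.2 c * inner 𝕜 (phi 𝕜 P k.1) (phi 𝕜 P l.1) := by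
    intro c
    rw [← pairing_phi]
    unfold pairing
    rw [← integral_const_mul]
    refine integral_congr_ae ?_
    filter_upwards [Lp.coeFn_smul (vecU 𝕜 a₁ a₂ k.2 c) (phi 𝕜 P k.1),
      Lp.coeFn_smul (vecV 𝕜 a₁ a₂ l.2 c) (phi 𝕜 P l.1)] with x h1 h2
    simp only [familyB, familyBstar, h1, h2, Pi.smul_apply, smul_eq_mul]
    ring
  simp only [pairingSq, h1]
  rw [← Finset.sum_mul, vecU_dot_vecV ha₁ hA, inner_phi]
  simp only [Prod.ext_iff]
  by_cases hp : k.1 = l.1 <;> by_cases hq : k.2 = l.2 <;> simp [hp, hq]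

end Vector

end DegSing

end

theorem proposition3p6 (𝕜 : Type*) [RCLike 𝕜] (P : DegSing.Params) (a₁ a₂ : ℝ) (ha₁ : a₁ ≠ 0)
    (hA : 0 < a₂ ^ 2 + 4 * a₁ ∨ (a₂ ^ 2 + 4 * a₁ < 0 ∧ (RCLike.I : 𝕜) ≠ 0)) :
    -- `ℬ` and `ℬ*` are biorthogonal in `L²(0,1)²`
    (∀ k l : ℕ × Fin 2,
      DegSing.pairingSq (DegSing.familyB 𝕜 P a₁ a₂ k) (DegSing.familyBstar 𝕜 P a₁ a₂ l)
        = if k = l then 1 else 0) ∧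
    -- `ℬ` and `ℬ*` are complete in `L²(0,1)²`
    ((Submodule.span 𝕜 (Set.range (DegSing.familyB 𝕜 P a₁ a₂))).topologicalClosure = ⊤ ∧
      (Submodule.span 𝕜 (Set.range (DegSing.familyBstar 𝕜 P a₁ a₂))).topologicalClosure = ⊤) ∧
    -- `ℬ` and `ℬ*` are Riesz bases of `L²(0,1)²`
    (DegSing.IsRieszBasis 𝕜 (DegSing.familyB 𝕜 P a₁ a₂) ∧
      DegSing.IsRieszBasis 𝕜 (DegSing.familyBstar 𝕜 P a₁ a₂)) ∧
    -- `ℬ*` lies in `H^{1,μ}_{α,0}(0,1)²` and is a basis of it,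
    ∃ b : SchauderBasis 𝕜 (DegSing.H1sq 𝕜 P),
      (∀ k : ℕ, DegSing.embedSq (b k) = DegSing.familyBstar 𝕜 P a₁ a₂ (DegSing.idx k)) ∧
      -- and `ℬ` is biorthogonal to it for the duality pairing and a basis of `H^{-1,μ}_α(0,1)²`
      (∀ k l : ℕ, DegSing.dualPairing
        (DegSing.toDualSq P (DegSing.familyB 𝕜 P a₁ a₂ (DegSing.idx k))) (b l)
          = if k = l then 1 else 0) ∧
      ∃ d : SchauderBasis 𝕜 (DegSing.Hneg1sq 𝕜 P),
        ∀ k : ℕ, d k = DegSing.toDualSq P (DegSing.familyB 𝕜 P a₁ a₂ (DegSing.idx k)) := by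
  have hUV := DegSing.biorthogonal_vecU_vecV ha₁ hA
  have hB : DegSing.IsRieszBasis 𝕜 (DegSing.familyB 𝕜 P a₁ a₂) := hUV.isRieszBasis P
  have hBs : DegSing.IsRieszBasis 𝕜 (DegSing.familyBstar 𝕜 P a₁ a₂) := hUV.symm.isRieszBasis P
  have hemb : ∀ k : ℕ, DegSing.embedSq (hUV.symm.schauderBasis (DegSing.schauderH1 𝕜 P) k) =
      DegSing.familyBstar 𝕜 P a₁ a₂ (DegSing.idx k) := by
    intro k
    ext1 c
    rw [hUV.symm.schauderBasis_apply]
    change DegSing.embed 𝕜 P (DegSing.vecV 𝕜 a₁ a₂ (DegSing.idx k).2 c •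
      DegSing.phiH1 𝕜 P (DegSing.idx k).1) = _
    rw [map_smul, DegSing.embed_phiH1]
    rfl
  refine ⟨DegSing.pairingSq_family ha₁ hA,
    ⟨hB.topologicalClosure_span, hBs.topologicalClosure_span⟩, ⟨hB, hBs⟩,
    hUV.symm.schauderBasis (DegSing.schauderH1 𝕜 P), hemb, fun k l => ?_,
    hUV.schauderBasis (DegSing.schauderDual 𝕜 P), fun k => ?_⟩
  -- On elements of L² the duality pairing is the L² pairing, so this is the first assertion read
  -- along `idx`.
  · have h1 := DegSing.pairingSq_family (P := P) ha₁ hA (DegSing.idx k) (DegSing.idx l)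
    rw [← hemb l] at h1
    simp only [DegSing.idx.injective.eq_iff] at h1
    rw [← h1]
    exact Finset.sum_congr rfl fun c _ => DegSing.toDual_apply P _ _
  · rw [hUV.schauderBasis_apply]
    ext1 c
    exact (DegSing.toDual_smul _ _).symm
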